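/- **Setting.** Let $d\ge 1$. For $n\ge 0$ let $H_n(t)=(-1)^n e^{t^2}\frac{d^n}{dt^n}e^{-t^2}$ and $h_n(t)=(2^n n!\sqrt{\pi})^{-1/2}H_n(t)e^{-t^2/2}$, and for $\beta\in\mathbb{N}_0^d$ let $\mathcal{H}_\beta(x)=\prod_{i=1}^d h_{\beta_i}(x_i)$, $x\in\mathbb{R}^d$, $|\beta|=\beta_1+\dots+\beta_d$. Put $$\mathcal{H}_n(x,y)=\sum_{|\beta|=n}\mathcal{H}_\beta(x)\mathcal{H}_\beta(y),\qquad W_n=\operatorname{span}_{\mathbb{C}}\{\mathcal{H}_\beta:|\beta|=n\},\qquad V_n=\bigoplus_{j=0}^n W_j .$$ Let $\widehat a$ be a complex-valued $C^\infty$ function with $\operatorname{supp}\widehat a\subset[1/4,4]$ and $|\widehat a|>c_0$ on $[1/3,3]$ for some constant $c_0>0$, and set $$\Phi_0=\mathcal{H}_0,\qquad \Phi_j=\sum_{\nu=0}^\infty\widehat a\Big(\frac{\nu}{4^{j-1}}\Big)\mathcal{H}_\nu\quad(j\ge1).$$ For a tempered distribution $f\in\mathcal{S}'(\mathbb{R}^d)$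 let $(\Phi_j*f)(x)=f(\Phi_j(x,\cdot))$, which is $\int\Phi_j(x,y)f(y)\,dy$ when $f$ is a function in $L^p$. The Hermite Besov space $B^{\alpha q}_p$ is the set of all $f\in\mathcal{S}'(\mathbb{R}^d)$ with $$\|f\|_{B^{\alpha q}_p}=\Big(\sum_{j=0}^\infty\big(2^{\alpha j}\|\Phi_j*f\|_p\big)^q\Big)^{1/q}<\infty .$$ For $f\in L^p(\mathbb{R}^d)$ let $E_n(f)_p=\inf_{g\in V_n}\|f-g\|_p$. The approximation space $A^{s,q}_p$ is the set of all $f\in L^p(\mathbb{R}^d)$ with $$\|f\|_{A^{s,q}_p}=\|f\|_p+\Big(\sum_{j=0}^\infty\big(2^{sj}E_{2^j}(f)_p\big)^q\Big)^{1/q}<\infty .$$ In both cases the $\ell^q$-norm is replaced by the supremum when $q=\infty$. **Proposition 5.7.** Let $\alpha>0$, $1\le p\le\infty$, $0<q\le\infty$, and let $\widehat a$ be as above. Then $B^{\alpha q}_p=A^{\alpha/2,q}_p$, where $f\in L^p$ is identified with the tempered distribution $\phi\mapsto\int f\phi\,dx$. Moreover, there are constants $c,C>0$, depending only on $d,\alpha,p,q,\widehat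 a$, such that for all $f$ in this space $$c\,\|f\|_{A^{\alpha/2,q}_p}\le\|f\|_{B^{\alpha q}_p}\le C\,\|f\|_{A^{\alpha/2,q}_p}.$$ -/

import Mathlib

open MeasureTheory
open scoped SchwartzMap ENNReal ContDiff

namespace HermiteBesov

noncomputable section

/-! ### Hermite functions -/

/-- The (physicists') Hermite polynomial
`H_n(t) = (-1)^n e^{t^2} (d/dt)^n e^{-t^2}` as a function on `ℝ`. -/
def hermiteH (n : ℕ) (t : ℝ) : ℝ :=
  (-1) ^ n * Real.exp (t ^ 2) * iteratedDeriv n (fun s : ℝ => Real.exp (-s ^ 2)) t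

/-- The `L²`-normalized Hermite function
`h_n(t) = (2^n n! √π)^{-1/2} H_n(t) e^{-t^2/2}`. -/
def hermiteFn (n : ℕ) (t : ℝ) : ℝ :=
  (Real.sqrt (2 ^ n * (n.factorial : ℝ) * Real.sqrt Real.pi))⁻¹ * hermiteH n t *
    Real.exp (-(t ^ 2 / 2))

theorem hermiteH_eq (n : ℕ) (t : ℝ) :
    hermiteH n t = Real.sqrt 2 ^ n *
      Polynomial.aeval (Real.sqrt 2 * t) (Polynomial.hermite n) := by
  have h2 : Real.sqrt 2 ^ 2 = 2 := Real.sq_sqrt (by norm_num)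
  have hfun : (fun s : ℝ => Real.exp (-s ^ 2)) =
      fun s : ℝ => (fun y : ℝ => Real.exp (-(y ^ 2 / 2))) (Real.sqrt 2 * s) := by
    funext s
    simp only [mul_pow, h2]
    congr 1
    ring
  have hsm : ContDiff ℝ n (fun y : ℝ => Real.exp (-(y ^ 2 / 2))) := by fun_prop
  rw [hermiteH, hfun, iteratedDeriv_comp_const_mul hsm, Polynomial.hermite_eq_deriv_gaussian',
    iteratedDeriv_eq_iterate, mul_pow, h2]
  have : (2 : ℝ) * t ^ 2 / 2 = t ^ 2 := by ring
  rw [this]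
  ring

/-- The Gaussian `e^{-|x|²/2}` as a Schwartz function. -/
def gaussianSchwartz (d : ℕ) : 𝓢(EuclideanSpace ℝ (Fin d), ℝ) where
  toFun x := Real.exp (-(‖x‖ ^ 2 / 2))
  smooth' := by
    have : ContDiff ℝ ∞ (fun x : EuclideanSpace ℝ (Fin d) => ‖x‖ ^ 2) := contDiff_norm_sq ℝ
    fun_prop
  decay' k n := by
    have hN : ContDiff ℝ ∞ (fun x : EuclideanSpace ℝ (Fin d) => ‖x‖ ^ 2) := contDiff_norm_sq ℝ
    have hf : Function.HasTemperateGrowth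
        (fun x : EuclideanSpace ℝ (Fin d) => -(‖x‖ ^ 2 / 2)) := by
      have h : Function.HasTemperateGrowth
          (fun x : EuclideanSpace ℝ (Fin d) => (-(1 / 2 : ℝ)) * ‖x‖ ^ 2) :=
        (Function.HasTemperateGrowth.const _).mul (Function.hasTemperateGrowth_norm_sq _)
      have he : (fun x : EuclideanSpace ℝ (Fin d) => -(‖x‖ ^ 2 / 2)) =
          fun x => (-(1 / 2 : ℝ)) * ‖x‖ ^ 2 := by
        funext x
        ring
      rw [he]
      exact h
    obtain ⟨m, C, hC0, hC⟩ := hf.norm_iteratedFDeriv_le_uniform n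
    set K : ℝ := max C 1 with hK
    refine ⟨n.factorial * K ^ n * ((k + m * n).factorial * Real.exp (3 / 2)), fun x => ?_⟩
    have hx0 : 0 ≤ ‖x‖ := norm_nonneg x
    have h1 : (1 : ℝ) ≤ 1 + ‖x‖ := by linarith
    have hK1 : 1 ≤ K := le_max_right _ _
    have hD1 : 1 ≤ K * (1 + ‖x‖) ^ m := one_le_mul_of_one_le_of_one_le hK1 (one_le_pow₀ h1)
    have hb := norm_iteratedFDeriv_comp_le (𝕜 := ℝ) (g := Real.exp)
      (f := fun x : EuclideanSpace ℝ (Fin d) => -(‖x‖ ^ 2 / 2)) (n := n) (N := ∞)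
      Real.contDiff_exp hf.1 (by exact_mod_cast le_top) x
      (C := Real.exp (-(‖x‖ ^ 2 / 2))) (D := K * (1 + ‖x‖) ^ m)
      (by
        intro i _
        rw [norm_iteratedFDeriv_eq_norm_iteratedDeriv, iteratedDeriv_eq_iterate,
          Real.iter_deriv_exp, Real.norm_eq_abs, abs_of_pos (Real.exp_pos _)])
      (by
        intro i hi hin
        calc _ ≤ C * (1 + ‖x‖) ^ m := hC i hin x
          _ ≤ K * (1 + ‖x‖) ^ m := by gcongr; exact le_max_left _ _
          _ ≤ (K * (1 + ‖x‖) ^ m) ^ i := le_self_pow₀ hD1 (by omega))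
    have hexp : (1 + ‖x‖) ^ (k + m * n) * Real.exp (-(‖x‖ ^ 2 / 2)) ≤
        (k + m * n).factorial * Real.exp (3 / 2) := by
      have hp := Real.pow_div_factorial_le_exp (1 + ‖x‖) (by linarith) (k + m * n)
      rw [div_le_iff₀ (by positivity)] at hp
      calc _ ≤ (Real.exp (1 + ‖x‖) * (k + m * n).factorial) * Real.exp (-(‖x‖ ^ 2 / 2)) := by
            gcongr
        _ = (k + m * n).factorial * Real.exp (1 + ‖x‖ + -(‖x‖ ^ 2 / 2)) := by
            rw [Real.exp_add (1 + ‖x‖)]; ring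
        _ ≤ _ := by
            gcongr
            nlinarith [sq_nonneg (‖x‖ - 1)]
    have hb' : ‖iteratedFDeriv ℝ n
        (fun x : EuclideanSpace ℝ (Fin d) => Real.exp (-(‖x‖ ^ 2 / 2))) x‖ ≤
        n.factorial * Real.exp (-(‖x‖ ^ 2 / 2)) * (K * (1 + ‖x‖) ^ m) ^ n := hb
    calc _ ≤ (1 + ‖x‖) ^ k *
          (n.factorial * Real.exp (-(‖x‖ ^ 2 / 2)) * (K * (1 + ‖x‖) ^ m) ^ n) := by
          gcongr
          linarith
      _ = n.factorial * K ^ n * ((1 + ‖x‖) ^ (k + m * n) * Real.exp (-(‖x‖ ^ 2 / 2))) := by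
          rw [pow_add, pow_mul, mul_pow]; ring
      _ ≤ _ := by gcongr

theorem hasTemperateGrowth_finset_prod {E ι : Type*} [NormedAddCommGroup E] [NormedSpace ℝ E]
    (s : Finset ι) (f : ι → E → ℝ) (hf : ∀ i, (f i).HasTemperateGrowth) :
    Function.HasTemperateGrowth (fun x => ∏ i ∈ s, f i x) := by
  classical
  induction s using Finset.induction_on with
  | empty => simp [Function.HasTemperateGrowth.const]
  | insert a s ha ih =>
    simp only [Finset.prod_insert ha]
    exact (hf a).mul ih

theorem hasTemperateGrowth_hermiteH {d : ℕ} (n : ℕ) (i : Fin d) :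
    Function.HasTemperateGrowth (fun x : EuclideanSpace ℝ (Fin d) => hermiteH n (x i)) := by
  have hcoord : Function.HasTemperateGrowth (fun x : EuclideanSpace ℝ (Fin d) => x i) := by
    have h := (EuclideanSpace.proj i : EuclideanSpace ℝ (Fin d) →L[ℝ] ℝ).hasTemperateGrowth
    exact h
  simp only [hermiteH_eq, Polynomial.aeval_eq_sum_range]
  have hterm : ∀ k : ℕ, Function.HasTemperateGrowth (fun x : EuclideanSpace ℝ (Fin d) =>
      (Polynomial.hermite n).coeff k • (Real.sqrt 2 * x i) ^ k) := by
    intro k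
    simp only [zsmul_eq_mul]
    have h1 : Function.HasTemperateGrowth (fun x : EuclideanSpace ℝ (Fin d) =>
        Real.sqrt 2 * x i) := (Function.HasTemperateGrowth.const (Real.sqrt 2)).mul hcoord
    exact (Function.HasTemperateGrowth.const (((Polynomial.hermite n).coeff k : ℤ) : ℝ)).mul
      (h1.pow k)
  have hsum : Function.HasTemperateGrowth (fun x : EuclideanSpace ℝ (Fin d) =>
      ∑ k ∈ Finset.range ((Polynomial.hermite n).natDegree + 1),
        (Polynomial.hermite n).coeff k • (Real.sqrt 2 * x i) ^ k) :=
    Function.HasTemperateGrowth.sum fun k _ => hterm k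
  exact (Function.HasTemperateGrowth.const (Real.sqrt 2 ^ n)).mul hsum

theorem exists_schwartz_hermite {d : ℕ} (α : Fin d → ℕ) :
    ∃ F : 𝓢(EuclideanSpace ℝ (Fin d), ℂ), ∀ x, F x = ((∏ i, hermiteFn (α i) (x i) : ℝ) : ℂ) := by
  have hg : Function.HasTemperateGrowth (fun x : EuclideanSpace ℝ (Fin d) =>
      ∏ i, ((Real.sqrt (2 ^ (α i) * ((α i).factorial : ℝ) * Real.sqrt Real.pi))⁻¹ *
        hermiteH (α i) (x i))) :=
    hasTemperateGrowth_finset_prod _ _ fun i =>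
      (Function.HasTemperateGrowth.const _).mul (hasTemperateGrowth_hermiteH _ i)
  refine ⟨SchwartzMap.postcompCLM (𝕜 := ℝ) Complex.ofRealCLM
    (SchwartzMap.smulLeftCLM ℝ (fun x : EuclideanSpace ℝ (Fin d) =>
      ∏ i, ((Real.sqrt (2 ^ (α i) * ((α i).factorial : ℝ) * Real.sqrt Real.pi))⁻¹ *
        hermiteH (α i) (x i))) (gaussianSchwartz d)), fun x => ?_⟩
  rw [SchwartzMap.postcompCLM_apply, SchwartzMap.smulLeftCLM_apply_apply hg]
  have : gaussianSchwartz d x = ∏ i, Real.exp (-(x i ^ 2 / 2)) := by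
    rw [← Real.exp_sum]
    change Real.exp (-(‖x‖ ^ 2 / 2)) = _
    rw [EuclideanSpace.real_norm_sq_eq, Finset.sum_neg_distrib, Finset.sum_div]
  simp only [this, smul_eq_mul, Complex.ofRealCLM_apply, hermiteFn, Finset.prod_mul_distrib]

/-- The `d`-dimensional Hermite function `ℋ_α(x) = h_{α₁}(x₁) ⋯ h_{α_d}(x_d)`,
as an element of the Schwartz space. -/
def hermiteS {d : ℕ} (α : Fin d → ℕ) : 𝓢(EuclideanSpace ℝ (Fin d), ℂ) where
  toFun x := ((∏ i, hermiteFn (α i) (x i) : ℝ) : ℂ)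
  smooth' := by
    obtain ⟨F, hF⟩ := exists_schwartz_hermite α
    rw [← funext hF]
    exact F.smooth'
  decay' := by
    obtain ⟨F, hF⟩ := exists_schwartz_hermite α
    rw [← funext hF]
    exact F.decay'

@[simp]
theorem hermiteS_apply {d : ℕ} (α : Fin d → ℕ) (x : EuclideanSpace ℝ (Fin d)) :
    hermiteS α x = ((∏ i, hermiteFn (α i) (x i) : ℝ) : ℂ) := rfl

/-! ### The spaces `W_n`, `V_n` and the kernels -/

/-- `W_n = span {ℋ_α : |α| = n}`. -/
def spaceW (d n : ℕ) : Submodule ℂ 𝓢(EuclideanSpace ℝ (Fin d), ℂ) :=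
  Submodule.span ℂ {g | ∃ α : Fin d → ℕ, ∑ i, α i = n ∧ g = hermiteS α}

/-- `V_n = W_0 + ⋯ + W_n` (the sum is direct, by orthogonality). -/
def spaceV (d n : ℕ) : Submodule ℂ 𝓢(EuclideanSpace ℝ (Fin d), ℂ) :=
  ⨆ j : ℕ, ⨆ _ : j ≤ n, spaceW d j

/-- The kernel `ℋ_n(x, y) = ∑_{|α| = n} ℋ_α(x) ℋ_α(y)`, for fixed `x`, as a Schwartz function
of `y`. (`Finset.piAntidiag Finset.univ n` is the set of all `α : Fin d → ℕ` with `|α| = n`.) -/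
def kernelH {d : ℕ} (n : ℕ) (x : EuclideanSpace ℝ (Fin d)) : 𝓢(EuclideanSpace ℝ (Fin d), ℂ) :=
  ∑ α ∈ Finset.piAntidiag (Finset.univ : Finset (Fin d)) n, hermiteS α x • hermiteS α

/-- Admissible cut-off functions: `a ∈ C^∞` with `supp a ⊆ [1/4, 4]` and
`|a| > c > 0` on `[1/3, 3]`. -/
structure IsCutoff (a : ℝ → ℂ) : Prop where
  smooth : ContDiff ℝ ∞ a
  supp : tsupport a ⊆ Set.Icc (1 / 4) 4
  lower : ∃ c : ℝ, 0 < c ∧ ∀ t ∈ Set.Icc (1 / 3 : ℝ) 3, c < ‖a t‖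

/-- The kernels `Φ_0 = ℋ_0` and `Φ_j = ∑_ν a(ν / 4^{j-1}) ℋ_ν` for `j ≥ 1`: here `Φ_j(x, ·)`
as a Schwartz function. For a cut-off function `a` only finitely many terms are non-zero,
see `kernelPhi_succ`. -/
def kernelPhi {d : ℕ} (a : ℝ → ℂ) :
    ℕ → EuclideanSpace ℝ (Fin d) → 𝓢(EuclideanSpace ℝ (Fin d), ℂ)
  | 0, x => kernelH 0 x
  | j + 1, x => ∑' ν : ℕ, a ((ν : ℝ) / 4 ^ j) • kernelH ν x

theorem kernelPhi_succ {d : ℕ} {a : ℝ → ℂ} (ha : IsCutoff a) (j : ℕ)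
    (x : EuclideanSpace ℝ (Fin d)) :
    kernelPhi a (j + 1) x =
      ∑ ν ∈ Finset.range (4 ^ (j + 1) + 1), a ((ν : ℝ) / 4 ^ j) • kernelH ν x := by
  refine tsum_eq_sum fun ν hν => ?_
  have hν' : 4 ^ (j + 1) < ν := by simpa [Nat.lt_succ_iff] using hν
  have h0 : a ((ν : ℝ) / 4 ^ j) = 0 := by
    by_contra hne
    have hm := (ha.supp (subset_tsupport a hne)).2
    rw [div_le_iff₀ (by positivity)] at hm
    have : (4 : ℝ) ^ (j + 1) < ν := by exact_mod_cast hν'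
    rw [pow_succ] at this
    linarith
  rw [h0, zero_smul]

/-- `Φ_j * f` for a tempered distribution `f`: `(Φ_j * f)(x) = ⟨f, conj Φ_j(x, ·)⟩`. Since
`⟨f, φ⟩ = f (conj φ)`, this is `f` applied to `Φ_j(x, ·)`. -/
def convPhi {d : ℕ} (a : ℝ → ℂ) (j : ℕ) (f : 𝓢'(EuclideanSpace ℝ (Fin d), ℂ))
    (x : EuclideanSpace ℝ (Fin d)) : ℂ :=
  f (kernelPhi a j x)

/-! ### The Besov and approximation spaces -/

/-- The `ℓ^q` quasi-norm, `0 < q ≤ ∞`, of a sequence with values in `[0, ∞]`. -/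
def lqNorm (q : ℝ≥0∞) (u : ℕ → ℝ≥0∞) : ℝ≥0∞ :=
  if q = ⊤ then ⨆ j, u j else (∑' j, u j ^ q.toReal) ^ (1 / q.toReal)

/-- The Hermite-Besov quasi-norm
`‖f‖ = (∑_j (2^{s j} ‖Φ_j * f‖_p)^q)^{1/q}` of a tempered distribution. -/
def besovNorm {d : ℕ} (a : ℝ → ℂ) (s : ℝ) (p q : ℝ≥0∞)
    (f : 𝓢'(EuclideanSpace ℝ (Fin d), ℂ)) : ℝ≥0∞ :=
  lqNorm q fun j => (2 : ℝ≥0∞) ^ (s * (j : ℝ)) * eLpNorm (convPhi a j f) p volume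

/-- The Hermite-Besov space. -/
def besovSpace (d : ℕ) (a : ℝ → ℂ) (s : ℝ) (p q : ℝ≥0∞) :
    Set 𝓢'(EuclideanSpace ℝ (Fin d), ℂ) :=
  {f | besovNorm a s p q f < ⊤}

/-- The best approximation `E_n(f)_p = inf_{g ∈ V_n} ‖f - g‖_p`. -/
def bestApprox {d : ℕ} (n : ℕ) (p : ℝ≥0∞) (f : EuclideanSpace ℝ (Fin d) → ℂ) : ℝ≥0∞ :=
  ⨅ g ∈ spaceV d n, eLpNorm (fun x => f x - g x) p volume

/-- The approximation quasi-norm `‖f‖_p + (∑_j (2^{s j} E_{2^j}(f)_p)^q)^{1/q}`. -/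
def approxNorm {d : ℕ} (s : ℝ) (p q : ℝ≥0∞) (f : EuclideanSpace ℝ (Fin d) → ℂ) : ℝ≥0∞ :=
  eLpNorm f p volume +
    lqNorm q fun j => (2 : ℝ≥0∞) ^ (s * (j : ℝ)) * bestApprox (2 ^ j) p f

/-- The approximation space, a subset of `L^p`. -/
def approxSpace (d : ℕ) (s : ℝ) (p q : ℝ≥0∞) :
    Set (Lp ℂ p (volume : Measure (EuclideanSpace ℝ (Fin d)))) :=
  {f | approxNorm s p q f < ⊤}

end

end HermiteBesov

namespace HermiteBesov

/-! ### One-dimensional Hermite functions -/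

/-! Everything rests on one analytic fact: if `g` is smooth with compact support, the multipliers `∑
g(ν/N) ℋ_ν` are bounded on every `L^p`, `1 ≤ p ≤ ∞`, uniformly in `N ≥ 1` (`exists_kernel_bound`,
`exists_multOp_bound`). To see this, Fourier inversion applied to `g(t) e^t` writes `g(ν/N)` as an
integral of `G(ξ) w^ν`, where `G` is a Schwartz function and `w = exp((2πiξ - 1)/N)` lies inside the
unit disc. Mehler's formula sums `∑ w^ν ℋ_ν(x,y)` in closed form, and the result is dominated by a
Gaussian in `x - y` whose integral grows only polynomially in `ξ`, uniformly in `N`. Since `G`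
decays rapidly, the kernel is dominated by `k(x - y)` with `∫ k` bounded, and Schur's test applies.

Besov norm by approximation norm (`besovNorm_le_approxNorm`): for `j ≥ 1` the symbol of `Φ_j`
vanishes on frequencies up to `4^(j-2)`, so `Φ_j` does not see elements of the corresponding `V_n`,
and `‖Φ_j * f‖_p` is at most a constant times `E_n(f)_p`. The frequency scale is `4^j = 2^(2j)`,
which is why smoothness `α` turns into `α/2`.

Approximation norm by Besov norm (`approxNorm_le_besovNorm`): a dual cutoff `b` with `∑_j b_j(ν)
a_j(ν) = 1` (`IsCutoff.exists_dual`) gives a Calderón decomposition `f = ∑_j Ψ_j * Φ_j * f`. As `α >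
0`, a finite Besov norm makes the series converge absolutely in `L^p`. Its partial sums lie in the
spaces `V_n`, so `E_n(f)_p` is bounded by a tail, and a discrete Hardy inequality, valid also for `q
< 1`, sums up the tails.

The `L^p` sum must be identified with the given distribution. For this it suffices to test on
Hermite functions (`temperedDistribution_ext`): every Schwartz seminorm is controlled by weighted
suprema of Hermite coefficients, and those coefficients decay rapidly, so Hermite expansions
converge in the Schwartz space. -/

theorem derivative_hermite_succ (n : ℕ) :
    Polynomial.derivative (Polynomial.hermite (n + 1)) = (n + 1 : ℤ) • Polynomial.hermite n := by
  induction n with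
  | zero => simp
  | succ n ih =>
    rw [Polynomial.hermite_succ (n + 1), Polynomial.derivative_sub, Polynomial.derivative_mul,
      Polynomial.derivative_X, ih, Polynomial.derivative_smul, Polynomial.hermite_succ n]
    simp only [zsmul_eq_mul]
    push_cast
    ring

theorem hermiteH_zero (t : ℝ) : hermiteH 0 t = 1 := by
  simp [hermiteH_eq]

theorem hermiteH_one (t : ℝ) : hermiteH 1 t = 2 * t := by
  simp only [hermiteH_eq, Polynomial.hermite_one, Polynomial.aeval_X, pow_one]
  rw [← mul_assoc, Real.mul_self_sqrt (by norm_num)]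

theorem hasDerivAt_hermiteH_succ (n : ℕ) (t : ℝ) :
    HasDerivAt (hermiteH (n + 1)) (2 * (n + 1) * hermiteH n t) t := by
  have h1 : HasDerivAt (fun t : ℝ => Real.sqrt 2 * t) (Real.sqrt 2) t := by
    simpa using (hasDerivAt_id t).const_mul (Real.sqrt 2)
  have h2 := ((Polynomial.hermite (n + 1)).hasDerivAt_aeval (Real.sqrt 2 * t)).comp t h1
  have h3 := h2.const_mul (Real.sqrt 2 ^ (n + 1))
  have he : hermiteH (n + 1) = fun t => Real.sqrt 2 ^ (n + 1) *
      ((fun x => Polynomial.aeval x (Polynomial.hermite (n + 1))) ∘ fun t => Real.sqrt 2 * t) t := by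
    funext t; exact hermiteH_eq _ t
  rw [he]
  refine h3.congr_deriv ?_
  rw [derivative_hermite_succ, hermiteH_eq]
  have hs : Real.sqrt 2 * Real.sqrt 2 = 2 := Real.mul_self_sqrt (by norm_num)
  simp only [zsmul_eq_mul, map_mul, pow_succ, map_add, map_one, Int.cast_add,
    Int.cast_natCast, Int.cast_one, map_natCast]
  linear_combination ((n + 1 : ℝ)) * Real.sqrt 2 ^ n *
    (Polynomial.aeval (Real.sqrt 2 * t) (Polynomial.hermite n)) * hs

theorem hermiteH_succ_succ (n : ℕ) (t : ℝ) :
    hermiteH (n + 2) t = 2 * t * hermiteH (n + 1) t - 2 * (n + 1) * hermiteH n t := by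
  have hs : Real.sqrt 2 * Real.sqrt 2 = 2 := Real.mul_self_sqrt (by norm_num)
  rw [hermiteH_eq (n + 2), Polynomial.hermite_succ (n + 1), derivative_hermite_succ, hermiteH_eq,
    hermiteH_eq]
  simp only [zsmul_eq_mul, map_mul, map_sub, pow_succ, Polynomial.aeval_X, map_add, map_one,
    Int.cast_add, Int.cast_natCast, Int.cast_one, map_natCast]
  linear_combination (Real.sqrt 2 ^ n * Real.sqrt 2 * t *
    (Polynomial.aeval (Real.sqrt 2 * t) (Polynomial.hermite (n + 1))) - (n + 1 : ℝ) *
      Real.sqrt 2 ^ n * (Polynomial.aeval (Real.sqrt 2 * t) (Polynomial.hermite n))) * hs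

/-- The normalising constant `(2^n n! √π)^{-1/2}`. -/
noncomputable def hermiteC (n : ℕ) : ℝ :=
  (Real.sqrt (2 ^ n * (n.factorial : ℝ) * Real.sqrt Real.pi))⁻¹

theorem hermiteC_pos (n : ℕ) : 0 < hermiteC n := by
  unfold hermiteC; positivity

theorem hermiteC_sq (n : ℕ) :
    hermiteC n ^ 2 = (2 ^ n * (n.factorial : ℝ) * Real.sqrt Real.pi)⁻¹ := by
  unfold hermiteC
  rw [inv_pow, Real.sq_sqrt (by positivity)]

/-- Written with `√((n+1)/2)` because this is the matrix entry of multiplication and differentiation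
in the normalised basis; the ladder relations below then follow by ring arithmetic. -/
theorem hermiteC_succ (n : ℕ) :
    hermiteC n = 2 * Real.sqrt ((n + 1) / 2) * hermiteC (n + 1) := by
  have h1 : hermiteC n ^ 2 = (2 * Real.sqrt ((n + 1) / 2) * hermiteC (n + 1)) ^ 2 := by
    rw [mul_pow, mul_pow, hermiteC_sq, hermiteC_sq, Real.sq_sqrt (by positivity),
      Nat.factorial_succ]
    push_cast
    field_simp
    ring
  exact (pow_left_inj₀ (hermiteC_pos n).le
    (mul_nonneg (by positivity) (hermiteC_pos _).le) two_ne_zero).1 h1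

theorem hermiteFn_eq (n : ℕ) (t : ℝ) :
    hermiteFn n t = hermiteC n * hermiteH n t * Real.exp (-(t ^ 2 / 2)) := rfl

/-- The three-term recurrence in normalised form. At `n = 0` the truncated index `n - 1 = 0` is
harmless, since its coefficient `√(0/2)` vanishes. -/
theorem mul_hermiteFn (n : ℕ) (t : ℝ) :
    t * hermiteFn n t = Real.sqrt (n / 2) * hermiteFn (n - 1) t +
      Real.sqrt ((n + 1) / 2) * hermiteFn (n + 1) t := by
  simp only [hermiteFn_eq]
  cases n with
  | zero =>
    rw [hermiteC_succ 0, hermiteH_zero, hermiteH_one]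
    simp
    ring
  | succ n =>
    have hs : Real.sqrt ((n + 1) / 2) * Real.sqrt ((n + 1) / 2) = (n + 1) / 2 :=
      Real.mul_self_sqrt (by positivity)
    simp only [Nat.add_sub_cancel]
    rw [hermiteC_succ n, hermiteC_succ (n + 1), hermiteH_succ_succ]
    push_cast
    linear_combination -(4 * Real.sqrt ((n + 1 + 1) / 2) * hermiteC (n + 1 + 1) * hermiteH n t *
      Real.exp (-(t ^ 2 / 2))) * hs

theorem hasDerivAt_hermiteFn (n : ℕ) (t : ℝ) :
    HasDerivAt (hermiteFn n) (Real.sqrt (n / 2) * hermiteFn (n - 1) t -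
      Real.sqrt ((n + 1) / 2) * hermiteFn (n + 1) t) t := by
  have hg : HasDerivAt (fun t : ℝ => Real.exp (-(t ^ 2 / 2)))
      (Real.exp (-(t ^ 2 / 2)) * (-t)) t := by
    have : HasDerivAt (fun t : ℝ => -(t ^ 2 / 2)) (-t) t := by
      have := ((hasDerivAt_pow 2 t).div_const 2).neg
      exact this.congr_deriv (by simp)
    exact this.exp
  have hx := mul_hermiteFn n t
  cases n with
  | zero =>
    have hH : HasDerivAt (hermiteH 0) 0 t := by
      have : hermiteH 0 = fun _ => 1 := funext hermiteH_zero
      rw [this]; exact hasDerivAt_const _ _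
    have h := (hH.const_mul (hermiteC 0)).mul hg
    refine h.congr_deriv ?_
    clear h
    simp only [hermiteFn_eq, Nat.cast_zero, zero_div, Real.sqrt_zero, zero_mul, zero_add,
      mul_zero, zero_sub] at hx ⊢
    linear_combination -hx
  | succ n =>
    have hs : Real.sqrt ((n + 1) / 2) * Real.sqrt ((n + 1) / 2) = (n + 1) / 2 :=
      Real.mul_self_sqrt (by positivity)
    have h := ((hasDerivAt_hermiteH_succ n t).const_mul (hermiteC (n + 1))).mul hg
    refine h.congr_deriv ?_
    simp only [hermiteFn_eq, Nat.add_sub_cancel] at hx ⊢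
    rw [hermiteC_succ n] at hx ⊢
    push_cast at hx ⊢
    linear_combination -hx - 4 * hermiteC (n + 1) * hermiteH n t * Real.exp (-(t ^ 2 / 2)) * hs

/-! ### Mehler's formula -/

theorem iteratedDeriv_ofReal_comp {φ : ℝ → ℝ} (hφ : ContDiff ℝ ∞ φ) (n : ℕ) :
    iteratedDeriv n (fun t => (φ t : ℂ)) = fun t => ((iteratedDeriv n φ t : ℝ) : ℂ) := by
  induction n with
  | zero => simp
  | succ n ih =>
    rw [iteratedDeriv_succ, ih]
    funext t
    rw [iteratedDeriv_succ]
    have hd : DifferentiableAt ℝ (iteratedDeriv n φ) t :=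
      (hφ.differentiable_iteratedDeriv n (by exact_mod_cast ENat.natCast_lt_top n)) t
    exact hd.hasDerivAt.ofReal_comp.deriv

theorem integrable_pow_mul_gaussian (n : ℕ) :
    Integrable fun s : ℝ => |s| ^ n * Real.exp (-(Real.pi ^ 2 * s ^ 2)) := by
  have h := integrable_rpow_mul_exp_neg_mul_sq (b := Real.pi ^ 2) (by positivity) (s := n)
    (by have : (0 : ℝ) ≤ n := n.cast_nonneg
        linarith)
  refine h.norm.congr (Filter.Eventually.of_forall fun s => ?_)
  simp [Real.rpow_natCast, abs_of_pos (Real.exp_pos _)]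

/-- `e^{-t²}` is, up to the factor `√π`, the Fourier transform of `e^{-π²s²}`. Each derivative in
`t` brings down `-2πis`, and the signs cancel the `(-1)^n` of the Rodrigues formula. In this form
the dependence on `n` is a pure power, so generating series can be summed under the integral. -/
theorem hermiteH_eq_integral (n : ℕ) (t : ℝ) :
    (hermiteH n t : ℂ) = Real.sqrt Real.pi * Real.exp (t ^ 2) *
      ∫ s : ℝ, (2 * Real.pi * Complex.I * s) ^ n *
        Complex.exp (-(2 * Real.pi * Complex.I * s * t) - Real.pi ^ 2 * s ^ 2) := by
  have hF := fourier_gaussian_pi (b := (Real.pi : ℂ)) (by simpa using Real.pi_pos)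
  have hint : ∀ m : ℕ, (m : ℕ∞) ≤ (⊤ : ℕ∞) → Integrable (fun x : ℝ =>
      x ^ m • Complex.exp (-Real.pi * Real.pi * (x : ℂ) ^ 2)) := by
    intro m _
    refine (integrable_pow_mul_gaussian m).mono' (by fun_prop)
      (Filter.Eventually.of_forall fun s => le_of_eq ?_)
    rw [norm_smul, Complex.norm_exp, norm_pow, Real.norm_eq_abs]
    congr 2
    norm_cast
    ring
  have hD := Real.iteratedDeriv_fourier (n := n) hint le_top
  rw [hF] at hD
  have hpi : (1 / (Real.pi : ℂ) ^ (1 / 2 : ℂ)) = (((Real.sqrt Real.pi)⁻¹ : ℝ) : ℂ) := by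
    rw [Real.sqrt_eq_rpow, Complex.ofReal_inv, Complex.ofReal_cpow Real.pi_pos.le]
    push_cast; simp
  have hfun : (fun t : ℝ => 1 / (Real.pi : ℂ) ^ (1 / 2 : ℂ) *
      Complex.exp (-Real.pi / Real.pi * (t : ℂ) ^ 2)) =
      fun t : ℝ => (((Real.sqrt Real.pi)⁻¹ * Real.exp (-t ^ 2) : ℝ) : ℂ) := by
    funext t
    rw [hpi, neg_div, div_self (by exact_mod_cast Real.pi_ne_zero)]
    push_cast
    ring_nf
  rw [hfun, iteratedDeriv_ofReal_comp (by fun_prop)] at hD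
  have hDt := congrFun hD t
  rw [iteratedDeriv_const_mul_field, Real.fourier_real_eq_integral_exp_smul] at hDt
  have hneg : ∀ v : ℝ, Complex.exp (((-2 * Real.pi * v * t : ℝ) : ℂ) * Complex.I) •
      (-2 * Real.pi * Complex.I * (v : ℂ)) ^ n • Complex.exp (-Real.pi * Real.pi * (v : ℂ) ^ 2) =
      (-1) ^ n * ((2 * Real.pi * Complex.I * v) ^ n *
        Complex.exp (-(2 * Real.pi * Complex.I * v * t) - Real.pi ^ 2 * v ^ 2)) := by
    intro v
    have h1 : (-2 * Real.pi * Complex.I * (v : ℂ)) = (-1) * (2 * Real.pi * Complex.I * v) := by ring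
    have h2 : (-(2 * Real.pi * Complex.I * v * t) - Real.pi ^ 2 * v ^ 2 : ℂ) =
      ((-2 * Real.pi * v * t : ℝ) : ℂ) * Complex.I + -Real.pi * Real.pi * (v : ℂ) ^ 2 := by
        push_cast; ring
    rw [h1, mul_pow, h2, Complex.exp_add, smul_eq_mul, smul_eq_mul]
    ring
  simp_rw [hneg] at hDt
  rw [integral_const_mul] at hDt
  have hs : Real.sqrt Real.pi ≠ 0 := by positivity
  have hone : ((-1 : ℂ) ^ n) * (-1) ^ n = 1 := by
    rw [← mul_pow]; simp
  have hI : ∫ s : ℝ, (2 * Real.pi * Complex.I * s) ^ n *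
        Complex.exp (-(2 * Real.pi * Complex.I * s * t) - Real.pi ^ 2 * s ^ 2) =
      (-1) ^ n * (((Real.sqrt Real.pi)⁻¹ * iteratedDeriv n (fun s : ℝ => Real.exp (-s ^ 2)) t : ℝ)
        : ℂ) := by
    rw [hDt, ← mul_assoc, hone, one_mul]
  rw [hI, hermiteH]
  have hsC : (Real.sqrt Real.pi : ℂ) ≠ 0 := by exact_mod_cast hs
  push_cast
  field_simp

/-- Mehler's kernel in dimension one. -/
noncomputable def mehler (w : ℂ) (x y : ℝ) : ℂ :=
  (1 / (Real.pi * (1 - w ^ 2))) ^ (1 / 2 : ℂ) *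
    Complex.exp ((2 * x * y * w - (1 + w ^ 2) * (x ^ 2 + y ^ 2) / 2) / (1 - w ^ 2))

/-- The integrand in the Fourier representation of the Gaussian. -/
noncomputable def gaussWave (s t : ℝ) : ℂ :=
  Complex.exp (-(2 * Real.pi * Complex.I * s * t) - Real.pi ^ 2 * s ^ 2)

theorem norm_gaussWave (s t : ℝ) : ‖gaussWave s t‖ = Real.exp (-(Real.pi ^ 2 * s ^ 2)) := by
  rw [gaussWave, Complex.norm_exp]
  congr 1
  have : (-(2 * Real.pi * Complex.I * s * t) - Real.pi ^ 2 * s ^ 2 : ℂ) =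
      ((-(Real.pi ^ 2 * s ^ 2) : ℝ) : ℂ) + ((-(2 * Real.pi * s * t) : ℝ) : ℂ) * Complex.I := by
    push_cast; ring
  rw [this, Complex.add_re, Complex.ofReal_re, Complex.re_ofReal_mul, Complex.I_re, mul_zero,
    add_zero]

theorem continuous_gaussWave (t : ℝ) : Continuous fun s => gaussWave s t := by
  unfold gaussWave; fun_prop

theorem norm_gauss_term (w : ℂ) (n : ℕ) (x y s u : ℝ) :
    ‖(-(2 * Real.pi ^ 2) * w * s * u) ^ n / n.factorial * (gaussWave s x * gaussWave u y)‖ =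
      (2 * Real.pi ^ 2 * ‖w‖ * |s| * |u|) ^ n / n.factorial *
        (Real.exp (-(Real.pi ^ 2 * s ^ 2)) * Real.exp (-(Real.pi ^ 2 * u ^ 2))) := by
  rw [norm_mul, norm_mul, norm_gaussWave, norm_gaussWave, norm_div, norm_pow]
  simp [abs_of_pos Real.pi_pos]

/-- By `2|s||u| ≤ s² + u²` the cross term consumes only the fraction `r < 1` of the Gaussian decay.
-/
theorem integrable_gauss_bound {r : ℝ} (hr : r < 1) :
    Integrable (fun z : ℝ × ℝ => Real.exp (2 * Real.pi ^ 2 * r * |z.1| * |z.2|) *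
      (Real.exp (-(Real.pi ^ 2 * z.1 ^ 2)) * Real.exp (-(Real.pi ^ 2 * z.2 ^ 2))))
      (volume.prod volume) := by
  rcases le_or_gt 0 r with h0 | h0
  swap
  · have hg : Integrable fun s : ℝ => Real.exp (-(Real.pi ^ 2) * s ^ 2) :=
      integrable_exp_neg_mul_sq (by positivity)
    refine (hg.mul_prod hg).mono' (by fun_prop) (Filter.Eventually.of_forall fun z => ?_)
    rw [Real.norm_eq_abs, abs_of_pos (by positivity)]
    have : Real.exp (2 * Real.pi ^ 2 * r * |z.1| * |z.2|) ≤ 1 := by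
      rw [Real.exp_le_one_iff]
      have : 0 ≤ Real.pi ^ 2 * |z.1| * |z.2| := by positivity
      nlinarith
    calc _ ≤ 1 * (Real.exp (-(Real.pi ^ 2 * z.1 ^ 2)) * Real.exp (-(Real.pi ^ 2 * z.2 ^ 2))) := by
          gcongr
      _ = _ := by simp
  have hg : Integrable fun s : ℝ => Real.exp (-(Real.pi ^ 2 * (1 - r)) * s ^ 2) :=
    integrable_exp_neg_mul_sq (by have : 0 < 1 - r := by linarith
                                  positivity)
  refine (hg.mul_prod hg).mono' (by fun_prop) (Filter.Eventually.of_forall fun z => ?_)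
  rw [Real.norm_eq_abs, abs_of_pos (by positivity), ← Real.exp_add, ← Real.exp_add,
    ← Real.exp_add, Real.exp_le_exp]
  have h1 : 2 * (|z.1| * |z.2|) ≤ z.1 ^ 2 + z.2 ^ 2 := by
    rw [← sq_abs z.1, ← sq_abs z.2]
    nlinarith [sq_nonneg (|z.1| - |z.2|)]
  have h2 : Real.pi ^ 2 * r * (2 * (|z.1| * |z.2|)) ≤ Real.pi ^ 2 * r * (z.1 ^ 2 + z.2 ^ 2) := by
    gcongr
  linarith

theorem one_sub_sq_re_pos {w : ℂ} (hw : ‖w‖ < 1) : 0 < (1 - w ^ 2).re := by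
  have h1 : (w ^ 2).re ≤ ‖w ^ 2‖ := Complex.re_le_norm _
  have h2 : ‖w ^ 2‖ < 1 := by
    rw [norm_pow]; exact pow_lt_one₀ (norm_nonneg _) hw two_ne_zero
  simp only [Complex.sub_re, Complex.one_re]
  linarith

theorem integral_gauss_exp {w : ℂ} (hw : ‖w‖ < 1) (x y : ℝ) :
    ∫ z : ℝ × ℝ, Complex.exp (-(2 * Real.pi ^ 2) * w * z.1 * z.2) *
        (gaussWave z.1 x * gaussWave z.2 y) ∂(volume.prod volume) =
      (Real.sqrt Real.pi : ℂ)⁻¹ * ((1 / (Real.pi * (1 - w ^ 2))) ^ (1 / 2 : ℂ) *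
        Complex.exp (-y ^ 2 - (w * y - x) ^ 2 / (1 - w ^ 2))) := by
  have hpi : (Real.pi : ℂ) ≠ 0 := by exact_mod_cast Real.pi_ne_zero
  have hre := one_sub_sq_re_pos hw
  have hne : (1 - w ^ 2) ≠ 0 := fun h => by rw [h] at hre; simp at hre
  rw [integral_prod]
  swap
  · refine (integrable_gauss_bound hw).mono' ?_ (Filter.Eventually.of_forall fun z => ?_)
    · refine Continuous.aestronglyMeasurable ?_
      exact (by fun_prop : Continuous fun z : ℝ × ℝ =>
        Complex.exp (-(2 * Real.pi ^ 2) * w * z.1 * z.2)).mul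
        (((continuous_gaussWave x).comp continuous_fst).mul
          ((continuous_gaussWave y).comp continuous_snd))
    · rw [norm_mul, norm_mul, norm_gaussWave, norm_gaussWave, Complex.norm_exp]
      gcongr
      refine (Complex.re_le_norm _).trans (le_of_eq ?_)
      simp [abs_of_pos Real.pi_pos]
  have hinner : ∀ s : ℝ, ∫ u : ℝ, Complex.exp (-(2 * Real.pi ^ 2) * w * s * u) *
        (gaussWave s x * gaussWave u y) = (Real.sqrt Real.pi : ℂ)⁻¹ *
        Complex.exp (-(Real.pi ^ 2 * (1 - w ^ 2)) * (s : ℂ) ^ 2 +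
          (2 * Real.pi * Complex.I * (w * y - x)) * s + (-(y : ℂ) ^ 2)) := by
    intro s
    have h1 : ∀ u : ℝ, Complex.exp (-(2 * Real.pi ^ 2) * w * s * u) *
        (gaussWave s x * gaussWave u y) =
        gaussWave s x * Complex.exp (-(Real.pi ^ 2 : ℂ) * (u : ℂ) ^ 2 +
          (-(2 * Real.pi ^ 2) * w * s - 2 * Real.pi * Complex.I * y) * u + 0) := by
      intro u
      simp only [gaussWave]
      rw [← Complex.exp_add, ← Complex.exp_add, ← Complex.exp_add]
      congr 1
      ring
    simp_rw [h1]
    have hb : (-(Real.pi ^ 2 : ℂ)).re < 0 := by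
      have : (-(Real.pi ^ 2 : ℂ)) = ((-(Real.pi ^ 2) : ℝ) : ℂ) := by push_cast; rfl
      rw [this, Complex.ofReal_re]
      have := Real.pi_pos
      nlinarith
    rw [integral_const_mul, integral_cexp_quadratic hb]
    have hc : ((Real.pi : ℂ) / -(-(Real.pi ^ 2 : ℂ))) ^ (1 / 2 : ℂ) =
        (Real.sqrt Real.pi : ℂ)⁻¹ := by
      have : ((Real.pi : ℂ) / -(-(Real.pi ^ 2 : ℂ))) = ((Real.pi⁻¹ : ℝ) : ℂ) := by
        push_cast; field_simp
      rw [this, show (1 / 2 : ℂ) = ((1 / 2 : ℝ) : ℂ) by push_cast; rfl,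
        ← Complex.ofReal_cpow (by positivity), ← Real.sqrt_eq_rpow, Real.sqrt_inv]
      push_cast; rfl
    rw [hc, gaussWave, mul_left_comm, ← Complex.exp_add]
    congr 2
    field_simp
    ring_nf
    rw [Complex.I_sq]
    ring
  simp_rw [hinner]
  have hb : (-(Real.pi ^ 2 * (1 - w ^ 2) : ℂ)).re < 0 := by
    have : (-(Real.pi ^ 2 * (1 - w ^ 2) : ℂ)) = ((-(Real.pi ^ 2) : ℝ) : ℂ) * (1 - w ^ 2) := by
      push_cast; ring
    rw [this, Complex.re_ofReal_mul]
    have : 0 < Real.pi ^ 2 := by positivity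
    nlinarith
  rw [integral_const_mul, integral_cexp_quadratic hb]
  congr 3
  · field_simp
  · field_simp
    ring_nf
    rw [Complex.I_sq]
    ring

/-- With the integral representation inserted for both factors, the `n`-th term contains
`(-2π²wsu)^n / n!`. Summing under the double integral, by dominated convergence, gives
`exp(-2π²wsu)`, and what remains is the Gaussian integral of `integral_gauss_exp`. -/
theorem hasSum_mehler {w : ℂ} (hw : ‖w‖ < 1) (x y : ℝ) :
    HasSum (fun n : ℕ => w ^ n * ((hermiteFn n x : ℂ) * hermiteFn n y)) (mehler w x y) := by
  have hterm : ∀ n : ℕ, w ^ n * ((hermiteFn n x : ℂ) * hermiteFn n y) =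
      (Real.sqrt Real.pi * Complex.exp ((x ^ 2 + y ^ 2) / 2)) *
      ∫ z : ℝ × ℝ, (-(2 * Real.pi ^ 2) * w * z.1 * z.2) ^ n / n.factorial *
        (gaussWave z.1 x * gaussWave z.2 y) ∂(volume.prod volume) := by
    intro n
    have h1 : ∀ z : ℝ × ℝ, (-(2 * Real.pi ^ 2) * w * z.1 * z.2) ^ n / n.factorial *
        (gaussWave z.1 x * gaussWave z.2 y) = (w ^ n / (2 ^ n * n.factorial)) *
        (((2 * Real.pi * Complex.I * z.1) ^ n * gaussWave z.1 x) *
          ((2 * Real.pi * Complex.I * z.2) ^ n * gaussWave z.2 y)) := by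
      intro z
      have : (-(2 * Real.pi ^ 2) * w * z.1 * z.2 : ℂ) =
          w / 2 * (2 * Real.pi * Complex.I * z.1) * (2 * Real.pi * Complex.I * z.2) := by
        ring_nf
        rw [Complex.I_sq]
        ring
      rw [this, mul_pow, mul_pow, div_pow]
      field_simp
    simp_rw [h1]
    rw [integral_const_mul, integral_prod_mul (fun s : ℝ => (2 * Real.pi * Complex.I * s) ^ n *
      gaussWave s x) (fun s : ℝ => (2 * Real.pi * Complex.I * s) ^ n * gaussWave s y)]
    have hsq : ((hermiteC n : ℂ)) ^ 2 = (2 ^ n * (n.factorial : ℂ) * Real.sqrt Real.pi)⁻¹ := by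
      exact_mod_cast congrArg (fun r : ℝ => (r : ℂ)) (hermiteC_sq n)
    have hs : (Real.sqrt Real.pi : ℂ) ≠ 0 := by
      exact_mod_cast (Real.sqrt_pos.2 Real.pi_pos).ne'
    rw [hermiteFn_eq, hermiteFn_eq]
    push_cast
    rw [hermiteH_eq_integral n x, hermiteH_eq_integral n y]
    simp_rw [show ∀ s t : ℝ, Complex.exp (-(2 * Real.pi * Complex.I * s * t) - Real.pi ^ 2 * s ^ 2)
      = gaussWave s t from fun _ _ => rfl]
    generalize (∫ s : ℝ, (2 * Real.pi * Complex.I * s) ^ n * gaussWave s x) = A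
    generalize (∫ s : ℝ, (2 * Real.pi * Complex.I * s) ^ n * gaussWave s y) = B
    have hE : Complex.exp (x ^ 2) * Complex.exp (y ^ 2) * (Complex.exp (-((x : ℂ) ^ 2 / 2)) *
        Complex.exp (-((y : ℂ) ^ 2 / 2))) = Complex.exp ((x ^ 2 + y ^ 2) / 2) := by
      simp only [← Complex.exp_add]
      congr 1
      ring
    rw [← hE]
    push_cast
    calc _ = (hermiteC n : ℂ) ^ 2 * w ^ n * (Real.sqrt Real.pi * Real.sqrt Real.pi * A * B *
          (Complex.exp (x ^ 2) * Complex.exp (y ^ 2) * (Complex.exp (-((x : ℂ) ^ 2 / 2)) *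
          Complex.exp (-((y : ℂ) ^ 2 / 2))))) := by ring
      _ = _ := by
        rw [hsq]
        field_simp
  have hre := one_sub_sq_re_pos hw
  have hne : (1 - w ^ 2) ≠ 0 := fun h => by rw [h] at hre; simp at hre
  have hs : (Real.sqrt Real.pi : ℂ) ≠ 0 := by
    exact_mod_cast (Real.sqrt_pos.2 Real.pi_pos).ne'
  have hval : mehler w x y = (Real.sqrt Real.pi * Complex.exp ((x ^ 2 + y ^ 2) / 2)) *
      ∫ z : ℝ × ℝ, Complex.exp (-(2 * Real.pi ^ 2) * w * z.1 * z.2) *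
        (gaussWave z.1 x * gaussWave z.2 y) ∂(volume.prod volume) := by
    rw [integral_gauss_exp hw, mehler]
    have : (2 * x * y * w - (1 + w ^ 2) * (x ^ 2 + y ^ 2) / 2) / (1 - w ^ 2) =
      ((x : ℂ) ^ 2 + y ^ 2) / 2 + (-y ^ 2 - (w * y - x) ^ 2 / (1 - w ^ 2)) := by
      field_simp
      ring
    rw [this, Complex.exp_add]
    field_simp
  rw [hval]
  simp_rw [hterm]
  refine HasSum.mul_left _ ?_
  have hexpR : ∀ r : ℝ, HasSum (fun n : ℕ => r ^ n / n.factorial) (Real.exp r) := fun r => by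
    rw [Real.exp_eq_exp_ℝ]; exact NormedSpace.expSeries_div_hasSum_exp r
  refine hasSum_integral_of_dominated_convergence
    (fun n z => (2 * Real.pi ^ 2 * ‖w‖ * |z.1| * |z.2|) ^ n / n.factorial *
        (Real.exp (-(Real.pi ^ 2 * z.1 ^ 2)) * Real.exp (-(Real.pi ^ 2 * z.2 ^ 2))))
    (fun n => ?_) (fun n => Filter.Eventually.of_forall fun z => ?_)
    (Filter.Eventually.of_forall fun z => ?_) ?_ (Filter.Eventually.of_forall fun z => ?_)
  · refine Continuous.aestronglyMeasurable ?_
    exact (by fun_prop : Continuous fun z : ℝ × ℝ =>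
        (-(2 * Real.pi ^ 2) * w * z.1 * z.2) ^ n / (n.factorial : ℂ)).mul
        (((continuous_gaussWave x).comp continuous_fst).mul
          ((continuous_gaussWave y).comp continuous_snd))
  · exact (norm_gauss_term w n x y z.1 z.2).le
  · exact ((hexpR _).summable).mul_right _
  · refine (integrable_gauss_bound hw).congr (Filter.Eventually.of_forall fun z => ?_)
    exact ((hexpR _).mul_right _).tsum_eq.symm
  · refine HasSum.mul_right _ ?_
    rw [Complex.exp_eq_exp_ℂ]
    exact NormedSpace.expSeries_div_hasSum_exp _

/-- The exponent splits as `-(x-y)²/4 · (1+w)/(1-w) - (x+y)²/4 · (1-w)/(1+w)`, and `Re((1+v)/(1-v))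
= (1-|v|²)/|1-v|²` is positive in the disc. Discarding the second part leaves a convolution kernel.
-/
theorem norm_mehler {w : ℂ} (hw : ‖w‖ < 1) (x y : ℝ) :
    ‖mehler w x y‖ ≤ (Real.sqrt (Real.pi * ‖1 - w ^ 2‖))⁻¹ *
      Real.exp (-((1 - ‖w‖ ^ 2) / ‖1 - w‖ ^ 2 * (x - y) ^ 2 / 4)) := by
  have hre := one_sub_sq_re_pos hw
  have hne : (1 - w ^ 2) ≠ 0 := fun h => by rw [h] at hre; simp at hre
  have h1 : (1 - w) ≠ 0 := fun h => hne (by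
    rw [show (1 - w ^ 2) = (1 - w) * (1 + w) by ring, h, zero_mul])
  have h2 : (1 + w) ≠ 0 := fun h => hne (by
    rw [show (1 - w ^ 2) = (1 - w) * (1 + w) by ring, h, mul_zero])
  have hquot : ∀ v : ℂ, 1 - v ≠ 0 → ((1 + v) / (1 - v)).re = (1 - ‖v‖ ^ 2) / ‖1 - v‖ ^ 2 := by
    intro v hv
    rw [Complex.div_re, ← Complex.normSq_eq_norm_sq, ← Complex.normSq_eq_norm_sq, ← add_div]
    congr 1
    simp [Complex.normSq_apply]
    ring
  rw [mehler, norm_mul, Complex.norm_exp]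
  gcongr
  · rw [show (1 / 2 : ℂ) = ((1 / 2 : ℝ) : ℂ) by push_cast; rfl,
      Complex.norm_cpow_real, ← Real.sqrt_eq_rpow, norm_div, norm_mul, norm_one,
      Complex.norm_real, Real.norm_of_nonneg Real.pi_pos.le, one_div, Real.sqrt_inv]
  · have he : (2 * x * y * w - (1 + w ^ 2) * (x ^ 2 + y ^ 2) / 2) / (1 - w ^ 2) =
        -(((x - y) ^ 2 / 4 : ℝ) : ℂ) * ((1 + w) / (1 - w)) -
          (((x + y) ^ 2 / 4 : ℝ) : ℂ) * ((1 + -w) / (1 - -w)) := by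
      rw [show (1 - w ^ 2) = (1 - w) * (1 + w) by ring, sub_neg_eq_add, ← sub_eq_add_neg]
      push_cast
      field_simp
      ring
    rw [he, Complex.sub_re, neg_mul, Complex.neg_re, Complex.re_ofReal_mul, Complex.re_ofReal_mul,
      hquot w h1, hquot (-w) (by simpa using h2)]
    have : 0 ≤ (x + y) ^ 2 / 4 * ((1 - ‖-w‖ ^ 2) / ‖1 - -w‖ ^ 2) := by
      have : 0 ≤ 1 - ‖-w‖ ^ 2 := by
        rw [norm_neg]
        have := pow_lt_one₀ (norm_nonneg _) hw two_ne_zero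
        linarith
      positivity
    linarith

/-! ### The `d`-dimensional Mehler kernel -/

/-- Cauchy product of finitely many series, by adding one index at a time. Absolute summability is
carried along because the two-factor Cauchy product needs it at the next step. -/
theorem hasSum_piAntidiag_prod {ι : Type*} [DecidableEq ι] (u : ι → ℕ → ℂ)
    (hu : ∀ i, Summable fun n => ‖u i n‖) (s : Finset ι) :
    (Summable fun ν => ‖∑ β ∈ s.piAntidiag ν, ∏ i ∈ s, u i (β i)‖) ∧
      HasSum (fun ν => ∑ β ∈ s.piAntidiag ν, ∏ i ∈ s, u i (β i)) (∏ i ∈ s, ∑' n, u i n) := by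
  induction s using Finset.cons_induction with
  | empty =>
    have h0 : (fun ν : ℕ => ∑ β ∈ (∅ : Finset ι).piAntidiag ν,
        ∏ i ∈ (∅ : Finset ι), u i (β i)) = fun ν => if ν = 0 then (1 : ℂ) else 0 := by
      funext ν
      by_cases h : ν = 0 <;> simp [h]
    have h1 : (fun ν : ℕ => ‖∑ β ∈ (∅ : Finset ι).piAntidiag ν,
        ∏ i ∈ (∅ : Finset ι), u i (β i)‖) = fun ν => ‖if ν = 0 then (1 : ℂ) else 0‖ := by
      funext ν
      rw [congrFun h0 ν]
    rw [h1, h0, Finset.prod_empty]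
    exact ⟨summable_norm_iff.2 (hasSum_ite_eq 0 (1 : ℂ)).summable, hasSum_ite_eq 0 1⟩
  | cons a s ha ih =>
    have hstep : ∀ ν : ℕ, ∑ β ∈ (Finset.cons a s ha).piAntidiag ν,
        ∏ i ∈ Finset.cons a s ha, u i (β i) = ∑ kl ∈ Finset.HasAntidiagonal.antidiagonal ν, u a kl.1 *
          ∑ β ∈ s.piAntidiag kl.2, ∏ i ∈ s, u i (β i) := by
      intro ν
      rw [Finset.piAntidiag_cons, Finset.sum_disjiUnion]
      refine Finset.sum_congr rfl fun p _ => ?_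
      rw [Finset.sum_map, Finset.mul_sum]
      refine Finset.sum_congr rfl fun β hβ => ?_
      rw [Finset.mem_piAntidiag] at hβ
      rw [Finset.prod_cons]
      have hβa : β a = 0 := by
        by_contra h; exact ha (hβ.2 a h)
      congr 1
      · simp [hβa]
      · refine Finset.prod_congr rfl fun i hi => ?_
        have : i ≠ a := fun h => ha (h ▸ hi)
        simp [this]
    simp only [hstep]
    rw [Finset.prod_cons]
    have hs := summable_norm_sum_mul_antidiagonal_of_summable_norm (hu a) ih.1
    refine ⟨hs, ?_⟩
    rw [← ih.2.tsum_eq, tsum_mul_tsum_eq_tsum_sum_antidiagonal_of_summable_norm (hu a) ih.1]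
    exact hs.of_norm.hasSum

variable {d : ℕ}

theorem kernelH_apply (ν : ℕ) (x y : EuclideanSpace ℝ (Fin d)) :
    kernelH ν x y = ∑ β ∈ Finset.piAntidiag (Finset.univ : Finset (Fin d)) ν,
      hermiteS β x * hermiteS β y := by
  simp [kernelH]

/-- Mehler's kernel in dimension `d`. -/
noncomputable def mehlerD (w : ℂ) (x y : EuclideanSpace ℝ (Fin d)) : ℂ :=
  ∏ i, mehler w (x i) (y i)

theorem pow_mul_hermiteS_mul (w : ℂ) {ν : ℕ} {β : Fin d → ℕ}
    (hβ : β ∈ Finset.piAntidiag (Finset.univ : Finset (Fin d)) ν)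
    (x y : EuclideanSpace ℝ (Fin d)) :
    w ^ ν * (hermiteS β x * hermiteS β y) =
      ∏ i, (w ^ β i * ((hermiteFn (β i) (x i) : ℂ) * hermiteFn (β i) (y i))) := by
  rw [Finset.mem_piAntidiag] at hβ
  simp only [Finset.prod_mul_distrib, Finset.prod_pow_eq_pow_sum, hβ.1, hermiteS_apply]
  push_cast
  rfl

theorem hasSum_mehlerD {w : ℂ} (hw : ‖w‖ < 1) (x y : EuclideanSpace ℝ (Fin d)) :
    HasSum (fun ν : ℕ => w ^ ν * kernelH ν x y) (mehlerD w x y) := by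
  have h := (hasSum_piAntidiag_prod (fun (i : Fin d) n => w ^ n * ((hermiteFn n (x i) : ℂ) *
    hermiteFn n (y i))) (fun i => (hasSum_mehler hw (x i) (y i)).summable.norm) Finset.univ).2
  simp only [(hasSum_mehler hw _ _).tsum_eq] at h
  refine h.congr_fun fun ν => ?_
  rw [kernelH_apply, Finset.mul_sum]
  exact Finset.sum_congr rfl fun β hβ => pow_mul_hermiteS_mul w hβ x y

theorem norm_mehlerD_le {w : ℂ} (hw : ‖w‖ < 1) (x y : EuclideanSpace ℝ (Fin d)) :
    ‖mehlerD w x y‖ ≤ (Real.sqrt (Real.pi * ‖1 - w ^ 2‖))⁻¹ ^ d *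
      Real.exp (-((1 - ‖w‖ ^ 2) / ‖1 - w‖ ^ 2 / 4) * ‖x - y‖ ^ 2) := by
  rw [mehlerD, norm_prod]
  calc _ ≤ ∏ i, ((Real.sqrt (Real.pi * ‖1 - w ^ 2‖))⁻¹ *
      Real.exp (-((1 - ‖w‖ ^ 2) / ‖1 - w‖ ^ 2 * (x i - y i) ^ 2 / 4))) :=
        Finset.prod_le_prod (fun _ _ => norm_nonneg _) fun i _ => norm_mehler hw _ _
    _ = _ := by
      rw [Finset.prod_mul_distrib, Finset.prod_const, ← Real.exp_sum, Finset.card_univ,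
        Fintype.card_fin]
      congr 2
      rw [EuclideanSpace.real_norm_sq_eq, Finset.mul_sum]
      refine Finset.sum_congr rfl fun i _ => ?_
      simp only [PiLp.sub_apply]
      ring

/-- On the diagonal `x = y` and for `w = r` in `[0, 1)`, all terms of Mehler's series are
nonnegative, so a single one is bounded by the closed form. The bound is far from sharp, but
polynomial growth in `|β|` is all that is used. -/
theorem norm_hermiteS_le (β : Fin d → ℕ) (x : EuclideanSpace ℝ (Fin d)) :
    ‖hermiteS β x‖ ≤ 2 * (1 + (∑ i, β i : ℕ) : ℝ) ^ d := by
  set n := ∑ i, β i with hn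
  -- This choice keeps `r^n` bounded below while the prefactor `(π(1 - r²))^{-1/2}` grows only like
  -- `√(n+1)`.
  set r : ℝ := n / (n + 1) with hr
  have hn1 : (0 : ℝ) < n + 1 := by positivity
  have hr0 : 0 ≤ r := by positivity
  have hr1 : r < 1 := by rw [hr, div_lt_one hn1]; linarith
  have hw : ‖(r : ℂ)‖ < 1 := by simpa [abs_of_nonneg hr0] using hr1
  have hle1 : r ^ n * ‖hermiteS β x‖ ^ 2 ≤ (Real.sqrt (Real.pi * (1 - r ^ 2)))⁻¹ ^ d := by
    have hS := hasSum_mehlerD hw x x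
    have hre := Complex.hasSum_re hS
    have hterm : ∀ ν, ((r : ℂ) ^ ν * kernelH ν x x).re = r ^ ν *
        ∑ γ ∈ Finset.piAntidiag (Finset.univ : Finset (Fin d)) ν, ‖hermiteS γ x‖ ^ 2 := by
      intro ν
      rw [← Complex.ofReal_pow, Complex.re_ofReal_mul, kernelH_apply, Complex.re_sum]
      congr 1
      refine Finset.sum_congr rfl fun γ _ => ?_
      rw [hermiteS_apply, ← Complex.ofReal_mul, Complex.ofReal_re, Complex.norm_real,
        Real.norm_eq_abs, sq_abs, sq]
    simp only [hterm] at hre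
    have h1 : r ^ n * ∑ γ ∈ Finset.piAntidiag (Finset.univ : Finset (Fin d)) n,
        ‖hermiteS γ x‖ ^ 2 ≤ (mehlerD (r : ℂ) x x).re :=
      le_hasSum hre n fun j _ => mul_nonneg (pow_nonneg hr0 _)
        (Finset.sum_nonneg fun _ _ => by positivity)
    have h2 : (mehlerD (r : ℂ) x x).re ≤ (Real.sqrt (Real.pi * (1 - r ^ 2)))⁻¹ ^ d := by
      refine (Complex.re_le_norm _).trans ((norm_mehlerD_le hw x x).trans (le_of_eq ?_))
      have : (1 - (r : ℂ) ^ 2) = ((1 - r ^ 2 : ℝ) : ℂ) := by push_cast; rfl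
      rw [this, Complex.norm_real, Real.norm_of_nonneg (by nlinarith)]
      simp
    refine le_trans ?_ (h1.trans h2)
    gcongr
    exact Finset.single_le_sum (f := fun γ => ‖hermiteS γ x‖ ^ 2) (fun _ _ => by positivity)
      (by simp [Finset.mem_piAntidiag, hn])
  have hsq : (Real.sqrt (Real.pi * (1 - r ^ 2)))⁻¹ ≤ Real.sqrt (n + 1) := by
    rw [← Real.sqrt_inv]
    apply Real.sqrt_le_sqrt
    apply inv_le_of_inv_le₀ hn1
    have h1 : 1 - r = ((n : ℝ) + 1)⁻¹ := by
      rw [hr, one_sub_div hn1.ne']; simp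
    rw [← h1]
    have h2 : 1 - r ≤ 1 - r ^ 2 := by nlinarith
    have h3 : 1 * (1 - r ^ 2) ≤ Real.pi * (1 - r ^ 2) := by
      have := Real.pi_gt_three
      apply mul_le_mul_of_nonneg_right <;> nlinarith
    linarith
  -- `r^{-n} = (1 + 1/n)^n ≤ e < 4`.
  have hrn : 1 ≤ 4 * r ^ n := by
    rcases Nat.eq_zero_or_pos n with h0 | h0
    · rw [h0]; norm_num
    · have hn0 : (0 : ℝ) < n := by exact_mod_cast h0
      have h1 : (1 + 1 / (n : ℝ)) ^ n ≤ Real.exp 1 := by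
        have := Real.add_one_le_exp (1 / (n : ℝ))
        calc (1 + 1 / (n : ℝ)) ^ n ≤ (Real.exp (1 / n)) ^ n := by gcongr; linarith
          _ = Real.exp 1 := by
            rw [← Real.exp_nat_mul]; congr 1; field_simp
      have h2 : (1 + 1 / (n : ℝ)) ^ n * r ^ n = 1 := by
        rw [← mul_pow, hr]
        have : (1 + 1 / (n : ℝ)) * (n / (n + 1)) = 1 := by field_simp
        rw [this, one_pow]
      have h3 := Real.exp_one_lt_d9
      have h4 : 0 ≤ r ^ n := by positivity
      nlinarith
  have hfin : ‖hermiteS β x‖ ^ 2 ≤ (2 * (1 + (n : ℝ)) ^ d) ^ 2 := by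
    have h1 : (Real.sqrt (Real.pi * (1 - r ^ 2)))⁻¹ ^ d ≤ (1 + (n : ℝ)) ^ d := by
      gcongr
      refine hsq.trans ?_
      rw [add_comm, Real.sqrt_le_left (by positivity)]
      nlinarith [n.cast_nonneg (α := ℝ)]
    have h2 : (1 : ℝ) ≤ (1 + (n : ℝ)) ^ d := one_le_pow₀ (by linarith [n.cast_nonneg (α := ℝ)])
    have h3 := hle1.trans h1
    have h4 : ‖hermiteS β x‖ ^ 2 ≤ 4 * r ^ n * ‖hermiteS β x‖ ^ 2 :=
      le_mul_of_one_le_left (by positivity) hrn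
    nlinarith
  exact (pow_le_pow_iff_left₀ (norm_nonneg _) (by positivity) two_ne_zero).1 hfin

/-! ### Uniform `L¹` bounds for kernels of smooth multipliers -/

/-- The complex dilation parameter `exp((2πiξ - 1)/N)`. -/
noncomputable def mehlerParam (N ξ : ℝ) : ℂ :=
  Complex.exp ((2 * Real.pi * ξ * Complex.I - 1) / N)

theorem norm_mehlerParam (N ξ : ℝ) : ‖mehlerParam N ξ‖ = Real.exp (-(1 / N)) := by
  rw [mehlerParam, Complex.norm_exp]
  congr 1
  have : (2 * Real.pi * ξ * Complex.I - 1) / N =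
      ((-(1 / N) : ℝ) : ℂ) + ((2 * Real.pi * ξ / N : ℝ) : ℂ) * Complex.I := by
    push_cast; ring
  rw [this, Complex.add_re, Complex.ofReal_re, Complex.re_ofReal_mul, Complex.I_re, mul_zero,
    add_zero]

theorem norm_mehlerParam_lt_one {N : ℝ} (hN : 1 ≤ N) (ξ : ℝ) : ‖mehlerParam N ξ‖ < 1 := by
  rw [norm_mehlerParam, Real.exp_lt_one_iff]
  have : 0 < 1 / N := by positivity
  linarith

/-- Up to a factor 4 and a power `d/2`, the left side is the `L¹` norm of the Gaussian majorant
(`lintegral_mehlerBound`). What matters is that the bound is polynomial in `ξ` and independent of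
`N`. -/
theorem mehlerParam_ratio {N : ℝ} (hN : 1 ≤ N) (ξ : ℝ) :
    ‖1 - mehlerParam N ξ‖ / ((1 - ‖mehlerParam N ξ‖ ^ 2) * ‖1 + mehlerParam N ξ‖) ≤
      448 * (1 + ξ ^ 2) := by
  set w := mehlerParam N ξ with hw
  have hN0 : 0 < N := by linarith
  have hlt := norm_mehlerParam_lt_one hN ξ
  rw [← hw] at hlt
  have hgap : 1 / (2 * N) ≤ 1 - ‖w‖ := by
    rw [hw, norm_mehlerParam, Real.exp_neg]
    have h1 : 1 + 1 / N ≤ Real.exp (1 / N) := by linarith [Real.add_one_le_exp (1 / N)]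
    have h2 : (Real.exp (1 / N))⁻¹ ≤ (1 + 1 / N)⁻¹ := by gcongr
    have h3 : (1 + 1 / N)⁻¹ = N / (N + 1) := by field_simp
    have h4 : 1 / (2 * N) ≤ 1 - N / (N + 1) := by
      rw [one_sub_div (by positivity), div_le_div_iff₀ (by positivity) (by positivity)]
      linarith
    linarith
  have hgap2 : 1 / (2 * N) ≤ 1 - ‖w‖ ^ 2 := by nlinarith [norm_nonneg w]
  have hplus : 1 / (2 * N) ≤ ‖1 + w‖ := by
    have := norm_sub_norm_le (1 : ℂ) (-w)
    simp at this
    linarith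
  have hpos : 0 < 1 / (2 * N) := by positivity
  have hgap0 : 0 ≤ 1 - ‖w‖ ^ 2 := hpos.le.trans hgap2
  set z : ℂ := (2 * Real.pi * ξ * Complex.I - 1) / N with hz
  have hwz : w = Complex.exp z := rfl
  have hznorm : ‖z‖ = ‖(2 * Real.pi * ξ * Complex.I - 1 : ℂ)‖ / N := by
    rw [hz, norm_div, Complex.norm_real, Real.norm_of_nonneg hN0.le]
  have hnum : ‖(2 * Real.pi * ξ * Complex.I - 1 : ℂ)‖ ≤ 2 * Real.pi * |ξ| + 1 := by
    refine (norm_sub_le _ _).trans (le_of_eq ?_)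
    simp [abs_of_pos Real.pi_pos]
  have hpi : 2 * Real.pi * |ξ| + 1 ≤ 7 * |ξ| + 1 := by
    have := Real.pi_lt_d2
    nlinarith [abs_nonneg ξ]
  have habs : |ξ| ^ 2 = ξ ^ 2 := sq_abs ξ
  -- For `|z| ≤ 1` the numerator is `O((1+|ξ|)/N)`, which compensates `1 - |w|² ≥ 1/(2N)`, while `|1
  -- + w| ≥ 1`. For `|z| > 1` the crude bounds cost `N²`, but then `N ≤ 7|ξ| + 1`.
  rcases le_or_gt ‖z‖ 1 with h1 | h1
  · have hA : ‖1 - w‖ ≤ 2 * ‖z‖ := by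
      rw [norm_sub_rev, hwz]; exact Complex.norm_exp_sub_one_le h1
    have hB : 1 ≤ ‖1 + w‖ := by
      have him : |z.im| ≤ 1 := (Complex.abs_im_le_norm z).trans h1
      have hcos : 0 ≤ Real.cos z.im := by
        apply Real.cos_nonneg_of_neg_pi_div_two_le_of_le <;>
          linarith [abs_le.1 him, Real.pi_gt_three, (abs_le.1 him).1, (abs_le.1 him).2]
      have hre : 0 ≤ w.re := by
        rw [hwz, Complex.exp_re]; positivity
      calc (1 : ℝ) ≤ (1 + w).re := by simp [hre]
        _ ≤ _ := Complex.re_le_norm _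
    calc _ ≤ 2 * ‖z‖ / (1 / (2 * N) * 1) := by gcongr
      _ = 4 * ‖(2 * Real.pi * ξ * Complex.I - 1 : ℂ)‖ := by
        rw [hznorm]; field_simp; ring
      _ ≤ 4 * (7 * |ξ| + 1) := by linarith
      _ ≤ _ := by nlinarith [sq_nonneg (|ξ| - 1)]
  · have hA : ‖1 - w‖ ≤ 2 := by
      refine (norm_sub_le _ _).trans ?_
      simp; linarith
    have hNle : N ≤ 7 * |ξ| + 1 := by
      rw [hznorm, lt_div_iff₀ hN0] at h1
      linarith
    calc _ ≤ 2 / (1 / (2 * N) * (1 / (2 * N))) := by gcongr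
      _ = 8 * N ^ 2 := by field_simp; ring
      _ ≤ 8 * (7 * |ξ| + 1) ^ 2 := by gcongr
      _ ≤ _ := by nlinarith [sq_nonneg (|ξ| - 1)]

/-- The Gaussian majorant of `mehlerD` as a function of `x - y`. -/
noncomputable def mehlerBound (w : ℂ) (z : EuclideanSpace ℝ (Fin d)) : ℝ :=
  (Real.sqrt (Real.pi * ‖1 - w ^ 2‖))⁻¹ ^ d *
    Real.exp (-((1 - ‖w‖ ^ 2) / ‖1 - w‖ ^ 2 / 4) * ‖z‖ ^ 2)

theorem mehlerBound_nonneg (w : ℂ) (z : EuclideanSpace ℝ (Fin d)) : 0 ≤ mehlerBound w z := by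
  unfold mehlerBound; positivity

/-- In the product of the prefactor with the Gaussian integral, `π` cancels, and `|1 - w²| = |1 -
w||1 + w|` removes one factor `|1 - w|`. -/
theorem lintegral_mehlerBound {w : ℂ} (hw : ‖w‖ < 1) :
    ∫⁻ z : EuclideanSpace ℝ (Fin d), ENNReal.ofReal (mehlerBound w z) =
      ENNReal.ofReal (Real.sqrt (4 * (‖1 - w‖ / ((1 - ‖w‖ ^ 2) * ‖1 + w‖))) ^ d) := by
  have hre := one_sub_sq_re_pos hw
  have hne : (1 - w ^ 2) ≠ 0 := fun h => by rw [h] at hre; simp at hre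
  have hfac : (1 - w ^ 2) = (1 - w) * (1 + w) := by ring
  have h1 : 0 < ‖1 - w‖ := norm_pos_iff.2 fun h => hne (by rw [hfac, h, zero_mul])
  have h2 : 0 < ‖1 + w‖ := norm_pos_iff.2 fun h => hne (by rw [hfac, h, mul_zero])
  have h3 : 0 < 1 - ‖w‖ ^ 2 := by
    have := pow_lt_one₀ (norm_nonneg w) hw two_ne_zero
    linarith
  have hb : 0 < (1 - ‖w‖ ^ 2) / ‖1 - w‖ ^ 2 / 4 := by positivity
  have hI := GaussianFourier.integral_rexp_neg_mul_sq_norm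
    (V := EuclideanSpace ℝ (Fin d)) hb
  have hint : Integrable (fun v : EuclideanSpace ℝ (Fin d) =>
      Real.exp (-((1 - ‖w‖ ^ 2) / ‖1 - w‖ ^ 2 / 4) * ‖v‖ ^ 2)) := by
    -- A non-integrable function has Bochner integral `0`, whereas the known value is positive.
    by_contra hcon
    rw [integral_undef hcon] at hI
    have : 0 < (Real.pi / ((1 - ‖w‖ ^ 2) / ‖1 - w‖ ^ 2 / 4)) ^
        ((Module.finrank ℝ (EuclideanSpace ℝ (Fin d)) : ℝ) / 2) := by positivity
    linarith
  rw [← ofReal_integral_eq_lintegral_ofReal (by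
    unfold mehlerBound; exact hint.const_mul _)
    (Filter.Eventually.of_forall (mehlerBound_nonneg w))]
  congr 1
  simp only [mehlerBound]
  rw [integral_const_mul, hI, finrank_euclideanSpace_fin]
  have hsq : (Real.pi / ((1 - ‖w‖ ^ 2) / ‖1 - w‖ ^ 2 / 4)) ^ ((d : ℝ) / 2) =
      Real.sqrt (Real.pi / ((1 - ‖w‖ ^ 2) / ‖1 - w‖ ^ 2 / 4)) ^ d := by
    have hA : 0 ≤ Real.pi / ((1 - ‖w‖ ^ 2) / ‖1 - w‖ ^ 2 / 4) := by positivity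
    generalize Real.pi / ((1 - ‖w‖ ^ 2) / ‖1 - w‖ ^ 2 / 4) = A at hA
    rw [Real.sqrt_eq_rpow, ← Real.rpow_natCast, ← Real.rpow_mul hA]
    congr 1; ring
  rw [hsq, ← mul_pow, ← Real.sqrt_inv, ← Real.sqrt_mul (by positivity)]
  congr 2
  rw [hfac, norm_mul]
  have := Real.pi_pos
  field_simp

theorem lintegral_mehlerBound_mehlerParam_le {N : ℝ} (hN : 1 ≤ N) (ξ : ℝ) :
    ∫⁻ z : EuclideanSpace ℝ (Fin d), ENNReal.ofReal (mehlerBound (mehlerParam N ξ) z) ≤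
      ENNReal.ofReal ((1792 * (1 + ξ ^ 2)) ^ d) := by
  rw [lintegral_mehlerBound (norm_mehlerParam_lt_one hN ξ)]
  apply ENNReal.ofReal_le_ofReal
  gcongr
  rw [Real.sqrt_le_left (by positivity)]
  have h := mehlerParam_ratio hN ξ
  nlinarith [sq_nonneg ξ]

theorem continuous_mehlerParam (N : ℝ) : Continuous (mehlerParam N) := by
  unfold mehlerParam; fun_prop

theorem measurable_mehlerBound (N : ℝ) :
    Measurable fun q : EuclideanSpace ℝ (Fin d) × ℝ => mehlerBound (mehlerParam N q.2) q.1 := by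
  have := (continuous_mehlerParam N).measurable
  unfold mehlerBound
  fun_prop

/-- Fourier inversion for `g(t) e^t` instead of `g`. The resulting damping `e^{-t}` moves the Mehler
parameter from the unit circle into the open disc, where the series converges. -/
theorem eq_integral_fourier_of_hasCompactSupport {g : ℝ → ℂ} (hg : ContDiff ℝ ∞ g)
    (hc : HasCompactSupport g) :
    ∃ G : 𝓢(ℝ, ℂ), ∀ t : ℝ, g t =
      ∫ ξ : ℝ, G ξ * Complex.exp ((2 * Real.pi * ξ * Complex.I - 1) * t) := by
  have hc' : HasCompactSupport fun t : ℝ => g t * Complex.exp t := hc.mul_right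
  have hg' : ContDiff ℝ ∞ fun t : ℝ => g t * Complex.exp t := by
    refine hg.mul ?_
    exact (Complex.contDiff_exp (𝕜 := ℝ)).comp Complex.ofRealCLM.contDiff
  set S : 𝓢(ℝ, ℂ) := hc'.toSchwartzMap hg' with hS
  refine ⟨FourierTransform.fourier S, fun t => ?_⟩
  have h1 : S t = g t * Complex.exp t := rfl
  have h2 : FourierTransformInv.fourierInv (FourierTransform.fourier S) = S :=
    FourierTransform.fourierInv_fourier_eq S
  have h3 : S t = ∫ ξ : ℝ, Complex.exp (((2 * Real.pi * (ξ * t) : ℝ) : ℂ) * Complex.I) •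
      (FourierTransform.fourier S) ξ := by
    conv_lhs => rw [← h2, SchwartzMap.fourierInv_coe]
    rw [Real.fourierInv_eq']
    simp [mul_comm]
  have h4 : g t = Complex.exp (-t) * S t := by
    rw [h1, mul_left_comm, ← Complex.exp_add]; simp
  rw [h4, h3, ← integral_const_mul]
  refine integral_congr_ae (Filter.Eventually.of_forall fun ξ => ?_)
  simp only [smul_eq_mul]
  rw [← mul_assoc, ← Complex.exp_add, mul_comm]
  congr 2
  push_cast
  ring

theorem integrable_norm_mul_pow (G : 𝓢(ℝ, ℂ)) (n : ℕ) :
    Integrable fun ξ : ℝ => ‖G ξ‖ * (1 + ξ ^ 2) ^ n := by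
  have h1 : Integrable fun ξ : ℝ => ‖G ξ‖ := G.integrable.norm
  have h2 : Integrable fun ξ : ℝ => ‖ξ‖ ^ (2 * n) * ‖G ξ‖ := G.integrable_pow_mul volume (2 * n)
  refine ((h1.add h2).const_mul (2 ^ n)).mono' (by fun_prop)
    (Filter.Eventually.of_forall fun ξ => ?_)
  rw [Real.norm_eq_abs, abs_of_nonneg (by positivity)]
  have h3 : (1 + ξ ^ 2) ^ n ≤ 2 ^ n * (1 + ‖ξ‖ ^ (2 * n)) := by
    rcases le_total (ξ ^ 2) 1 with h | h
    · calc (1 + ξ ^ 2) ^ n ≤ (2 : ℝ) ^ n := by gcongr; linarith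
        _ ≤ _ := le_mul_of_one_le_right (by positivity)
          (by have : 0 ≤ ‖ξ‖ ^ (2 * n) := by positivity
              linarith)
    · calc (1 + ξ ^ 2) ^ n ≤ (2 * ξ ^ 2) ^ n := by gcongr; linarith
        _ = 2 ^ n * ‖ξ‖ ^ (2 * n) := by rw [mul_pow, pow_mul, Real.norm_eq_abs, sq_abs]
        _ ≤ _ := by gcongr; linarith
  simp only [Pi.add_apply]
  calc _ ≤ ‖G ξ‖ * (2 ^ n * (1 + ‖ξ‖ ^ (2 * n))) := by gcongr
    _ = _ := by ring

/-- The kernels `∑ g(ν/N) ℋ_ν(x,y)` are dominated by `L¹` convolution kernels, uniformly in `N`. -/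
theorem exists_kernel_bound (d : ℕ) {g : ℝ → ℂ} (hg : ContDiff ℝ ∞ g) (hc : HasCompactSupport g) :
    ∃ C : ℝ≥0∞, C ≠ ⊤ ∧ ∀ N : ℝ, 1 ≤ N → ∃ k : EuclideanSpace ℝ (Fin d) → ℝ≥0∞,
      Measurable k ∧ ∫⁻ z, k z ≤ C ∧
      ∀ (T : Finset ℕ), (∀ ν ∉ T, g (ν / N) = 0) → ∀ x y : EuclideanSpace ℝ (Fin d),
        ‖∑ ν ∈ T, g (ν / N) * kernelH ν x y‖ₑ ≤ k (x - y) := by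
  obtain ⟨G, hG⟩ := eq_integral_fourier_of_hasCompactSupport hg hc
  have hGint : Integrable fun ξ : ℝ => ‖G ξ‖ * (1792 * (1 + ξ ^ 2)) ^ d := by
    refine ((integrable_norm_mul_pow G d).const_mul (1792 ^ d)).congr
      (Filter.Eventually.of_forall fun ξ => ?_)
    simp only [mul_pow]; ring
  refine ⟨∫⁻ ξ, ENNReal.ofReal (‖G ξ‖ * (1792 * (1 + ξ ^ 2)) ^ d),
    hGint.lintegral_lt_top.ne, fun N hN => ?_⟩
  have hmeas : Measurable fun q : EuclideanSpace ℝ (Fin d) × ℝ =>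
      ‖G q.2‖ₑ * ENNReal.ofReal (mehlerBound (mehlerParam N q.2) q.1) := by
    have h1 := measurable_mehlerBound (d := d) N
    have h2 : Measurable G := G.continuous.measurable
    fun_prop
  -- The majorant is the superposition of the Gaussian bounds with weight `|G|`. By Tonelli its mass
  -- is at most `∫ |G(ξ)| (1792(1 + ξ²))^d dξ`, which does not involve `N`.
  refine ⟨fun z => ∫⁻ ξ, ‖G ξ‖ₑ * ENNReal.ofReal (mehlerBound (mehlerParam N ξ) z),
    hmeas.lintegral_prod_right', ?_, ?_⟩
  · rw [lintegral_lintegral_swap hmeas.aemeasurable]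
    refine lintegral_mono fun ξ => ?_
    rw [lintegral_const_mul' _ _ (by simp), ENNReal.ofReal_mul (norm_nonneg _),
      ofReal_norm]
    gcongr
    exact lintegral_mehlerBound_mehlerParam_le hN ξ
  · intro T hT x y
    have hN0 : (0 : ℝ) < N := by linarith
    have hterm : ∀ ν : ℕ, g (ν / N) * kernelH ν x y =
        ∫ ξ : ℝ, G ξ * (mehlerParam N ξ ^ ν * kernelH ν x y) := by
      intro ν
      rw [hG, ← integral_mul_const]
      refine integral_congr_ae (Filter.Eventually.of_forall fun ξ => ?_)
      simp only [mehlerParam]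
      rw [← Complex.exp_nat_mul, mul_assoc]
      congr 3
      push_cast
      ring
    have hr : ‖((Real.exp (-(1 / N)) : ℝ) : ℂ)‖ < 1 := by
      rw [Complex.norm_real, Real.norm_of_nonneg (Real.exp_pos _).le,
        ← norm_mehlerParam N 0]
      exact norm_mehlerParam_lt_one hN 0
    have hsumm := (hasSum_mehlerD hr x y).summable.norm
    have hnorm : ∀ (ν : ℕ) (ξ : ℝ), ‖G ξ * (mehlerParam N ξ ^ ν * kernelH ν x y)‖ =
        ‖G ξ‖ * ‖((Real.exp (-(1 / N)) : ℝ) : ℂ) ^ ν * kernelH ν x y‖ := by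
      intro ν ξ
      rw [norm_mul, norm_mul, norm_mul, norm_pow, norm_pow, norm_mehlerParam, Complex.norm_real,
        Real.norm_of_nonneg (Real.exp_pos _).le]
    have hcont : ∀ ν : ℕ, Continuous fun ξ : ℝ =>
        G ξ * (mehlerParam N ξ ^ ν * kernelH ν x y) := fun ν =>
      G.continuous.mul (((continuous_mehlerParam N).pow ν).mul continuous_const)
    have hInt : ∀ ν : ℕ, Integrable fun ξ : ℝ =>
        G ξ * (mehlerParam N ξ ^ ν * kernelH ν x y) := fun ν => by
      refine (G.integrable.norm.mul_const _).mono' (hcont ν).aestronglyMeasurable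
        (Filter.Eventually.of_forall fun ξ => (hnorm ν ξ).le)
    have hS := hasSum_integral_of_summable_integral_norm hInt (by
      simp only [hnorm, integral_mul_const]
      exact hsumm.mul_left _)
    have hval : ∀ ξ : ℝ, ∑' ν : ℕ, G ξ * (mehlerParam N ξ ^ ν * kernelH ν x y) =
        G ξ * mehlerD (mehlerParam N ξ) x y := fun ξ =>
      ((hasSum_mehlerD (norm_mehlerParam_lt_one hN ξ) x y).mul_left _).tsum_eq
    simp only [hval, ← hterm] at hS
    -- `T` contains all frequencies where `g(ν/N) ≠ 0`, so the finite sum is the whole series, which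
    -- has been summed under the integral.
    have hfin : HasSum (fun ν : ℕ => g (ν / N) * kernelH ν x y)
        (∑ ν ∈ T, g (ν / N) * kernelH ν x y) :=
      hasSum_sum_of_ne_finset_zero fun ν hν => by rw [hT ν hν, zero_mul]
    rw [hfin.unique hS]
    refine (enorm_integral_le_lintegral_enorm _).trans (lintegral_mono fun ξ => ?_)
    rw [enorm_mul]
    gcongr
    rw [← ofReal_norm]
    exact ENNReal.ofReal_le_ofReal (norm_mehlerD_le (norm_mehlerParam_lt_one hN ξ) x y)

open scoped LineDeriv

/-! ### Ladder operators on Schwartz functions and Hermite coefficients -/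

/-- Raise the `i`-th entry of a multi-index. -/
def idxUp (β : Fin d → ℕ) (i : Fin d) : Fin d → ℕ := Function.update β i (β i + 1)

/-- Lower the `i`-th entry of a multi-index. -/
def idxDown (β : Fin d → ℕ) (i : Fin d) : Fin d → ℕ := Function.update β i (β i - 1)

theorem sum_idxUp (β : Fin d → ℕ) (i : Fin d) : ∑ j, idxUp β i j = ∑ j, β j + 1 := by
  rw [idxUp, Finset.sum_update_of_mem (Finset.mem_univ i),
    ← Finset.add_sum_erase Finset.univ β (Finset.mem_univ i), Finset.sdiff_singleton_eq_erase]
  omega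

/-- Only an inequality, because `idxDown` leaves `β` unchanged when `β i = 0`. -/
theorem sum_le_sum_idxDown (β : Fin d → ℕ) (i : Fin d) : ∑ j, β j ≤ ∑ j, idxDown β i j + 1 := by
  rw [idxDown, Finset.sum_update_of_mem (Finset.mem_univ i),
    ← Finset.add_sum_erase Finset.univ β (Finset.mem_univ i), Finset.sdiff_singleton_eq_erase]
  omega

theorem idxUp_idxDown {β : Fin d → ℕ} {i : Fin d} (h : β i ≠ 0) : idxUp (idxDown β i) i = β := by
  have : β i - 1 + 1 = β i := by omega
  simp [idxDown, idxUp, this]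

theorem hermiteS_update (β : Fin d → ℕ) (i : Fin d) (m : ℕ) (x : EuclideanSpace ℝ (Fin d)) :
    hermiteS (Function.update β i m) x =
      (hermiteFn m (x i) : ℂ) * ∏ j ∈ Finset.univ.erase i, (hermiteFn (β j) (x j) : ℂ) := by
  rw [hermiteS_apply]
  push_cast
  rw [← Finset.mul_prod_erase Finset.univ _ (Finset.mem_univ i)]
  congr 1
  · simp
  · refine Finset.prod_congr rfl fun j hj => ?_
    rw [Function.update_of_ne (Finset.ne_of_mem_erase hj)]

theorem hermiteS_eq_mul (β : Fin d → ℕ) (i : Fin d) (x : EuclideanSpace ℝ (Fin d)) :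
    hermiteS β x =
      (hermiteFn (β i) (x i) : ℂ) * ∏ j ∈ Finset.univ.erase i, (hermiteFn (β j) (x j) : ℂ) := by
  have := hermiteS_update β i (β i) x
  rwa [Function.update_eq_self] at this

theorem hasTemperateGrowth_coord (i : Fin d) :
    Function.HasTemperateGrowth (fun x : EuclideanSpace ℝ (Fin d) => x i) :=
  (EuclideanSpace.proj i : EuclideanSpace ℝ (Fin d) →L[ℝ] ℝ).hasTemperateGrowth

/-- Multiplication by the `i`-th coordinate. -/
noncomputable def mulCoord (i : Fin d) (ψ : 𝓢(EuclideanSpace ℝ (Fin d), ℂ)) :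
    𝓢(EuclideanSpace ℝ (Fin d), ℂ) :=
  SchwartzMap.smulLeftCLM ℂ (fun x : EuclideanSpace ℝ (Fin d) => x i) ψ

@[simp]
theorem mulCoord_apply (i : Fin d) (ψ : 𝓢(EuclideanSpace ℝ (Fin d), ℂ))
    (x : EuclideanSpace ℝ (Fin d)) : mulCoord i ψ x = (x i : ℂ) * ψ x := by
  simp [mulCoord, SchwartzMap.smulLeftCLM_apply_apply (hasTemperateGrowth_coord i)]

/-- The `i`-th partial derivative. -/
noncomputable def partialD (i : Fin d) (ψ : 𝓢(EuclideanSpace ℝ (Fin d), ℂ)) :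
    𝓢(EuclideanSpace ℝ (Fin d), ℂ) :=
  ∂_{EuclideanSpace.single i (1 : ℝ)} ψ

theorem partialD_apply (i : Fin d) (ψ : 𝓢(EuclideanSpace ℝ (Fin d), ℂ))
    (x : EuclideanSpace ℝ (Fin d)) :
    partialD i ψ x = fderiv ℝ ψ x (EuclideanSpace.single i (1 : ℝ)) := rfl

theorem mulCoord_hermiteS (β : Fin d → ℕ) (i : Fin d) (x : EuclideanSpace ℝ (Fin d)) :
    mulCoord i (hermiteS β) x = (Real.sqrt (β i / 2) : ℂ) * hermiteS (idxDown β i) x +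
      (Real.sqrt ((β i + 1) / 2) : ℂ) * hermiteS (idxUp β i) x := by
  rw [mulCoord_apply, idxDown, idxUp, hermiteS_update, hermiteS_update, hermiteS_eq_mul β i]
  have := congrArg (fun r : ℝ => (r : ℂ)) (mul_hermiteFn (β i) (x i))
  push_cast at this
  rw [← mul_assoc, this]
  ring

theorem partialD_hermiteS (β : Fin d → ℕ) (i : Fin d) (x : EuclideanSpace ℝ (Fin d)) :
    partialD i (hermiteS β) x = (Real.sqrt (β i / 2) : ℂ) * hermiteS (idxDown β i) x -
      (Real.sqrt ((β i + 1) / 2) : ℂ) * hermiteS (idxUp β i) x := by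
  have h1 : HasLineDerivAt ℝ (hermiteS β) (partialD i (hermiteS β) x) x
      (EuclideanSpace.single i (1 : ℝ)) := ((hermiteS β).hasFDerivAt x).hasLineDerivAt _
  have h2 : HasLineDerivAt ℝ (hermiteS β) ((Real.sqrt (β i / 2) : ℂ) * hermiteS (idxDown β i) x -
      (Real.sqrt ((β i + 1) / 2) : ℂ) * hermiteS (idxUp β i) x) x
      (EuclideanSpace.single i (1 : ℝ)) := by
    unfold HasLineDerivAt
    have he : (fun t : ℝ => hermiteS β (x + t • EuclideanSpace.single i (1 : ℝ))) =
        fun t : ℝ => (hermiteFn (β i) (x i + t) : ℂ) *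
          ∏ j ∈ Finset.univ.erase i, (hermiteFn (β j) (x j) : ℂ) := by
      funext t
      rw [hermiteS_eq_mul β i]
      congr 1
      · simp
      · refine Finset.prod_congr rfl fun j hj => ?_
        simp [Finset.ne_of_mem_erase hj]
    rw [he]
    have hd := hasDerivAt_hermiteFn (β i) (x i + 0)
    have hd' : HasDerivAt (fun t : ℝ => hermiteFn (β i) (x i + t)) _ 0 :=
      hd.comp_const_add (x i) 0
    refine (hd'.ofReal_comp.mul_const _).congr_deriv ?_
    rw [idxDown, idxUp, hermiteS_update, hermiteS_update, add_zero]
    push_cast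
    ring
  exact h1.unique h2

/-- The Hermite coefficient `∫ ℋ_β ψ`. -/
noncomputable def hcoef (β : Fin d → ℕ) (ψ : 𝓢(EuclideanSpace ℝ (Fin d), ℂ)) : ℂ :=
  ∫ x, hermiteS β x * ψ x

theorem integrable_mul (φ ψ : 𝓢(EuclideanSpace ℝ (Fin d), ℂ)) :
    Integrable fun x => φ x * ψ x :=
  (SchwartzMap.pairing (ContinuousLinearMap.mul ℝ ℂ) φ ψ).integrable

theorem hcoef_add (β : Fin d → ℕ) (φ ψ : 𝓢(EuclideanSpace ℝ (Fin d), ℂ)) :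
    hcoef β (φ + ψ) = hcoef β φ + hcoef β ψ := by
  simp only [hcoef, add_apply, mul_add]
  exact integral_add (integrable_mul _ _) (integrable_mul _ _)

theorem hcoef_sub (β : Fin d → ℕ) (φ ψ : 𝓢(EuclideanSpace ℝ (Fin d), ℂ)) :
    hcoef β (φ - ψ) = hcoef β φ - hcoef β ψ := by
  simp only [hcoef, sub_apply, mul_sub]
  exact integral_sub (integrable_mul _ _) (integrable_mul _ _)

theorem hcoef_smul (β : Fin d → ℕ) (c : ℂ) (ψ : 𝓢(EuclideanSpace ℝ (Fin d), ℂ)) :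
    hcoef β (c • ψ) = c * hcoef β ψ := by
  simp only [hcoef, smul_apply, smul_eq_mul, mul_left_comm _ c]
  exact integral_const_mul _ _

theorem hcoef_sum {ι : Type*} (s : Finset ι) (β : Fin d → ℕ)
    (ψ : ι → 𝓢(EuclideanSpace ℝ (Fin d), ℂ)) :
    hcoef β (∑ i ∈ s, ψ i) = ∑ i ∈ s, hcoef β (ψ i) := by
  classical
  induction s using Finset.induction_on with
  | empty => simp [hcoef]
  | insert a s ha ih => rw [Finset.sum_insert ha, Finset.sum_insert ha, hcoef_add, ih]

theorem hcoef_mulCoord (β : Fin d → ℕ) (i : Fin d) (ψ : 𝓢(EuclideanSpace ℝ (Fin d), ℂ)) :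
    hcoef β (mulCoord i ψ) = (Real.sqrt (β i / 2) : ℂ) * hcoef (idxDown β i) ψ +
      (Real.sqrt ((β i + 1) / 2) : ℂ) * hcoef (idxUp β i) ψ := by
  simp only [hcoef]
  rw [← integral_const_mul, ← integral_const_mul,
    ← integral_add ((integrable_mul _ _).const_mul _) ((integrable_mul _ _).const_mul _)]
  refine integral_congr_ae (Filter.Eventually.of_forall fun x => ?_)
  have := mulCoord_hermiteS β i x
  simp only [mulCoord_apply] at this ⊢
  linear_combination ψ x * this

theorem hcoef_partialD (β : Fin d → ℕ) (i : Fin d) (ψ : 𝓢(EuclideanSpace ℝ (Fin d), ℂ)) :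
    hcoef β (partialD i ψ) = -(Real.sqrt (β i / 2) : ℂ) * hcoef (idxDown β i) ψ +
      (Real.sqrt ((β i + 1) / 2) : ℂ) * hcoef (idxUp β i) ψ := by
  have h := SchwartzMap.integral_mul_lineDerivOp_right_eq_neg_left (μ := volume) (hermiteS β) ψ
    (EuclideanSpace.single i (1 : ℝ))
  have h' : hcoef β (partialD i ψ) = -∫ x, partialD i (hermiteS β) x * ψ x := h
  rw [h']
  simp only [hcoef]
  rw [← integral_const_mul, ← integral_const_mul, ← integral_neg,
    ← integral_add ((integrable_mul _ _).const_mul _) ((integrable_mul _ _).const_mul _)]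
  refine integral_congr_ae (Filter.Eventually.of_forall fun x => ?_)
  have := partialD_hermiteS β i x
  simp only [this]
  ring

/-- Multiplication and differentiation each mix the two neighbours of `β`; their sum keeps only the
upper one and their difference only the lower one. Both orthonormality and the eigenvalue relation
for `hermiteOp` come from this. -/
theorem hcoef_annihilate (β : Fin d → ℕ) (i : Fin d) (ψ : 𝓢(EuclideanSpace ℝ (Fin d), ℂ)) :
    hcoef β (mulCoord i ψ + partialD i ψ) =
      2 * (Real.sqrt ((β i + 1) / 2) : ℂ) * hcoef (idxUp β i) ψ := by
  rw [hcoef_add, hcoef_mulCoord, hcoef_partialD]; ring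

theorem hcoef_create (β : Fin d → ℕ) (i : Fin d) (ψ : 𝓢(EuclideanSpace ℝ (Fin d), ℂ)) :
    hcoef β (mulCoord i ψ - partialD i ψ) =
      2 * (Real.sqrt (β i / 2) : ℂ) * hcoef (idxDown β i) ψ := by
  rw [hcoef_sub, hcoef_mulCoord, hcoef_partialD]; ring

theorem annihilate_hermiteS (β : Fin d → ℕ) (i : Fin d) :
    mulCoord i (hermiteS β) + partialD i (hermiteS β) =
      (2 * (Real.sqrt (β i / 2) : ℂ)) • hermiteS (idxDown β i) := by
  ext x
  rw [add_apply, mulCoord_hermiteS, partialD_hermiteS, smul_apply,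
    smul_eq_mul]
  ring

theorem hcoef_hermiteS_comm (β γ : Fin d → ℕ) :
    hcoef β (hermiteS γ) = hcoef γ (hermiteS β) := by
  simp only [hcoef, mul_comm]

theorem hcoef_zero_zero : hcoef (0 : Fin d → ℕ) (hermiteS 0) = 1 := by
  have h0 : ∀ t : ℝ, hermiteFn 0 t = (Real.sqrt (Real.sqrt Real.pi))⁻¹ * Real.exp (-(t ^ 2 / 2)) := by
    intro t
    rw [hermiteFn_eq, hermiteH_zero, hermiteC]
    simp
  have h1 : ∀ x : EuclideanSpace ℝ (Fin d), hermiteS 0 x * hermiteS 0 x =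
      (((Real.sqrt Real.pi)⁻¹ ^ d * Real.exp (-1 * ‖x‖ ^ 2) : ℝ) : ℂ) := by
    intro x
    rw [hermiteS_apply, ← Complex.ofReal_mul, ← Finset.prod_mul_distrib]
    congr 1
    have : ∀ i, hermiteFn ((0 : Fin d → ℕ) i) (x i) * hermiteFn ((0 : Fin d → ℕ) i) (x i) =
        (Real.sqrt Real.pi)⁻¹ * Real.exp (-(x i) ^ 2) := by
      intro i
      simp only [Pi.zero_apply, h0]
      have e1 : (Real.sqrt (Real.sqrt Real.pi))⁻¹ * (Real.sqrt (Real.sqrt Real.pi))⁻¹ =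
          (Real.sqrt Real.pi)⁻¹ := by
        rw [← mul_inv, Real.mul_self_sqrt (Real.sqrt_nonneg _)]
      have e2 : Real.exp (-(x i ^ 2 / 2)) * Real.exp (-(x i ^ 2 / 2)) = Real.exp (-(x i) ^ 2) := by
        rw [← Real.exp_add]; congr 1; ring
      rw [← e1, ← e2]; ring
    simp only [this]
    rw [Finset.prod_mul_distrib, Finset.prod_const, ← Real.exp_sum, Finset.card_univ,
      Fintype.card_fin, EuclideanSpace.real_norm_sq_eq, Finset.sum_neg_distrib, neg_one_mul]
  simp only [hcoef, h1]
  rw [integral_complex_ofReal, integral_const_mul,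
    GaussianFourier.integral_rexp_neg_mul_sq_norm one_pos, finrank_euclideanSpace_fin, div_one]
  have : Real.pi ^ ((d : ℝ) / 2) = Real.sqrt Real.pi ^ d := by
    rw [Real.sqrt_eq_rpow, ← Real.rpow_natCast, ← Real.rpow_mul Real.pi_pos.le]
    congr 1; ring
  rw [this, ← mul_pow, inv_mul_cancel₀ (by positivity), one_pow, Complex.ofReal_one]

theorem sqrt_half_ne_zero (n : ℕ) : (2 * (Real.sqrt (((n : ℝ) + 1) / 2) : ℂ)) ≠ 0 := by
  refine mul_ne_zero two_ne_zero ?_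
  have : 0 < Real.sqrt (((n : ℝ) + 1) / 2) := by positivity
  exact_mod_cast this.ne'

/-- The Hermite functions are orthonormal. -/
theorem hcoef_hermiteS (β γ : Fin d → ℕ) :
    hcoef β (hermiteS γ) = if β = γ then 1 else 0 := by
  -- `x_i + ∂_i` annihilates the ground state, while pairing with it produces a nonzero multiple of
  -- the coefficient at the raised index.
  have hzero : ∀ γ : Fin d → ℕ, γ ≠ 0 → hcoef γ (hermiteS 0) = 0 := by
    intro γ hγ
    obtain ⟨i, hi⟩ : ∃ i, γ i ≠ 0 := by
      by_contra h; push Not at h; exact hγ (funext h)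
    have h1 := hcoef_annihilate (idxDown γ i) i (hermiteS 0)
    rw [annihilate_hermiteS, hcoef_smul, idxUp_idxDown hi] at h1
    simp only [Pi.zero_apply, Nat.cast_zero, zero_div, Real.sqrt_zero, Complex.ofReal_zero,
      mul_zero, zero_mul] at h1
    exact (mul_eq_zero.1 h1.symm).resolve_left (sqrt_half_ne_zero _)
  induction hn : ∑ i, β i generalizing β γ with
  | zero =>
    have hβ : β = 0 := by
      funext i
      exact (Finset.sum_eq_zero_iff.1 hn) i (Finset.mem_univ i)
    subst hβ
    by_cases hγ : γ = 0
    · subst hγ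
      simp [hcoef_zero_zero]
    · rw [if_neg (Ne.symm hγ), hcoef_hermiteS_comm, hzero γ hγ]
  | succ n ih =>
    obtain ⟨i, hi⟩ : ∃ i, β i ≠ 0 := by
      by_contra h; push Not at h
      simp [h] at hn
    have hup := idxUp_idxDown hi
    have hsum : ∑ j, idxDown β i j = n := by
      have := sum_idxUp (idxDown β i) i
      rw [hup] at this
      omega
    -- Computing `x_i + ∂_i` on `ℋ_γ` in two ways relates the coefficient at `(β, γ)` to the one at
    -- both indices lowered, where the induction hypothesis applies. If `γ i = 0`, the relation has
    -- the factor `√0` and the coefficient vanishes.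
    have h1 := hcoef_annihilate (idxDown β i) i (hermiteS γ)
    rw [annihilate_hermiteS, hcoef_smul, hup, ih _ _ hsum] at h1
    have hne := sqrt_half_ne_zero (idxDown β i i)
    by_cases hg : γ i = 0
    · have hne' : β ≠ γ := fun h => hi (by rw [h, hg])
      rw [if_neg hne']
      rw [hg] at h1
      simp only [Nat.cast_zero, zero_div, Real.sqrt_zero, Complex.ofReal_zero,
        mul_zero, zero_mul] at h1
      exact (mul_eq_zero.1 h1.symm).resolve_left hne
    · by_cases hbg : β = γ
      · subst hbg
        have hc : ((idxDown β i i : ℕ) : ℝ) + 1 = β i := by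
          have : idxDown β i i + 1 = β i := by simp [idxDown]; omega
          exact_mod_cast this
        rw [if_pos rfl, hc, mul_one] at h1
        rw [hc] at hne
        rw [if_pos rfl]
        exact mul_left_cancel₀ hne (by rw [mul_one]; exact h1.symm)
      · have : idxDown β i ≠ idxDown γ i := fun h => hbg (by
          rw [← hup, h, idxUp_idxDown hg])
        rw [if_neg this, mul_zero] at h1
        rw [if_neg hbg]
        exact (mul_eq_zero.1 h1.symm).resolve_left hne

/-! ### Decay of Hermite coefficients -/

/-- The Hermite operator, normalised to have eigenvalue `2|β| + 1` at `ℋ_β`. -/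
noncomputable def hermiteOp (ψ : 𝓢(EuclideanSpace ℝ (Fin d), ℂ)) :
    𝓢(EuclideanSpace ℝ (Fin d), ℂ) :=
  ψ + ∑ i, (mulCoord i (mulCoord i ψ + partialD i ψ) - partialD i (mulCoord i ψ + partialD i ψ))

theorem hcoef_hermiteOp (β : Fin d → ℕ) (ψ : 𝓢(EuclideanSpace ℝ (Fin d), ℂ)) :
    hcoef β (hermiteOp ψ) = (1 + 2 * (∑ i, β i : ℕ)) * hcoef β ψ := by
  rw [hermiteOp, hcoef_add, hcoef_sum]
  have : ∀ i, hcoef β (mulCoord i (mulCoord i ψ + partialD i ψ) -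
      partialD i (mulCoord i ψ + partialD i ψ)) = 2 * (β i : ℂ) * hcoef β ψ := by
    intro i
    rw [hcoef_create]
    by_cases h : β i = 0
    · simp [h]
    · rw [hcoef_annihilate, idxUp_idxDown h]
      have hc : ((idxDown β i i : ℕ) : ℝ) + 1 = β i := by
        have : idxDown β i i + 1 = β i := by simp [idxDown]; omega
        exact_mod_cast this
      rw [hc]
      have hs : (Real.sqrt (β i / 2) : ℂ) * (Real.sqrt (β i / 2) : ℂ) = (β i : ℂ) / 2 := by
        rw [← Complex.ofReal_mul, Real.mul_self_sqrt (by positivity)]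
        push_cast; rfl
      linear_combination 4 * hcoef β ψ * hs
  simp only [this]
  push_cast
  rw [← Finset.sum_mul, ← Finset.mul_sum]
  ring

theorem norm_hcoef_le (β : Fin d → ℕ) (ψ : 𝓢(EuclideanSpace ℝ (Fin d), ℂ)) :
    ‖hcoef β ψ‖ ≤ 2 * (1 + (∑ i, β i : ℕ) : ℝ) ^ d * ∫ x, ‖ψ x‖ := by
  rw [hcoef, ← integral_const_mul]
  refine norm_integral_le_of_norm_le (ψ.integrable.norm.const_mul _)
    (Filter.Eventually.of_forall fun x => ?_)
  rw [norm_mul]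
  gcongr
  exact norm_hermiteS_le β x

/-- Hermite coefficients of Schwartz functions decay rapidly. -/
theorem exists_hcoef_decay (K : ℕ) (ψ : 𝓢(EuclideanSpace ℝ (Fin d), ℂ)) :
    ∃ B : ℝ, ∀ β : Fin d → ℕ, (1 + (∑ i, β i : ℕ) : ℝ) ^ K * ‖hcoef β ψ‖ ≤ B := by
  -- Each application of `hermiteOp` gains the eigenvalue `1 + 2|β| ≥ 1 + |β|`. The factor
  -- `(1+|β|)^d` on the right is the growth of the Hermite functions in the base case; it is
  -- cancelled afterwards by using `K + d` in place of `K`.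
  have key : ∀ (K : ℕ) (ψ : 𝓢(EuclideanSpace ℝ (Fin d), ℂ)), ∃ B : ℝ, ∀ β : Fin d → ℕ,
      (1 + (∑ i, β i : ℕ) : ℝ) ^ K * ‖hcoef β ψ‖ ≤ B * (1 + (∑ i, β i : ℕ) : ℝ) ^ d := by
    intro K
    induction K with
    | zero =>
      intro ψ
      refine ⟨2 * ∫ x, ‖ψ x‖, fun β => ?_⟩
      have := norm_hcoef_le β ψ
      rw [pow_zero, one_mul]
      linarith
    | succ K ih =>
      intro ψ
      obtain ⟨B, hB⟩ := ih (hermiteOp ψ)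
      refine ⟨B, fun β => le_trans ?_ (hB β)⟩
      rw [hcoef_hermiteOp, norm_mul, pow_succ, mul_assoc]
      gcongr
      have : (1 + 2 * ((∑ i, β i : ℕ) : ℂ)) = ((1 + 2 * (∑ i, β i : ℕ) : ℝ) : ℂ) := by
        push_cast; rfl
      rw [this, Complex.norm_real, Real.norm_of_nonneg (by positivity)]
      have : (0 : ℝ) ≤ (∑ i, β i : ℕ) := Nat.cast_nonneg _
      linarith
  obtain ⟨B, hB⟩ := key (K + d) ψ
  refine ⟨B, fun β => ?_⟩
  have h1 : (0 : ℝ) < (1 + (∑ i, β i : ℕ) : ℝ) ^ d := by positivity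
  have h2 := hB β
  rw [pow_add, mul_right_comm] at h2
  exact le_of_mul_le_mul_right h2 h1

/-! ### Pointwise control by Hermite coefficients -/

theorem card_piAntidiag_le (d ν : ℕ) :
    (Finset.piAntidiag (Finset.univ : Finset (Fin d)) ν).card ≤ (1 + ν) ^ d := by
  have hsub : Finset.piAntidiag (Finset.univ : Finset (Fin d)) ν ⊆
      Fintype.piFinset fun _ => Finset.range (1 + ν) := by
    intro β hβ
    rw [Finset.mem_piAntidiag] at hβ
    rw [Fintype.mem_piFinset]
    intro i
    rw [Finset.mem_range]
    have := Finset.single_le_sum (f := β) (fun _ _ => Nat.zero_le _) (Finset.mem_univ i)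
    rw [hβ.1] at this
    omega
  refine (Finset.card_le_card hsub).trans (le_of_eq ?_)
  simp [Fintype.card_piFinset]

theorem norm_sum_piAntidiag_le {ν : ℕ} {B : ℝ} (hB : 0 ≤ B) {u : (Fin d → ℕ) → ℂ}
    (hu : ∀ β ∈ Finset.piAntidiag (Finset.univ : Finset (Fin d)) ν, ‖u β‖ ≤ B) :
    ‖∑ β ∈ Finset.piAntidiag (Finset.univ : Finset (Fin d)) ν, u β‖ ≤ (1 + ν : ℝ) ^ d * B := by
  refine (norm_sum_le_of_le _ hu).trans ?_
  rw [Finset.sum_const, nsmul_eq_mul]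
  gcongr
  exact_mod_cast card_piAntidiag_le d ν

theorem norm_hermiteS_le_of_mem {ν : ℕ} {β : Fin d → ℕ}
    (hβ : β ∈ Finset.piAntidiag (Finset.univ : Finset (Fin d)) ν)
    (x : EuclideanSpace ℝ (Fin d)) : ‖hermiteS β x‖ ≤ 2 * (1 + ν : ℝ) ^ d := by
  rw [Finset.mem_piAntidiag] at hβ
  have := norm_hermiteS_le β x
  rwa [hβ.1] at this

theorem summable_one_add_pow_mul_geometric (k : ℕ) {r : ℝ} (h0 : 0 ≤ r) (h1 : r < 1) :
    Summable fun ν : ℕ => (1 + ν : ℝ) ^ k * r ^ ν := by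
  have hr : ‖r‖ < 1 := by rwa [Real.norm_of_nonneg h0]
  have hs := ((summable_pow_mul_geometric_of_norm_lt_one 0 hr).add
    (summable_pow_mul_geometric_of_norm_lt_one k hr)).mul_left (2 ^ (k - 1))
  refine hs.of_nonneg_of_le (fun ν => by positivity) fun ν => ?_
  have := add_pow_le zero_le_one (Nat.cast_nonneg (α := ℝ) ν) k
  calc _ ≤ (2 ^ (k - 1) * (1 ^ k + (ν : ℝ) ^ k)) * r ^ ν := by gcongr
    _ = _ := by simp; ring

/-- Term by term integration of Mehler's series against a Schwartz function. -/
theorem hasSum_integral_mehlerD {r : ℝ} (h0 : 0 ≤ r) (h1 : r < 1)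
    (x : EuclideanSpace ℝ (Fin d)) (ψ : 𝓢(EuclideanSpace ℝ (Fin d), ℂ)) :
    HasSum (fun ν : ℕ => (r : ℂ) ^ ν * ∑ β ∈ Finset.piAntidiag (Finset.univ : Finset (Fin d)) ν,
      hermiteS β x * hcoef β ψ) (∫ y, mehlerD (r : ℂ) x y * ψ y) := by
  have hw : ‖(r : ℂ)‖ < 1 := by rwa [Complex.norm_real, Real.norm_of_nonneg h0]
  have hInt : ∀ ν : ℕ, Integrable fun y => (r : ℂ) ^ ν * kernelH ν x y * ψ y := fun ν => by
    simp only [mul_assoc]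
    exact (integrable_mul _ _).const_mul _
  have hbound : ∀ (ν : ℕ) (y : EuclideanSpace ℝ (Fin d)),
      ‖(r : ℂ) ^ ν * kernelH ν x y * ψ y‖ ≤ 4 * ((1 + ν : ℝ) ^ (3 * d) * r ^ ν) * ‖ψ y‖ := by
    intro ν y
    have hk : ‖kernelH ν x y‖ ≤ (1 + ν : ℝ) ^ d * (2 * (1 + ν : ℝ) ^ d * (2 * (1 + ν : ℝ) ^ d)) := by
      rw [kernelH_apply]
      refine norm_sum_piAntidiag_le (by positivity) fun β hβ => ?_
      rw [norm_mul]
      gcongr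
      · exact norm_hermiteS_le_of_mem hβ x
      · exact norm_hermiteS_le_of_mem hβ y
    rw [norm_mul, norm_mul, norm_pow, Complex.norm_real, Real.norm_of_nonneg h0]
    calc _ ≤ r ^ ν * ((1 + ν : ℝ) ^ d * (2 * (1 + ν : ℝ) ^ d * (2 * (1 + ν : ℝ) ^ d))) * ‖ψ y‖ := by
          gcongr
      _ = _ := by ring
  have hS := hasSum_integral_of_summable_integral_norm hInt (by
    refine Summable.of_nonneg_of_le (fun ν => integral_nonneg fun _ => norm_nonneg _)
      (fun ν => ?_) (((summable_one_add_pow_mul_geometric (3 * d) h0 h1).mul_left 4).mul_right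
        (∫ y, ‖ψ y‖))
    rw [← integral_const_mul]
    exact integral_mono (hInt ν).norm (ψ.integrable.norm.const_mul _) (hbound ν))
  have hval : ∀ y, ∑' ν : ℕ, (r : ℂ) ^ ν * kernelH ν x y * ψ y = mehlerD (r : ℂ) x y * ψ y :=
    fun y => ((hasSum_mehlerD hw x y).mul_right _).tsum_eq
  simp only [hval] at hS
  refine hS.congr_fun fun ν => ?_
  simp only [mul_assoc]
  rw [integral_const_mul]
  congr 1
  simp only [kernelH_apply, Finset.sum_mul]
  rw [integral_finsetSum _ fun β _ => by
    simp only [mul_assoc]; exact (integrable_mul _ _).const_mul _]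
  refine Finset.sum_congr rfl fun β _ => ?_
  simp only [mul_assoc]
  rw [integral_const_mul, hcoef]

/-- The substitution `y = x + √(1-r²) u` absorbs the singular prefactor. The exponent on the right
is continuous at `r = 1` with value `-b²`, which gives the pointwise limit in
`tendsto_integral_mehlerD`. -/
theorem mehler_dilate {r : ℝ} (h0 : 0 < r) (h1 : r < 1) (a b : ℝ) :
    (Real.sqrt (1 - r ^ 2) : ℂ) * mehler r a (a + Real.sqrt (1 - r ^ 2) * b) =
      (((Real.sqrt Real.pi)⁻¹ * Real.exp (-((1 - r) / (1 + r) * a ^ 2) -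
        (1 - r) / (1 + r) * Real.sqrt (1 - r ^ 2) * a * b - (1 + r ^ 2) * b ^ 2 / 2) : ℝ) : ℂ) := by
  have hpos : 0 < 1 - r ^ 2 := by nlinarith
  set s := Real.sqrt (1 - r ^ 2) with hs
  have hs2 : s ^ 2 = 1 - r ^ 2 := Real.sq_sqrt hpos.le
  have hspos : 0 < s := Real.sqrt_pos.2 hpos
  have hfac : (1 / (Real.pi * (1 - (r : ℂ) ^ 2))) ^ (1 / 2 : ℂ) =
      (((Real.sqrt Real.pi)⁻¹ * s⁻¹ : ℝ) : ℂ) := by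
    have : (1 / (Real.pi * (1 - (r : ℂ) ^ 2))) = (((Real.pi * (1 - r ^ 2))⁻¹ : ℝ) : ℂ) := by
      push_cast; simp
    rw [this, show (1 / 2 : ℂ) = ((1 / 2 : ℝ) : ℂ) by push_cast; rfl,
      ← Complex.ofReal_cpow (by positivity), ← Real.sqrt_eq_rpow, Real.sqrt_inv,
      Real.sqrt_mul Real.pi_pos.le, mul_inv]
  have hexp : (2 * a * ((a + s * b : ℝ) : ℂ) * r - (1 + (r : ℂ) ^ 2) *
      ((a : ℂ) ^ 2 + ((a + s * b : ℝ) : ℂ) ^ 2) / 2) / (1 - (r : ℂ) ^ 2) =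
      ((-((1 - r) / (1 + r) * a ^ 2) - (1 - r) / (1 + r) * s * a * b -
        (1 + r ^ 2) * b ^ 2 / 2 : ℝ) : ℂ) := by
    have hreal : (2 * a * (a + s * b) * r - (1 + r ^ 2) * (a ^ 2 + (a + s * b) ^ 2) / 2) /
        (1 - r ^ 2) = -((1 - r) / (1 + r) * a ^ 2) - (1 - r) / (1 + r) * s * a * b -
        (1 + r ^ 2) * b ^ 2 / 2 := by
      have h1r : 1 - r ≠ 0 := by linarith
      have h2r : 1 + r ≠ 0 := by linarith
      rw [div_eq_iff hpos.ne', show 1 - r ^ 2 = (1 - r) * (1 + r) by ring]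
      field_simp
      linear_combination (-(1 + r ^ 2) * b ^ 2) * hs2
    rw [← hreal]
    push_cast
    rfl
  rw [mehler, hfac, hexp]
  push_cast
  have : (s : ℂ) ≠ 0 := by exact_mod_cast hspos.ne'
  field_simp

/-- The majorant for dominated convergence, independent of `r`: the dilated exponent is
`-(1+r)²‖u‖²/4`, and the prefactor reduces to `π^{-d/2} ≤ 1`. -/
theorem norm_integrand_dilate_le {r : ℝ} (h0 : 0 < r) (h1 : r < 1)
    (x u : EuclideanSpace ℝ (Fin d)) :
    ‖(Real.sqrt (1 - r ^ 2) : ℂ) ^ d * mehlerD r x (x + Real.sqrt (1 - r ^ 2) • u)‖ ≤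
      Real.exp (-(1 / 4) * ‖u‖ ^ 2) := by
  have hpos : 0 < 1 - r ^ 2 := by nlinarith
  have hw : ‖(r : ℂ)‖ < 1 := by rwa [Complex.norm_real, Real.norm_of_nonneg h0.le]
  have hspos : 0 < Real.sqrt (1 - r ^ 2) := Real.sqrt_pos.2 hpos
  have hs2 : Real.sqrt (1 - r ^ 2) ^ 2 = 1 - r ^ 2 := Real.sq_sqrt hpos.le
  rw [norm_mul, norm_pow, Complex.norm_real, Real.norm_of_nonneg hspos.le]
  have hb := norm_mehlerD_le hw x (x + Real.sqrt (1 - r ^ 2) • u)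
  have e1 : (1 - (r : ℂ) ^ 2) = ((1 - r ^ 2 : ℝ) : ℂ) := by push_cast; rfl
  have e2 : (1 - (r : ℂ)) = ((1 - r : ℝ) : ℂ) := by push_cast; rfl
  have h1r : 0 < 1 - r := by linarith
  rw [e1, e2, Complex.norm_real, Complex.norm_real, Complex.norm_real, Real.norm_of_nonneg hpos.le,
    Real.norm_of_nonneg h0.le, Real.norm_of_nonneg h1r.le, sub_add_cancel_left, norm_neg, norm_smul,
    Real.norm_of_nonneg hspos.le, mul_pow, hs2] at hb
  calc _ ≤ Real.sqrt (1 - r ^ 2) ^ d * ((Real.sqrt (Real.pi * (1 - r ^ 2)))⁻¹ ^ d *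
        Real.exp (-((1 - r ^ 2) / (1 - r) ^ 2 / 4) * ((1 - r ^ 2) * ‖u‖ ^ 2))) := by gcongr
    _ = (Real.sqrt (1 - r ^ 2) * (Real.sqrt (Real.pi * (1 - r ^ 2)))⁻¹) ^ d *
        Real.exp (-((1 - r ^ 2) / (1 - r) ^ 2 / 4) * ((1 - r ^ 2) * ‖u‖ ^ 2)) := by
      rw [mul_pow]; ring
    _ ≤ 1 ^ d * Real.exp (-(1 / 4) * ‖u‖ ^ 2) := by
      gcongr ?_ ^ d * Real.exp ?_
      · rw [Real.sqrt_mul Real.pi_pos.le, mul_inv, mul_left_comm, mul_inv_cancel₀ hspos.ne', mul_one]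
        apply inv_le_one_of_one_le₀
        rw [Real.one_le_sqrt]
        linarith [Real.pi_gt_three]
      · have : (1 - r ^ 2) / (1 - r) ^ 2 / 4 * ((1 - r ^ 2) * ‖u‖ ^ 2) =
            (1 + r) ^ 2 / 4 * ‖u‖ ^ 2 := by
          rw [show 1 - r ^ 2 = (1 - r) * (1 + r) by ring]
          field_simp
        rw [neg_mul, this, neg_mul, neg_le_neg_iff]
        have : 1 ≤ (1 + r) ^ 2 := by nlinarith
        gcongr
    _ = _ := by rw [one_pow, one_mul]

theorem integrable_gaussian_euclidean {b : ℝ} (hb : 0 < b) :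
    Integrable fun v : EuclideanSpace ℝ (Fin d) => Real.exp (-b * ‖v‖ ^ 2) := by
  by_contra hcon
  have hI := GaussianFourier.integral_rexp_neg_mul_sq_norm (V := EuclideanSpace ℝ (Fin d)) hb
  rw [integral_undef hcon] at hI
  have : 0 < (Real.pi / b) ^ ((Module.finrank ℝ (EuclideanSpace ℝ (Fin d)) : ℝ) / 2) := by
    positivity
  linarith

theorem integral_dilate (f : EuclideanSpace ℝ (Fin d) → ℂ) (x : EuclideanSpace ℝ (Fin d)) {s : ℝ}
    (hs : 0 < s) : ∫ y, f y = ∫ u, (s : ℂ) ^ d * f (x + s • u) := by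
  rw [integral_const_mul, Measure.integral_comp_smul volume (fun u => f (x + u)) s,
    integral_add_left_eq_self f x, finrank_euclideanSpace_fin, abs_of_pos (by positivity),
    Complex.real_smul, ← mul_assoc]
  push_cast
  rw [mul_inv_cancel₀ (pow_ne_zero _ (by exact_mod_cast hs.ne')), one_mul]

open Filter Topology in
/-- Mehler's kernel is an approximate identity as `r → 1`. -/
theorem tendsto_integral_mehlerD (x : EuclideanSpace ℝ (Fin d))
    (ψ : 𝓢(EuclideanSpace ℝ (Fin d), ℂ)) :
    Tendsto (fun r : ℝ => ∫ y, mehlerD (r : ℂ) x y * ψ y) (𝓝[<] 1) (𝓝 (ψ x)) := by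
  have hev : ∀ᶠ r : ℝ in 𝓝[<] 1, 0 < r ∧ r < 1 := by
    filter_upwards [self_mem_nhdsWithin, mem_nhdsWithin_of_mem_nhds (Ioi_mem_nhds one_pos)]
      with r h1 h2 using ⟨h2, h1⟩
  obtain ⟨M, hM⟩ : ∃ M : ℝ, ∀ y, ‖ψ y‖ ≤ M := by
    obtain ⟨M, -, hM⟩ := ψ.decay 0 0
    exact ⟨M, fun y => by simpa using hM y⟩
  have hlim : ∫ u : EuclideanSpace ℝ (Fin d),
      (((Real.sqrt Real.pi)⁻¹ ^ d * Real.exp (-1 * ‖u‖ ^ 2) : ℝ) : ℂ) * ψ x = ψ x := by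
    rw [integral_mul_const, integral_complex_ofReal, integral_const_mul,
      GaussianFourier.integral_rexp_neg_mul_sq_norm one_pos, finrank_euclideanSpace_fin, div_one]
    have : Real.pi ^ ((d : ℝ) / 2) = Real.sqrt Real.pi ^ d := by
      rw [Real.sqrt_eq_rpow, ← Real.rpow_natCast, ← Real.rpow_mul Real.pi_pos.le]
      congr 1; ring
    rw [this, ← mul_pow, inv_mul_cancel₀ (by positivity), one_pow, Complex.ofReal_one, one_mul]
  rw [← hlim]
  have hT : Tendsto (fun r : ℝ => ∫ u : EuclideanSpace ℝ (Fin d),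
      (Real.sqrt (1 - r ^ 2) : ℂ) ^ d * mehlerD r x (x + Real.sqrt (1 - r ^ 2) • u) *
        ψ (x + Real.sqrt (1 - r ^ 2) • u)) (𝓝[<] 1)
      (𝓝 (∫ u : EuclideanSpace ℝ (Fin d),
        (((Real.sqrt Real.pi)⁻¹ ^ d * Real.exp (-1 * ‖u‖ ^ 2) : ℝ) : ℂ) * ψ x)) := by
    refine tendsto_integral_filter_of_dominated_convergence
      (fun u => Real.exp (-(1 / 4) * ‖u‖ ^ 2) * M) ?_ ?_
      ((integrable_gaussian_euclidean (by norm_num)).mul_const M) ?_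
    · refine Eventually.of_forall fun r => Continuous.aestronglyMeasurable ?_
      unfold mehlerD mehler
      have := ψ.continuous
      fun_prop
    · filter_upwards [hev] with r hr
      refine Eventually.of_forall fun u => ?_
      rw [norm_mul]
      gcongr
      · exact norm_integrand_dilate_le hr.1 hr.2 x u
      · exact hM _
    · refine Eventually.of_forall fun u => ?_
      have hs : Tendsto (fun r : ℝ => Real.sqrt (1 - r ^ 2)) (𝓝[<] 1) (𝓝 0) := by
        have : Continuous fun r : ℝ => Real.sqrt (1 - r ^ 2) := by fun_prop
        have h := this.tendsto 1
        simp only [one_pow, sub_self, Real.sqrt_zero] at h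
        exact h.mono_left nhdsWithin_le_nhds
      refine Tendsto.mul ?_ ?_
      · have hcongr : ∀ᶠ r : ℝ in 𝓝[<] 1, ∏ i, (((Real.sqrt Real.pi)⁻¹ *
            Real.exp (-((1 - r) / (1 + r) * x i ^ 2) - (1 - r) / (1 + r) * Real.sqrt (1 - r ^ 2) *
              x i * u i - (1 + r ^ 2) * u i ^ 2 / 2) : ℝ) : ℂ) =
            (Real.sqrt (1 - r ^ 2) : ℂ) ^ d * mehlerD r x (x + Real.sqrt (1 - r ^ 2) • u) := by
          filter_upwards [hev] with r hr
          have : (Real.sqrt (1 - r ^ 2) : ℂ) ^ d = ∏ _i : Fin d, (Real.sqrt (1 - r ^ 2) : ℂ) := by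
            simp
          rw [mehlerD, this, ← Finset.prod_mul_distrib]
          refine Finset.prod_congr rfl fun i _ => ?_
          rw [← mehler_dilate hr.1 hr.2]
          simp
        refine Tendsto.congr' hcongr ?_
        have hval : (((Real.sqrt Real.pi)⁻¹ ^ d * Real.exp (-1 * ‖u‖ ^ 2) : ℝ) : ℂ) =
            ∏ i, (((Real.sqrt Real.pi)⁻¹ * Real.exp (-(u i) ^ 2) : ℝ) : ℂ) := by
          rw [← Complex.ofReal_prod, Finset.prod_mul_distrib, Finset.prod_const, ← Real.exp_sum,
            Finset.card_univ, Fintype.card_fin, EuclideanSpace.real_norm_sq_eq,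
            Finset.sum_neg_distrib, neg_one_mul]
        rw [hval]
        refine tendsto_finsetProd _ fun i _ => ?_
        refine (Complex.continuous_ofReal.tendsto _).comp ?_
        refine Tendsto.const_mul _ ((Real.continuous_exp.tendsto _).comp ?_)
        have hc : ContinuousAt (fun r : ℝ => -((1 - r) / (1 + r) * x i ^ 2) - (1 - r) / (1 + r) *
            Real.sqrt (1 - r ^ 2) * x i * u i - (1 + r ^ 2) * u i ^ 2 / 2) 1 := by
          have : ContinuousAt (fun r : ℝ => (1 - r) / (1 + r)) 1 :=
            ContinuousAt.div (by fun_prop) (by fun_prop) (by norm_num)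
          fun_prop
        have h := hc.tendsto.mono_left (nhdsWithin_le_nhds (s := Set.Iio 1))
        convert h using 2
        norm_num
      · have h := (ψ.continuous.tendsto (x + (0 : ℝ) • u))
        rw [zero_smul, add_zero] at h
        refine h.comp ?_
        have := (hs.smul_const u).const_add x
        rwa [zero_smul, add_zero] at this
  refine hT.congr' ?_
  filter_upwards [hev] with r hr
  have hpos : 0 < Real.sqrt (1 - r ^ 2) := Real.sqrt_pos.2 (by nlinarith)
  rw [integral_dilate (fun y => mehlerD (r : ℂ) x y * ψ y) x hpos]
  simp only [mul_assoc]

-- Abel summation: `ψ(x)` is the limit of its Hermite series weighted by `r^ν`, which is bounded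
-- uniformly in `r`. Level `ν` has at most `(1+ν)^d` indices, each with `|ℋ_β(x)| ≤ 2(1+ν)^d`, so a
-- decay of order `2d + 2` leaves the summable `2(1+ν)^{-2}`. No completeness of the Hermite system
-- is needed beforehand.
open Filter Topology in
theorem exists_norm_le_of_hcoef (d : ℕ) :
    ∃ C : ℝ, 0 ≤ C ∧ ∀ (ψ : 𝓢(EuclideanSpace ℝ (Fin d), ℂ)) (B : ℝ),
      (∀ β : Fin d → ℕ, (1 + (∑ i, β i : ℕ) : ℝ) ^ (2 * d + 2) * ‖hcoef β ψ‖ ≤ B) →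
      ∀ x, ‖ψ x‖ ≤ C * B := by
  have hsum : Summable fun ν : ℕ => 2 / (1 + ν : ℝ) ^ 2 := by
    have := ((summable_nat_add_iff 1).2 (Real.summable_one_div_nat_pow.2 one_lt_two)).mul_left 2
    refine this.congr fun ν => ?_
    push_cast
    rw [add_comm]; ring
  refine ⟨∑' ν : ℕ, 2 / (1 + ν : ℝ) ^ 2, tsum_nonneg fun _ => by positivity, fun ψ B hB x => ?_⟩
  have hB0 : 0 ≤ B := le_trans (by positivity) (hB 0)
  refine le_of_tendsto (tendsto_integral_mehlerD x ψ).norm ?_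
  filter_upwards [self_mem_nhdsWithin, mem_nhdsWithin_of_mem_nhds (Ioi_mem_nhds one_pos)]
    with r h1 h2
  have h1' : r < 1 := h1
  have h2' : 0 < r := h2
  refine (hasSum_integral_mehlerD h2'.le h1' x ψ).norm_le_of_bounded (hsum.hasSum.mul_right B)
    fun ν => ?_
  have hterm : ∀ β ∈ Finset.piAntidiag (Finset.univ : Finset (Fin d)) ν,
      ‖hermiteS β x * hcoef β ψ‖ ≤ 2 * B / ((1 + ν : ℝ) ^ d * (1 + ν) ^ 2) := by
    intro β hβ
    have h3 := hB β
    rw [(Finset.mem_piAntidiag.1 hβ).1] at h3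
    rw [norm_mul, le_div_iff₀ (by positivity)]
    calc _ ≤ 2 * (1 + ν : ℝ) ^ d * ‖hcoef β ψ‖ * ((1 + ν : ℝ) ^ d * (1 + ν) ^ 2) := by
          gcongr; exact norm_hermiteS_le_of_mem hβ x
      _ = 2 * ((1 + ν : ℝ) ^ (2 * d + 2) * ‖hcoef β ψ‖) := by ring
      _ ≤ 2 * B := by gcongr
  rw [norm_mul, norm_pow, Complex.norm_real, Real.norm_of_nonneg h2'.le]
  calc _ ≤ 1 * ((1 + ν : ℝ) ^ d * (2 * B / ((1 + ν : ℝ) ^ d * (1 + ν) ^ 2))) := by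
        gcongr
        · exact pow_le_one₀ h2'.le h1'.le
        · exact norm_sum_piAntidiag_le (by positivity) hterm
    _ = _ := by field_simp

/-! ### Density of the Hermite functions in the Schwartz space -/

/-- The weighted sup-bound `(1 + |β|)^K |∫ ℋ_β ψ| ≤ B` for all `β`. -/
def CoefBound (K : ℕ) (B : ℝ) (ψ : 𝓢(EuclideanSpace ℝ (Fin d), ℂ)) : Prop :=
  ∀ β : Fin d → ℕ, (1 + (∑ i, β i : ℕ) : ℝ) ^ K * ‖hcoef β ψ‖ ≤ B

theorem CoefBound.nonneg {K : ℕ} {B : ℝ} {ψ : 𝓢(EuclideanSpace ℝ (Fin d), ℂ)}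
    (h : CoefBound K B ψ) : 0 ≤ B := le_trans (by positivity) (h 0)

theorem CoefBound.mono {K L : ℕ} (hKL : K ≤ L) {B : ℝ} {ψ : 𝓢(EuclideanSpace ℝ (Fin d), ℂ)}
    (h : CoefBound L B ψ) : CoefBound K B ψ := fun β => by
  refine le_trans ?_ (h β)
  gcongr
  have : (0 : ℝ) ≤ (∑ i, β i : ℕ) := Nat.cast_nonneg _
  linarith

/-- The common argument for `mulCoord` and `partialD`: the ladder coefficients are at most `1 +
|β|`, which costs one power of the weight, and passing to a neighbouring index changes the weight by
a factor of at most 2. -/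
theorem coefBound_ladder {K : ℕ} {B : ℝ} {ψ φ : 𝓢(EuclideanSpace ℝ (Fin d), ℂ)}
    (h : CoefBound (K + 1) B ψ) (i : Fin d)
    (hφ : ∀ β, ‖hcoef β φ‖ ≤ Real.sqrt (β i / 2) * ‖hcoef (idxDown β i) ψ‖ +
      Real.sqrt ((β i + 1) / 2) * ‖hcoef (idxUp β i) ψ‖) : CoefBound K (2 ^ (K + 2) * B) φ := by
  intro β
  have hB := h.nonneg
  set n : ℝ := ((∑ i, β i : ℕ) : ℝ) with hn
  have hn0 : 0 ≤ n := Nat.cast_nonneg _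
  have hi : (β i : ℝ) ≤ n := by
    rw [hn]
    exact_mod_cast Finset.single_le_sum (f := β) (fun _ _ => Nat.zero_le _) (Finset.mem_univ i)
  have hi0 : (0 : ℝ) ≤ β i := Nat.cast_nonneg _
  have hs1 : Real.sqrt (β i / 2) ≤ 1 + n := by
    rw [Real.sqrt_le_left (by positivity)]; nlinarith
  have hs2 : Real.sqrt ((β i + 1) / 2) ≤ 1 + n := by
    rw [Real.sqrt_le_left (by positivity)]; nlinarith
  have hdn : (1 + n) ^ (K + 1) * ‖hcoef (idxDown β i) ψ‖ ≤ 2 ^ (K + 1) * B := by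
    have h1 := h (idxDown β i)
    have h2 : 1 + n ≤ 2 * (1 + (∑ j, idxDown β i j : ℕ) : ℝ) := by
      have : n ≤ (∑ j, idxDown β i j : ℕ) + 1 := by
        rw [hn]; exact_mod_cast sum_le_sum_idxDown β i
      have h3 : (0 : ℝ) ≤ (∑ j, idxDown β i j : ℕ) := Nat.cast_nonneg _
      linarith
    calc _ ≤ (2 * (1 + (∑ j, idxDown β i j : ℕ) : ℝ)) ^ (K + 1) * ‖hcoef (idxDown β i) ψ‖ := by
          gcongr
      _ = 2 ^ (K + 1) * ((1 + (∑ j, idxDown β i j : ℕ) : ℝ) ^ (K + 1) *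
          ‖hcoef (idxDown β i) ψ‖) := by rw [mul_pow]; ring
      _ ≤ _ := by gcongr
  have hup : (1 + n) ^ (K + 1) * ‖hcoef (idxUp β i) ψ‖ ≤ 2 ^ (K + 1) * B := by
    have h1 := h (idxUp β i)
    rw [sum_idxUp] at h1
    have h2 : (1 + n) ^ (K + 1) * ‖hcoef (idxUp β i) ψ‖ ≤ B := by
      refine le_trans ?_ h1
      gcongr
      push_cast
      rw [hn]; push_cast; linarith
    refine h2.trans (le_mul_of_one_le_left hB (one_le_pow₀ one_le_two))
  calc (1 + n) ^ K * ‖hcoef β φ‖ ≤ (1 + n) ^ K * ((1 + n) * ‖hcoef (idxDown β i) ψ‖ +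
        (1 + n) * ‖hcoef (idxUp β i) ψ‖) := by
        gcongr
        refine (hφ β).trans ?_
        gcongr
    _ = (1 + n) ^ (K + 1) * ‖hcoef (idxDown β i) ψ‖ +
        (1 + n) ^ (K + 1) * ‖hcoef (idxUp β i) ψ‖ := by ring
    _ ≤ 2 ^ (K + 1) * B + 2 ^ (K + 1) * B := add_le_add hdn hup
    _ = _ := by ring

theorem CoefBound.mulCoord {K : ℕ} {B : ℝ} {ψ : 𝓢(EuclideanSpace ℝ (Fin d), ℂ)}
    (h : CoefBound (K + 1) B ψ) (i : Fin d) : CoefBound K (2 ^ (K + 2) * B) (mulCoord i ψ) := by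
  refine coefBound_ladder h i fun β => ?_
  rw [hcoef_mulCoord]
  refine (norm_add_le _ _).trans (le_of_eq ?_)
  simp [abs_of_nonneg]

theorem CoefBound.partialD {K : ℕ} {B : ℝ} {ψ : 𝓢(EuclideanSpace ℝ (Fin d), ℂ)}
    (h : CoefBound (K + 1) B ψ) (i : Fin d) : CoefBound K (2 ^ (K + 2) * B) (partialD i ψ) := by
  refine coefBound_ladder h i fun β => ?_
  rw [hcoef_partialD]
  refine (norm_add_le _ _).trans (le_of_eq ?_)
  simp [abs_of_nonneg]

theorem fderiv_eq_sum_partialD (ψ : 𝓢(EuclideanSpace ℝ (Fin d), ℂ)) :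
    fderiv ℝ ψ = fun x => ∑ i, ((EuclideanSpace.proj i : EuclideanSpace ℝ (Fin d) →L[ℝ] ℝ)).smulRight
      (partialD i ψ x) := by
  funext x
  ext v
  have hv : v = ∑ i, v i • EuclideanSpace.single i (1 : ℝ) := by
    ext j
    simp [Finset.sum_apply, Pi.single_apply]
  conv_lhs => rw [hv, map_sum]
  simp [partialD_apply]

theorem norm_iteratedFDeriv_succ_le (n : ℕ) (ψ : 𝓢(EuclideanSpace ℝ (Fin d), ℂ))
    (x : EuclideanSpace ℝ (Fin d)) :
    ‖iteratedFDeriv ℝ (n + 1) ψ x‖ ≤ ∑ i, ‖iteratedFDeriv ℝ n (partialD i ψ) x‖ := by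
  rw [← norm_iteratedFDeriv_fderiv, fderiv_eq_sum_partialD]
  have hL : ∀ i : Fin d, (fun x => ((EuclideanSpace.proj i : EuclideanSpace ℝ (Fin d) →L[ℝ] ℝ)).smulRight
      (partialD i ψ x)) = (ContinuousLinearMap.smulRightL ℝ (EuclideanSpace ℝ (Fin d)) ℂ
        (EuclideanSpace.proj i : EuclideanSpace ℝ (Fin d) →L[ℝ] ℝ)) ∘ partialD i ψ := fun i => rfl
  have hsm : ∀ i : Fin d, ContDiff ℝ n (fun x => ((EuclideanSpace.proj i :
      EuclideanSpace ℝ (Fin d) →L[ℝ] ℝ)).smulRight (partialD i ψ x)) := fun i => by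
    rw [hL]
    exact (ContinuousLinearMap.contDiff _).comp ((partialD i ψ).smooth n)
  rw [iteratedFDeriv_fun_sum_apply fun i _ => (hsm i).contDiffAt]
  refine norm_sum_le_of_le _ fun i _ => ?_
  rw [hL]
  refine (ContinuousLinearMap.norm_iteratedFDeriv_comp_left _
    ((partialD i ψ).smooth n).contDiffAt le_rfl).trans ?_
  refine mul_le_of_le_one_left (norm_nonneg _) ?_
  refine ContinuousLinearMap.opNorm_le_bound _ zero_le_one fun z => ?_
  change ‖((EuclideanSpace.proj i : EuclideanSpace ℝ (Fin d) →L[ℝ] ℝ)).smulRight z‖ ≤ _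
  rw [ContinuousLinearMap.norm_smulRight_apply]
  gcongr
  refine ContinuousLinearMap.opNorm_le_bound _ zero_le_one fun y => ?_
  rw [one_mul]
  exact PiLp.norm_apply_le y i

/-- Induction from the sup norm: a power of `‖x‖` is traded for coordinate multiplications and a
derivative for partial derivatives, each consuming one power of the weight on the coefficients. -/
theorem exists_seminorm_le (d : ℕ) (k n : ℕ) :
    ∃ (K : ℕ) (C : ℝ), 0 ≤ C ∧ ∀ (ψ : 𝓢(EuclideanSpace ℝ (Fin d), ℂ)) (B : ℝ), CoefBound K B ψ →
      ∀ x, ‖x‖ ^ k * ‖iteratedFDeriv ℝ n ψ x‖ ≤ C * B := by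
  induction n with
  | zero =>
    induction k with
    | zero =>
      obtain ⟨C, hC, h⟩ := exists_norm_le_of_hcoef d
      exact ⟨2 * d + 2, C, hC, fun ψ B hB x => by simpa using h ψ B hB x⟩
    | succ k ih =>
      obtain ⟨K, C, hC, h⟩ := ih
      refine ⟨K + 1, d * (C * 2 ^ (K + 2)), by positivity, fun ψ B hB x => ?_⟩
      have hx : ‖x‖ ≤ ∑ i, |x i| := by
        have : x = ∑ i, EuclideanSpace.single i (x i) := by
          ext j
          simp [Finset.sum_apply, Pi.single_apply]
        conv_lhs => rw [this]
        refine norm_sum_le_of_le _ fun i _ => ?_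
        simp
      calc ‖x‖ ^ (k + 1) * ‖iteratedFDeriv ℝ 0 ψ x‖ = ‖x‖ * (‖x‖ ^ k * ‖ψ x‖) := by
            rw [norm_iteratedFDeriv_zero]; ring
        _ ≤ (∑ i, |x i|) * (‖x‖ ^ k * ‖ψ x‖) := by gcongr
        _ = ∑ i, ‖x‖ ^ k * ‖iteratedFDeriv ℝ 0 (mulCoord i ψ) x‖ := by
            rw [Finset.sum_mul]
            refine Finset.sum_congr rfl fun i _ => ?_
            rw [norm_iteratedFDeriv_zero, mulCoord_apply, norm_mul, Complex.norm_real,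
              Real.norm_eq_abs]
            ring
        _ ≤ ∑ _i : Fin d, C * (2 ^ (K + 2) * B) :=
            Finset.sum_le_sum fun i _ => h _ _ (hB.mulCoord i) x
        _ = _ := by
            rw [Finset.sum_const, Finset.card_univ, Fintype.card_fin, nsmul_eq_mul]; ring
  | succ n ih =>
    obtain ⟨K, C, hC, h⟩ := ih
    refine ⟨K + 1, d * (C * 2 ^ (K + 2)), by positivity, fun ψ B hB x => ?_⟩
    calc ‖x‖ ^ k * ‖iteratedFDeriv ℝ (n + 1) ψ x‖
        ≤ ‖x‖ ^ k * ∑ i, ‖iteratedFDeriv ℝ n (partialD i ψ) x‖ := by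
          gcongr; exact norm_iteratedFDeriv_succ_le n ψ x
      _ = ∑ i, ‖x‖ ^ k * ‖iteratedFDeriv ℝ n (partialD i ψ) x‖ := Finset.mul_sum _ _ _
      _ ≤ ∑ _i : Fin d, C * (2 ^ (K + 2) * B) :=
          Finset.sum_le_sum fun i _ => h _ _ (hB.partialD i) x
      _ = _ := by
          rw [Finset.sum_const, Finset.card_univ, Fintype.card_fin, nsmul_eq_mul]; ring

theorem exists_temperedDistribution_bound (f : 𝓢'(EuclideanSpace ℝ (Fin d), ℂ)) :
    ∃ (K : ℕ) (C : ℝ), 0 ≤ C ∧ ∀ (ψ : 𝓢(EuclideanSpace ℝ (Fin d), ℂ)) (B : ℝ), CoefBound K B ψ →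
      ‖f ψ‖ ≤ C * B := by
  classical
  let F : 𝓢(EuclideanSpace ℝ (Fin d), ℂ) →ₗ[ℂ] ℂ :=
    { toFun := f, map_add' := map_add f, map_smul' := map_smul f }
  have hF : Continuous ((normSeminorm ℂ ℂ).comp F) := by
    change Continuous fun ψ => ‖f ψ‖
    exact (map_continuous f).norm
  obtain ⟨s, C, -, hC⟩ := Seminorm.bound_of_continuous
    (schwartz_withSeminorms ℂ (EuclideanSpace ℝ (Fin d)) ℂ) _ hF
  choose K C' hC'0 hK using exists_seminorm_le d
  refine ⟨s.sup fun m => K m.1 m.2, C * ∑ m ∈ s, C' m.1 m.2,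
    mul_nonneg C.2 (Finset.sum_nonneg fun _ _ => hC'0 _ _), fun ψ B hB => ?_⟩
  have h1 : ‖f ψ‖ ≤ C * (s.sup (schwartzSeminormFamily ℂ (EuclideanSpace ℝ (Fin d)) ℂ)) ψ := hC ψ
  have h2 : (s.sup (schwartzSeminormFamily ℂ (EuclideanSpace ℝ (Fin d)) ℂ)) ψ ≤
      (∑ m ∈ s, C' m.1 m.2) * B := by
    refine Seminorm.finset_sup_apply_le
      (mul_nonneg (Finset.sum_nonneg fun _ _ => hC'0 _ _) hB.nonneg) fun m hm => ?_
    have hm1 : (schwartzSeminormFamily ℂ (EuclideanSpace ℝ (Fin d)) ℂ) m ψ ≤ C' m.1 m.2 * B := by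
      refine SchwartzMap.seminorm_le_bound ℂ m.1 m.2 ψ (mul_nonneg (hC'0 _ _) hB.nonneg)
        (hK m.1 m.2 ψ B (hB.mono ?_))
      exact Finset.le_sup (f := fun m : ℕ × ℕ => K m.1 m.2) hm
    refine hm1.trans (mul_le_mul_of_nonneg_right ?_ hB.nonneg)
    exact Finset.single_le_sum (f := fun m : ℕ × ℕ => C' m.1 m.2) (fun _ _ => hC'0 _ _) hm
  calc _ ≤ _ := h1
    _ ≤ C * ((∑ m ∈ s, C' m.1 m.2) * B) := by gcongr
    _ = _ := by ring

/-- Partial sums of the Hermite expansion. -/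
noncomputable def partialSum (n : ℕ) (ψ : 𝓢(EuclideanSpace ℝ (Fin d), ℂ)) :
    𝓢(EuclideanSpace ℝ (Fin d), ℂ) :=
  ∑ ν ∈ Finset.range n, ∑ β ∈ Finset.piAntidiag (Finset.univ : Finset (Fin d)) ν,
    hcoef β ψ • hermiteS β

theorem sum_piAntidiag_ite (ν : ℕ) (γ : Fin d → ℕ) (u : (Fin d → ℕ) → ℂ) :
    ∑ β ∈ Finset.piAntidiag (Finset.univ : Finset (Fin d)) ν, u β * (if γ = β then 1 else 0) =
      if ∑ i, γ i = ν then u γ else 0 := by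
  simp only [mul_ite, mul_one, mul_zero]
  rw [Finset.sum_ite_eq]
  simp [Finset.mem_piAntidiag]

theorem hcoef_partialSum (n : ℕ) (ψ : 𝓢(EuclideanSpace ℝ (Fin d), ℂ)) (γ : Fin d → ℕ) :
    hcoef γ (partialSum n ψ) = if ∑ i, γ i < n then hcoef γ ψ else 0 := by
  simp only [partialSum, hcoef_sum, hcoef_smul, hcoef_hermiteS, sum_piAntidiag_ite]
  rw [Finset.sum_ite_eq]
  simp

/-- A tempered distribution annihilating all Hermite functions is zero. -/
theorem temperedDistribution_eq_zero {f : 𝓢'(EuclideanSpace ℝ (Fin d), ℂ)}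
    (hf : ∀ β, f (hermiteS β) = 0) : f = 0 := by
  ext ψ
  obtain ⟨K, C, hC, h⟩ := exists_temperedDistribution_bound f
  obtain ⟨B, hB⟩ := exists_hcoef_decay (K + 1) ψ
  have hB0 : 0 ≤ B := CoefBound.nonneg hB
  -- Subtracting a partial sum does not change `f ψ`, and it leaves only coefficients with `|β| ≥
  -- n`. The one extra power in the decay then yields the factor `1/(n+1)`.
  have hn : ∀ n : ℕ, ‖f ψ‖ ≤ C * B * (1 / ((n : ℝ) + 1)) := by
    intro n
    have h1 : f ψ = f (ψ - partialSum n ψ) := by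
      rw [map_sub]
      simp [partialSum, map_sum, hf]
    rw [h1, mul_assoc]
    refine h _ _ fun β => ?_
    rw [hcoef_sub, hcoef_partialSum]
    split_ifs with hlt
    · simp; positivity
    · rw [sub_zero, mul_one_div, le_div_iff₀ (by positivity)]
      refine le_trans ?_ (hB β)
      rw [pow_succ, mul_right_comm]
      have : (n : ℝ) + 1 ≤ 1 + (∑ i, β i : ℕ) := by
        rw [add_comm]
        gcongr
        omega
      gcongr
  have hlim := (tendsto_one_div_add_atTop_nhds_zero_nat (𝕜 := ℝ)).const_mul (C * B)
  rw [mul_zero] at hlim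
  have := ge_of_tendsto' hlim hn
  simpa using this

theorem temperedDistribution_ext {f g : 𝓢'(EuclideanSpace ℝ (Fin d), ℂ)}
    (h : ∀ β, f (hermiteS β) = g (hermiteS β)) : f = g := by
  rw [← sub_eq_zero]
  exact temperedDistribution_eq_zero fun β => by simp [h β]

/-! ### Schur's test and multiplier operators -/

/-- Hölder's inequality against the constant `1` for the measure `k μ`. -/
theorem lintegral_mul_le_eLpNorm {X : Type*} [MeasurableSpace X] {μ : Measure X} {k : X → ℝ≥0∞}
    (hk : Measurable k) {f : X → ℂ} (hf : StronglyMeasurable f) {p : ℝ≥0∞} (hp : 1 ≤ p) :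
    ∫⁻ y, k y * ‖f y‖ₑ ∂μ ≤ eLpNorm f p (μ.withDensity k) *
      (∫⁻ y, k y ∂μ) ^ (1 - 1 / p.toReal) := by
  have h1 : ∫⁻ y, k y * ‖f y‖ₑ ∂μ = eLpNorm f 1 (μ.withDensity k) := by
    rw [eLpNorm_one_eq_lintegral_enorm,
      lintegral_withDensity_eq_lintegral_mul _ hk hf.measurable.enorm]
    rfl
  rw [h1]
  have h2 := eLpNorm_le_eLpNorm_mul_rpow_measure_univ (μ := μ.withDensity k) hp
    hf.aestronglyMeasurable
  rwa [withDensity_apply _ MeasurableSet.univ, Measure.restrict_univ, ENNReal.toReal_one,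
    div_one] at h2

/-- Young's inequality in the form of Schur's test: `k(x - y)` has the same mass in `x` and in `y`.
For `p = ∞` the pointwise Hölder bound suffices; for finite `p` its `p`-th power is integrated in
`x` by Tonelli. -/
theorem eLpNorm_integral_le_of_enorm_le {E : Type*} [NormedAddCommGroup E] [MeasurableSpace E]
    [BorelSpace E] [SecondCountableTopology E] {μ : Measure E} [SFinite μ]
    [μ.IsAddLeftInvariant] [μ.IsNegInvariant] {k : E → ℝ≥0∞} (hk : Measurable k)
    {K : E → E → ℂ} (hK : ∀ x y, ‖K x y‖ₑ ≤ k (x - y)) {f : E → ℂ} (hf : StronglyMeasurable f)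
    {p : ℝ≥0∞} (hp : 1 ≤ p) :
    eLpNorm (fun x => ∫ y, K x y * f y ∂μ) p μ ≤ (∫⁻ z, k z ∂μ) * eLpNorm f p μ := by
  set C := ∫⁻ z, k z ∂μ with hC
  have hmass : ∀ x, ∫⁻ y, k (x - y) ∂μ = C := fun x => lintegral_sub_left_eq_self k x
  have hmass' : ∀ y, ∫⁻ x, k (x - y) ∂μ = C := fun y => lintegral_sub_right_eq_self k y
  have hkx : ∀ x, Measurable fun y => k (x - y) := fun x =>
    hk.comp (measurable_const.sub measurable_id)
  have hpt : ∀ x, ‖∫ y, K x y * f y ∂μ‖ₑ ≤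
      eLpNorm f p (μ.withDensity fun y => k (x - y)) * C ^ (1 - 1 / p.toReal) := by
    intro x
    rw [← hmass x]
    refine le_trans ?_ (lintegral_mul_le_eLpNorm (hkx x) hf hp)
    refine (enorm_integral_le_lintegral_enorm _).trans (lintegral_mono fun y => ?_)
    rw [enorm_mul]
    gcongr
    exact hK x y
  rcases eq_or_ne p ⊤ with rfl | hptop
  · have hle : ∀ x, ‖∫ y, K x y * f y ∂μ‖ₑ ≤ C * eLpNorm f ⊤ μ := by
      intro x
      refine (hpt x).trans ?_
      rw [ENNReal.toReal_top, div_zero, sub_zero, ENNReal.rpow_one, mul_comm]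
      refine mul_le_mul' le_rfl ?_
      rw [eLpNorm_exponent_top, eLpNorm_exponent_top]
      exact essSup_mono_measure (withDensity_absolutelyContinuous _ _)
    rw [eLpNorm_exponent_top]
    exact essSup_le_of_ae_le _ (Filter.Eventually.of_forall hle)
  · have hp0 : p ≠ 0 := (zero_lt_one.trans_le hp).ne'
    set r := p.toReal with hr
    have hr1 : 1 ≤ r := by
      rw [hr, ← ENNReal.toReal_one]
      exact (ENNReal.toReal_le_toReal ENNReal.one_ne_top hptop).2 hp
    have hr0 : 0 < r := by linarith
    have hpow : ∀ x, ‖∫ y, K x y * f y ∂μ‖ₑ ^ r ≤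
        (∫⁻ y, k (x - y) * ‖f y‖ₑ ^ r ∂μ) * C ^ (r - 1) := by
      intro x
      calc _ ≤ (eLpNorm f p (μ.withDensity fun y => k (x - y)) * C ^ (1 - 1 / r)) ^ r := by
            gcongr; exact hpt x
        _ = _ := by
            rw [ENNReal.mul_rpow_of_nonneg _ _ hr0.le, ← ENNReal.rpow_mul,
              eLpNorm_eq_lintegral_rpow_enorm_toReal hp0 hptop, ← hr, ← ENNReal.rpow_mul,
              one_div_mul_cancel hr0.ne', ENNReal.rpow_one,
              lintegral_withDensity_eq_lintegral_mul _ (hkx x) (hf.measurable.enorm.pow_const r)]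
            congr 2
            field_simp
    have hjoint : Measurable fun z : E × E => k (z.1 - z.2) * ‖f z.2‖ₑ ^ r := by
      refine (hk.comp (measurable_fst.sub measurable_snd)).mul ?_
      exact (hf.measurable.comp measurable_snd).enorm.pow_const r
    rw [eLpNorm_eq_lintegral_rpow_enorm_toReal hp0 hptop,
      eLpNorm_eq_lintegral_rpow_enorm_toReal hp0 hptop, ← hr]
    calc _ ≤ (∫⁻ x, (∫⁻ y, k (x - y) * ‖f y‖ₑ ^ r ∂μ) * C ^ (r - 1) ∂μ) ^ (1 / r) := by
          gcongr with x
          exact hpow x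
      _ = (C ^ r * ∫⁻ y, ‖f y‖ₑ ^ r ∂μ) ^ (1 / r) := by
          congr 1
          rw [lintegral_mul_const'' _ hjoint.lintegral_prod_right'.aemeasurable,
            lintegral_lintegral_swap hjoint.aemeasurable]
          have : ∀ y, ∫⁻ x, k (x - y) * ‖f y‖ₑ ^ r ∂μ = C * ‖f y‖ₑ ^ r := by
            intro y
            have hky : Measurable fun x => k (x - y) := hk.comp (measurable_id.sub measurable_const)
            rw [lintegral_mul_const _ hky, hmass']
          simp only [this]
          rw [lintegral_const_mul _ (hf.measurable.enorm.pow_const r), mul_right_comm]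
          congr 1
          nth_rewrite 1 [← ENNReal.rpow_one C]
          rw [← ENNReal.rpow_add_of_nonneg _ _ (by norm_num) (by linarith)]
          congr 1
          ring
      _ = _ := by
          rw [ENNReal.mul_rpow_of_nonneg _ _ (by positivity), ← ENNReal.rpow_mul,
            mul_one_div_cancel hr0.ne', ENNReal.rpow_one]

/-- The Hermite multiplier `∑_{ν ∈ T} m(ν) ∑_{|β| = ν} f(ℋ_β) ℋ_β` applied to a distribution. -/
noncomputable def multOp (T : Finset ℕ) (m : ℕ → ℂ) (f : 𝓢'(EuclideanSpace ℝ (Fin d), ℂ)) :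
    𝓢(EuclideanSpace ℝ (Fin d), ℂ) :=
  ∑ ν ∈ T, ∑ β ∈ Finset.piAntidiag (Finset.univ : Finset (Fin d)) ν,
    (m ν * f (hermiteS β)) • hermiteS β

/-- Links the two views of a multiplier: a Schwartz function with explicit Hermite coefficients, and
the pairing of `f` with a kernel, to which Schur's test applies. -/
theorem multOp_apply (T : Finset ℕ) (m : ℕ → ℂ) (f : 𝓢'(EuclideanSpace ℝ (Fin d), ℂ))
    (x : EuclideanSpace ℝ (Fin d)) : multOp T m f x = f (∑ ν ∈ T, m ν • kernelH ν x) := by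
  simp only [multOp, kernelH, map_sum, map_smul, smul_eq_mul, sum_apply,
    smul_apply, Finset.mul_sum]
  refine Finset.sum_congr rfl fun ν _ => Finset.sum_congr rfl fun β _ => ?_
  ring

theorem multOp_sub (T : Finset ℕ) (m : ℕ → ℂ) (f g : 𝓢'(EuclideanSpace ℝ (Fin d), ℂ)) :
    multOp T m (f - g) = multOp T m f - multOp T m g := by
  ext x
  rw [sub_apply, multOp_apply, multOp_apply, multOp_apply]
  rfl

theorem hcoef_multOp (T : Finset ℕ) (m : ℕ → ℂ) (f : 𝓢'(EuclideanSpace ℝ (Fin d), ℂ))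
    (γ : Fin d → ℕ) :
    hcoef γ (multOp T m f) =
      if ∑ i, γ i ∈ T then m (∑ i, γ i) * f (hermiteS γ) else 0 := by
  simp only [multOp, hcoef_sum, hcoef_smul, hcoef_hermiteS, sum_piAntidiag_ite]
  rw [Finset.sum_ite_eq]

theorem multOp_mem_spaceV {n : ℕ} {T : Finset ℕ} (hT : ∀ ν ∈ T, ν ≤ n) (m : ℕ → ℂ)
    (f : 𝓢'(EuclideanSpace ℝ (Fin d), ℂ)) : multOp T m f ∈ spaceV d n := by
  refine Submodule.sum_mem _ fun ν hν => Submodule.sum_mem _ fun β hβ => ?_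
  refine Submodule.smul_mem _ _ ?_
  have h1 : hermiteS β ∈ spaceW d ν := Submodule.subset_span
    ⟨β, (Finset.mem_piAntidiag.1 hβ).1, rfl⟩
  exact Submodule.mem_iSup_of_mem ν (Submodule.mem_iSup_of_mem (hT ν hν) h1)

theorem hcoef_eq_zero_of_mem_spaceV {n : ℕ} {g : 𝓢(EuclideanSpace ℝ (Fin d), ℂ)}
    (hg : g ∈ spaceV d n) {γ : Fin d → ℕ} (hγ : n < ∑ i, γ i) : hcoef γ g = 0 := by
  let L : 𝓢(EuclideanSpace ℝ (Fin d), ℂ) →ₗ[ℂ] ℂ :=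
    { toFun := hcoef γ, map_add' := hcoef_add γ, map_smul' := hcoef_smul γ }
  have hle : spaceV d n ≤ LinearMap.ker L := by
    refine iSup_le fun j => iSup_le fun hj => Submodule.span_le.2 ?_
    rintro _ ⟨β, hβ, rfl⟩
    change hcoef γ (hermiteS β) = 0
    rw [hcoef_hermiteS, if_neg]
    rintro rfl
    omega
  exact hle hg

theorem toTemperedDistribution_toLp_hermiteS (p : ℝ≥0∞) [Fact (1 ≤ p)]
    (g : 𝓢(EuclideanSpace ℝ (Fin d), ℂ)) (β : Fin d → ℕ) :
    Lp.toTemperedDistribution (g.toLp p volume) (hermiteS β) = hcoef β g := by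
  rw [Lp.toTemperedDistribution_apply, hcoef]
  refine integral_congr_ae ?_
  filter_upwards [g.coeFn_toLp p volume] with x hx
  rw [hx, smul_eq_mul]

theorem multOp_toTemperedDistribution_apply (T : Finset ℕ) (m : ℕ → ℂ) {p : ℝ≥0∞} [Fact (1 ≤ p)]
    (F : Lp ℂ p (volume : Measure (EuclideanSpace ℝ (Fin d)))) (x : EuclideanSpace ℝ (Fin d)) :
    multOp T m (Lp.toTemperedDistribution F) x = ∫ y, (∑ ν ∈ T, m ν * kernelH ν x y) * F y := by
  rw [multOp_apply, Lp.toTemperedDistribution_apply]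
  simp

/-- Smooth compactly supported dilated multipliers are uniformly bounded on every `L^p`. -/
theorem exists_multOp_bound (d : ℕ) {g : ℝ → ℂ} (hg : ContDiff ℝ ∞ g) (hc : HasCompactSupport g) :
    ∃ C : ℝ≥0∞, C ≠ ⊤ ∧ ∀ N : ℝ, 1 ≤ N → ∀ T : Finset ℕ, (∀ ν ∉ T, g (ν / N) = 0) →
      ∀ (p : ℝ≥0∞) [Fact (1 ≤ p)] (F : Lp ℂ p (volume : Measure (EuclideanSpace ℝ (Fin d)))),
        eLpNorm (multOp T (fun ν => g (ν / N)) (Lp.toTemperedDistribution F)) p volume ≤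
          C * eLpNorm F p volume := by
  obtain ⟨C, hC, h⟩ := exists_kernel_bound d hg hc
  refine ⟨C, hC, fun N hN T hT p hp F => ?_⟩
  obtain ⟨k, hk, hkC, hker⟩ := h N hN
  have he : (multOp T (fun ν => g (ν / N)) (Lp.toTemperedDistribution F) :
      EuclideanSpace ℝ (Fin d) → ℂ) =
      fun x => ∫ y, (∑ ν ∈ T, g (ν / N) * kernelH ν x y) * F y :=
    funext (multOp_toTemperedDistribution_apply T _ F)
  rw [he]
  refine (eLpNorm_integral_le_of_enorm_le hk (hker T hT) (Lp.stronglyMeasurable F) hp.out).trans ?_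
  gcongr

/-! ### The dyadic multipliers and the Calderón reproducing formula -/

/-- The symbol of `Φ_j`: `δ_0` for `j = 0` and `ν ↦ a(ν/4^{j-1})` for `j ≥ 1`. -/
noncomputable def levelSym (a : ℝ → ℂ) : ℕ → ℕ → ℂ
  | 0, ν => if ν = 0 then 1 else 0
  | j + 1, ν => a ((ν : ℝ) / 4 ^ j)

/-- The frequencies seen by `Φ_j`. -/
def levelSet (j : ℕ) : Finset ℕ := Finset.range (4 ^ j + 1)

/-- Consequently `Φ_j * f` is a Schwartz function for every tempered distribution `f`, hence belongs
to every `L^p`. -/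
theorem convPhi_eq_multOp {a : ℝ → ℂ} (ha : IsCutoff a) (j : ℕ)
    (f : 𝓢'(EuclideanSpace ℝ (Fin d), ℂ)) :
    convPhi a j f = multOp (levelSet j) (levelSym a j) f := by
  funext x
  rw [multOp_apply, convPhi]
  cases j with
  | zero =>
    congr 1
    simp [kernelPhi, levelSet, levelSym]
  | succ j => rw [kernelPhi_succ ha]; rfl

/-- The set where a continuous function is nonzero is open, so it misses the endpoints of `[1/4,
4]`. -/
theorem IsCutoff.mem_Ioo {a : ℝ → ℂ} (ha : IsCutoff a) {t : ℝ} (ht : a t ≠ 0) :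
    1 / 4 < t ∧ t < 4 := by
  have hopen : IsOpen (Function.support a) := ha.smooth.continuous.isOpen_support
  have hsub : Function.support a ⊆ interior (Set.Icc (1 / 4 : ℝ) 4) :=
    interior_maximal ((subset_tsupport a).trans ha.supp) hopen
  rw [interior_Icc] at hsub
  exact hsub ht

theorem hasCompactSupport_of_mem_Ioo {b : ℝ → ℂ} (hb : ∀ t, b t ≠ 0 → 1 / 4 < t ∧ t < 4) :
    HasCompactSupport b :=
  HasCompactSupport.of_support_subset_isCompact (K := Set.Icc (1 / 4) 4) isCompact_Icc
    fun t ht => ⟨(hb t ht).1.le, (hb t ht).2.le⟩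

/-- Stated for a general `b` because it is applied both to the cutoff `a` and to its dual. -/
theorem exists_levelSym_bound (d : ℕ) {b : ℝ → ℂ} (hb : ContDiff ℝ ∞ b)
    (hs : ∀ t, b t ≠ 0 → 1 / 4 < t ∧ t < 4) :
    ∃ C : ℝ≥0∞, C ≠ ⊤ ∧ ∀ (j : ℕ) (p : ℝ≥0∞) [Fact (1 ≤ p)]
      (F : Lp ℂ p (volume : Measure (EuclideanSpace ℝ (Fin d)))),
        eLpNorm (multOp (levelSet j) (levelSym b j) (Lp.toTemperedDistribution F)) p volume ≤
          C * eLpNorm F p volume := by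
  obtain ⟨C, hC, h⟩ := exists_multOp_bound d hb (hasCompactSupport_of_mem_Ioo hs)
  -- Level `0` is not a dilate of `b`. Its symbol `δ_0` is the restriction to `ℕ` of a bump
  -- supported in `[-1/2, 1/2]`, taken at scale `N = 1`.
  let χ : ContDiffBump (0 : ℝ) := ⟨1 / 4, 1 / 2, by norm_num, by norm_num⟩
  have hχs : ContDiff ℝ ∞ fun t : ℝ => ((χ t : ℝ) : ℂ) :=
    Complex.ofRealCLM.contDiff.comp χ.contDiff
  have hχc : HasCompactSupport fun t : ℝ => ((χ t : ℝ) : ℂ) :=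
    χ.hasCompactSupport.comp_left (g := fun t : ℝ => (t : ℂ)) Complex.ofReal_zero
  have hχ1 : ∀ ν : ℕ, ((χ ((ν : ℝ) / 1) : ℝ) : ℂ) = if ν = 0 then 1 else 0 := by
    intro ν
    split_ifs with h0
    · rw [h0]
      have : χ (((0 : ℕ) : ℝ) / 1) = 1 := χ.one_of_mem_closedBall (by simp [χ])
      rw [this, Complex.ofReal_one]
    · have : χ ((ν : ℝ) / 1) = 0 := χ.zero_of_le_dist (by
        have : (1 : ℝ) ≤ ν := by exact_mod_cast Nat.one_le_iff_ne_zero.2 h0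
        simp [χ]
        linarith)
      rw [this, Complex.ofReal_zero]
  obtain ⟨C0, hC0, h0⟩ := exists_multOp_bound d hχs hχc
  refine ⟨max C C0, (max_lt hC.lt_top hC0.lt_top).ne, fun j p hp F => ?_⟩
  cases j with
  | zero =>
    have := h0 1 le_rfl (levelSet 0) (fun ν hν => by
      rw [hχ1, if_neg]
      rintro rfl
      simp [levelSet] at hν) p F
    simp only [hχ1] at this
    refine this.trans ?_
    gcongr
    exact le_max_right _ _
  | succ j =>
    refine (h (4 ^ j) (one_le_pow₀ (by norm_num)) (levelSet (j + 1)) (fun ν hν => ?_) p F).trans ?_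
    · by_contra hne
      have h1 := (hs _ hne).2
      rw [div_lt_iff₀ (by positivity)] at h1
      apply hν
      rw [levelSet, Finset.mem_range]
      have : (ν : ℝ) < (4 ^ (j + 1) + 1 : ℕ) := by push_cast; rw [pow_succ]; linarith
      exact_mod_cast this
    · gcongr
      exact le_max_left _ _

theorem levelSym_eq_zero {b : ℝ → ℂ} (hs : ∀ t, b t ≠ 0 → 1 / 4 < t ∧ t < 4) {j ν : ℕ}
    (h : 4 * ν ≤ 4 ^ j) : levelSym b (j + 1) ν = 0 := by
  by_contra hne
  have h1 := (hs _ hne).1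
  rw [lt_div_iff₀ (by positivity)] at h1
  have : (4 : ℝ) * ν ≤ 4 ^ j := by exact_mod_cast h
  linarith

/-- Calderón's reproducing formula on the level of symbols. -/
theorem IsCutoff.exists_dual {a : ℝ → ℂ} (ha : IsCutoff a) :
    ∃ b : ℝ → ℂ, ContDiff ℝ ∞ b ∧ (∀ t, b t ≠ 0 → 1 / 4 < t ∧ t < 4) ∧
      ∀ ν J : ℕ, ν ≤ 4 ^ J →
        ∑ j ∈ Finset.range (J + 2), levelSym b j ν * levelSym a j ν = 1 := by
  obtain ⟨c, hc, hlow⟩ := ha.lower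
  have hz : ∀ t, (t ≤ 1 / 4 ∨ 4 ≤ t) → a t = 0 := fun t ht => by
    by_contra hne
    obtain ⟨h1, h2⟩ := ha.mem_Ioo hne
    rcases ht with h | h <;> linarith
  -- The dual is `b = conj a / A`. The three-term sum `A` is visibly smooth and equals the
  -- dilation-invariant sum `full` on `(1/4, 4)`, outside of which `a` vanishes.
  set A : ℝ → ℝ := fun t => ‖a (t / 4)‖ ^ 2 + ‖a t‖ ^ 2 + ‖a (4 * t)‖ ^ 2 with hA
  set full : ℝ → ℝ := fun t => ∑' i : ℤ, ‖a ((4 : ℝ) ^ i * t)‖ ^ 2 with hfull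
  -- One of `4t`, `t`, `t/4` always lies in `[1/3, 3]`, where `a` is bounded away from zero.
  have hApos : ∀ t, 1 / 4 ≤ t → t ≤ 4 → 0 < A t := by
    intro t h1 h2
    have hpos : ∀ s, 1 / 3 ≤ s → s ≤ 3 → 0 < ‖a s‖ ^ 2 := fun s h3 h4 => by
      have := hlow s ⟨h3, h4⟩
      exact pow_pos (hc.trans this) 2
    have e1 := sq_nonneg ‖a (t / 4)‖
    have e2 := sq_nonneg ‖a t‖
    have e3 := sq_nonneg ‖a (4 * t)‖
    simp only [hA]
    rcases le_or_gt t (1 / 3) with h3 | h3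
    · have := hpos (4 * t) (by linarith) (by linarith)
      linarith
    · rcases le_or_gt t 3 with h4 | h4
      · have := hpos t (by linarith) (by linarith)
        linarith
      · have := hpos (t / 4) (by linarith) (by linarith)
        linarith
  have hfullA : ∀ t, 1 / 4 < t → t < 4 → full t = A t := by
    intro t h1 h2
    simp only [hfull, hA]
    rw [tsum_eq_sum (s := {-1, 0, 1})]
    · rw [Finset.sum_insert (by decide), Finset.sum_insert (by decide), Finset.sum_singleton]
      simp only [zpow_neg_one, zpow_zero, one_mul, zpow_one]
      rw [inv_mul_eq_div, add_assoc]
    · intro i hi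
      simp only [Finset.mem_insert, Finset.mem_singleton, not_or] at hi
      have : a ((4 : ℝ) ^ i * t) = 0 := by
        apply hz
        rcases lt_or_ge i 0 with hneg | hpos
        · left
          have h3 : (4 : ℝ) ^ i ≤ 4 ^ (-2 : ℤ) := zpow_le_zpow_right₀ (by norm_num) (by omega)
          have h4 : (4 : ℝ) ^ (-2 : ℤ) = 1 / 16 := by norm_num
          have h5 : (0 : ℝ) < 4 ^ i := by positivity
          rw [h4] at h3
          nlinarith
        · right
          have h3 : (4 : ℝ) ^ (2 : ℤ) ≤ 4 ^ i := zpow_le_zpow_right₀ (by norm_num) (by omega)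
          have h4 : (4 : ℝ) ^ (2 : ℤ) = 16 := by norm_num
          rw [h4] at h3
          nlinarith
      rw [this]; simp
  have hshift : ∀ (k : ℕ) (t : ℝ), full (t / 4 ^ k) = full t := by
    intro k t
    simp only [hfull]
    rw [← (Equiv.addRight (k : ℤ)).tsum_eq (fun i : ℤ => ‖a ((4 : ℝ) ^ i * (t / 4 ^ k))‖ ^ 2)]
    refine tsum_congr fun i => ?_
    have : (4 : ℝ) ^ (Equiv.addRight (k : ℤ) i) * (t / 4 ^ k) = 4 ^ i * t := by
      rw [Equiv.coe_addRight, zpow_add₀ (by norm_num), zpow_natCast]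
      field_simp
    rw [this]
  -- For integers `1 ≤ ν ≤ 4^J` the scales `i > 0` give arguments `≥ 4`, and the scales `i < -J`
  -- give arguments `≤ 1/4`.
  have hsum : ∀ ν J : ℕ, 1 ≤ ν → ν ≤ 4 ^ J →
      ∑ k ∈ Finset.range (J + 1), ‖a ((ν : ℝ) / 4 ^ k)‖ ^ 2 = full ν := by
    intro ν J hν hJ
    have hν1 : (1 : ℝ) ≤ ν := by exact_mod_cast hν
    have hJ1 : (ν : ℝ) ≤ 4 ^ J := by exact_mod_cast hJ
    simp only [hfull]
    rw [tsum_eq_sum (s := (Finset.range (J + 1)).image fun k : ℕ => -(k : ℤ))]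
    · rw [Finset.sum_image fun _ _ _ _ h => by simpa using h]
      refine Finset.sum_congr rfl fun k _ => ?_
      rw [zpow_neg, zpow_natCast, inv_mul_eq_div]
    · intro i hi
      have : a ((4 : ℝ) ^ i * ν) = 0 := by
        apply hz
        rcases lt_or_ge 0 i with hpos | hneg
        · right
          have h3 : (4 : ℝ) ^ (1 : ℤ) ≤ 4 ^ i := zpow_le_zpow_right₀ (by norm_num) (by omega)
          rw [zpow_one] at h3
          nlinarith
        · left
          have hi' : i ≤ -((J : ℤ) + 1) := by
            by_contra hcon
            refine hi (Finset.mem_image.2 ⟨(-i).toNat, Finset.mem_range.2 (by omega), by omega⟩)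
          have h3 : (4 : ℝ) ^ i ≤ 4 ^ (-((J : ℤ) + 1)) := zpow_le_zpow_right₀ (by norm_num) hi'
          have h4 : (4 : ℝ) ^ (-((J : ℤ) + 1)) = 1 / (4 * 4 ^ J) := by
            rw [zpow_neg, zpow_add₀ (by norm_num), zpow_natCast, zpow_one, one_div, mul_comm]
          calc (4 : ℝ) ^ i * ν ≤ 1 / (4 * 4 ^ J) * 4 ^ J := by rw [← h4]; gcongr
            _ = 1 / 4 := by field_simp
      rw [this]; simp
  have hfullpos : ∀ ν : ℕ, 1 ≤ ν → 0 < full ν := by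
    intro ν hν
    have hν1 : (1 : ℝ) ≤ ν := by exact_mod_cast hν
    obtain ⟨k, hk1, hk2⟩ := exists_nat_pow_near hν1 (by norm_num : (1 : ℝ) < 4)
    have h1 : 1 ≤ (ν : ℝ) / 4 ^ k := by rw [le_div_iff₀ (by positivity)]; linarith
    have h2 : (ν : ℝ) / 4 ^ k < 4 := by
      rw [div_lt_iff₀ (by positivity)]; rw [pow_succ] at hk2; linarith
    rw [← hshift k, hfullA _ (by linarith) h2]
    exact hApos _ (by linarith) h2.le
  have hAsm : ContDiff ℝ ∞ fun t => ((A t : ℝ) : ℂ) := by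
    have hconj : ∀ z : ℂ, ((‖z‖ ^ 2 : ℝ) : ℂ) = Complex.conjCLE z * z := fun z => by
      rw [← Complex.normSq_eq_norm_sq, Complex.normSq_eq_conj_mul_self]; rfl
    have h1 := ha.smooth
    have hn : ∀ φ : ℝ → ℝ, ContDiff ℝ ∞ φ → ContDiff ℝ ∞ fun t => ((‖a (φ t)‖ ^ 2 : ℝ) : ℂ) := by
      intro φ hφ
      simp only [hconj]
      exact (Complex.conjCLE.contDiff.comp (h1.comp hφ)).mul (h1.comp hφ)
    simp only [hA, Complex.ofReal_add]
    exact ((hn (fun t => t / 4) (by fun_prop)).add (hn (fun t => t) (by fun_prop))).add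
      (hn (fun t => 4 * t) (by fun_prop))
  have hbsupp : ∀ t, Complex.conjCLE (a t) / ((A t : ℝ) : ℂ) ≠ 0 → 1 / 4 < t ∧ t < 4 := by
    intro t ht
    apply ha.mem_Ioo
    intro h0
    rw [h0] at ht
    simp at ht
  refine ⟨fun t => Complex.conjCLE (a t) / ((A t : ℝ) : ℂ), ?_, hbsupp, ?_⟩
  · rw [contDiff_iff_contDiffAt]
    intro t
    by_cases ht : t ∈ tsupport a
    · obtain ⟨h1, h2⟩ := ha.supp ht
      have hne : ((A t : ℝ) : ℂ) ≠ 0 := by exact_mod_cast (hApos t h1 h2).ne'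
      simp only [div_eq_mul_inv]
      exact (Complex.conjCLE.contDiff.comp ha.smooth).contDiffAt.mul
        (hAsm.contDiffAt.inv hne)
    -- Zeros of `A` do no harm here: off the closed support of `a` the quotient is locally zero,
    -- with the convention `x / 0 = 0`.
    · have h0 : (fun t => Complex.conjCLE (a t) / ((A t : ℝ) : ℂ)) =ᶠ[nhds t] fun _ => 0 := by
        filter_upwards [notMem_tsupport_iff_eventuallyEq.1 ht] with s hs
        rw [hs]; simp
      exact contDiffAt_const.congr_of_eventuallyEq h0
  · intro ν J hJ
    rcases Nat.eq_zero_or_pos ν with rfl | hν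
    · rw [Finset.sum_range_succ']
      have h0 : a 0 = 0 := hz 0 (by left; norm_num)
      simp [levelSym, h0]
    · rw [Finset.sum_range_succ']
      have hν0 : ν ≠ 0 := by omega
      simp only [levelSym, if_neg hν0, mul_zero, add_zero]
      have hterm : ∀ k ∈ Finset.range (J + 1),
          Complex.conjCLE (a ((ν : ℝ) / 4 ^ k)) / ((A ((ν : ℝ) / 4 ^ k) : ℝ) : ℂ) *
            a ((ν : ℝ) / 4 ^ k) = ((‖a ((ν : ℝ) / 4 ^ k)‖ ^ 2 / full ν : ℝ) : ℂ) := by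
        intro k _
        by_cases h0 : a ((ν : ℝ) / 4 ^ k) = 0
        · rw [h0]; simp
        · obtain ⟨h1, h2⟩ := ha.mem_Ioo h0
          rw [← hfullA _ h1 h2, hshift, div_mul_eq_mul_div, Complex.ofReal_div]
          congr 1
          rw [← Complex.normSq_eq_norm_sq, Complex.normSq_eq_conj_mul_self]
          rfl
      rw [Finset.sum_congr rfl hterm, ← Complex.ofReal_sum, ← Finset.sum_div, hsum ν J hν hJ,
        div_self (hfullpos ν hν).ne', Complex.ofReal_one]

/-! ### Sequence inequalities for the `ℓ^q` quasi-norm, `0 < q ≤ ∞`. -/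

theorem lqNorm_rpow {q : ℝ≥0∞} (hq : 0 < q) (hq' : q ≠ ⊤) (t : ℕ → ℝ≥0∞) :
    lqNorm q t ^ q.toReal = ∑' j, t j ^ q.toReal := by
  have h0 : 0 < q.toReal := ENNReal.toReal_pos hq.ne' hq'
  rw [lqNorm, if_neg hq', ← ENNReal.rpow_mul, one_div, inv_mul_cancel₀ h0.ne', ENNReal.rpow_one]

theorem lqNorm_le_of_tsum_le {q : ℝ≥0∞} (hq : 0 < q) (hq' : q ≠ ⊤) {t : ℕ → ℝ≥0∞} {K L : ℝ≥0∞}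
    (h : ∑' j, t j ^ q.toReal ≤ K * L ^ q.toReal) : lqNorm q t ≤ K ^ (1 / q.toReal) * L := by
  have h0 : 0 < q.toReal := ENNReal.toReal_pos hq.ne' hq'
  rw [lqNorm, if_neg hq']
  calc _ ≤ (K * L ^ q.toReal) ^ (1 / q.toReal) := ENNReal.rpow_le_rpow h (by positivity)
    _ = _ := by
      rw [ENNReal.mul_rpow_of_nonneg _ _ (by positivity), ← ENNReal.rpow_mul, mul_one_div,
        div_self h0.ne', ENNReal.rpow_one]

theorem le_lqNorm {q : ℝ≥0∞} (hq : 0 < q) (t : ℕ → ℝ≥0∞) (j : ℕ) : t j ≤ lqNorm q t := by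
  by_cases hq' : q = ⊤
  · rw [lqNorm, if_pos hq']
    exact le_iSup t j
  · have h0 : 0 < q.toReal := ENNReal.toReal_pos hq.ne' hq'
    rw [← ENNReal.rpow_le_rpow_iff h0, lqNorm_rpow hq hq']
    exact ENNReal.le_tsum j

theorem lqNorm_mono (q : ℝ≥0∞) {s t : ℕ → ℝ≥0∞} (h : ∀ j, s j ≤ t j) :
    lqNorm q s ≤ lqNorm q t := by
  unfold lqNorm
  split_ifs
  · exact iSup_mono h
  · gcongr with j
    exact h j

theorem lqNorm_const_mul {q : ℝ≥0∞} (hq : 0 < q) (c : ℝ≥0∞) (t : ℕ → ℝ≥0∞) :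
    lqNorm q (fun j => c * t j) = c * lqNorm q t := by
  unfold lqNorm
  split_ifs with hq'
  · rw [ENNReal.mul_iSup]
  · have h0 : 0 < q.toReal := ENNReal.toReal_pos hq.ne' hq'
    simp only [ENNReal.mul_rpow_of_nonneg _ _ h0.le, ENNReal.tsum_mul_left]
    rw [ENNReal.mul_rpow_of_nonneg _ _ (by positivity), ← ENNReal.rpow_mul, mul_one_div,
      div_self h0.ne', ENNReal.rpow_one]

theorem tsum_comp_add_le (w : ℕ → ℝ≥0∞) (c : ℕ) : ∑' m, w (m + c) ≤ ∑' m, w m :=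
  ENNReal.tsum_comp_le_tsum_of_injective (add_left_injective c) w

theorem tsum_comp_half (w : ℕ → ℝ≥0∞) : ∑' i : ℕ, w (i / 2) = 2 * ∑' m, w m := by
  rw [← tsum_even_add_odd (f := fun i : ℕ => w (i / 2)) ENNReal.summable ENNReal.summable, two_mul]
  congr 1
  · exact tsum_congr fun k => by congr 1; omega
  · exact tsum_congr fun k => by congr 1; omega

/-- A discrete Hardy inequality. -/
theorem exists_lqNorm_hardy {q : ℝ≥0∞} (hq : 0 < q) {σ : ℝ≥0∞} (hσ : σ < 1) :
    ∃ C : ℝ≥0∞, C ≠ ⊤ ∧ ∀ t : ℕ → ℝ≥0∞,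
      lqNorm q (fun i => ∑' l, σ ^ l * σ ^ l * t (i / 2 + 1 + l)) ≤ C * lqNorm q t := by
  set S : ℝ≥0∞ := ∑' l : ℕ, σ ^ l with hS
  have hStop : S ≠ ⊤ := by
    rw [hS, ENNReal.tsum_geometric]
    exact ENNReal.inv_ne_top.2 (tsub_pos_of_lt hσ).ne'
  -- One factor `σ^l` is summed to `S`; the other stays inside an `ℓ^q` norm in `l`, which dominates
  -- each of its terms. This replaces the triangle inequality and therefore covers `q < 1`.
  have hu : ∀ (t : ℕ → ℝ≥0∞) (i : ℕ), ∑' l, σ ^ l * σ ^ l * t (i / 2 + 1 + l) ≤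
      S * lqNorm q (fun l => σ ^ l * t (i / 2 + 1 + l)) := by
    intro t i
    rw [hS, ← ENNReal.tsum_mul_right]
    refine ENNReal.tsum_le_tsum fun l => ?_
    rw [mul_assoc]
    gcongr
    exact le_lqNorm hq (fun l => σ ^ l * t (i / 2 + 1 + l)) l
  by_cases hq' : q = ⊤
  · refine ⟨S, hStop, fun t => ?_⟩
    subst hq'
    refine (lqNorm_mono _ (hu t)).trans ?_
    rw [lqNorm_const_mul hq]
    gcongr
    simp only [lqNorm, if_true]
    refine iSup_le fun i => iSup_le fun l => ?_
    calc _ ≤ 1 * t (i / 2 + 1 + l) := by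
          gcongr
          exact pow_le_one' hσ.le l
      _ ≤ _ := by rw [one_mul]; exact le_iSup t _
  · have h0 : 0 < q.toReal := ENNReal.toReal_pos hq.ne' hq'
    have hτ : σ ^ q.toReal < 1 := ENNReal.rpow_lt_one hσ h0
    -- A geometric series in `σ^q`, times 2 because each value of `i / 2` is taken twice.
    set K : ℝ≥0∞ := (1 - σ ^ q.toReal)⁻¹ * 2
    have hK : K ≠ ⊤ := ENNReal.mul_ne_top (ENNReal.inv_ne_top.2 (tsub_pos_of_lt hτ).ne') (by simp)
    refine ⟨S * K ^ (1 / q.toReal), ENNReal.mul_ne_top hStop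
      (ENNReal.rpow_ne_top_of_nonneg (by positivity) hK), fun t => ?_⟩
    refine (lqNorm_mono _ (hu t)).trans ?_
    rw [lqNorm_const_mul hq, mul_assoc]
    gcongr
    refine lqNorm_le_of_tsum_le hq hq' ?_
    simp only [lqNorm_rpow hq hq']
    rw [ENNReal.tsum_comm]
    calc _ = ∑' l : ℕ, (σ ^ q.toReal) ^ l * ∑' i : ℕ, t (i / 2 + 1 + l) ^ q.toReal := by
          refine tsum_congr fun l => ?_
          rw [← ENNReal.tsum_mul_left]
          refine tsum_congr fun i => ?_
          rw [ENNReal.mul_rpow_of_nonneg _ _ h0.le, ← ENNReal.rpow_natCast, ← ENNReal.rpow_natCast,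
            ← ENNReal.rpow_mul, ← ENNReal.rpow_mul, mul_comm q.toReal]
      _ ≤ ∑' l : ℕ, (σ ^ q.toReal) ^ l * (2 * ∑' j, t j ^ q.toReal) := by
          refine ENNReal.tsum_le_tsum fun l => ?_
          gcongr
          rw [tsum_comp_half (fun m => t (m + 1 + l) ^ q.toReal)]
          refine mul_le_mul' le_rfl ?_
          simp only [add_assoc]
          exact tsum_comp_add_le (fun m => t m ^ q.toReal) (1 + l)
      _ = _ := by rw [ENNReal.tsum_mul_right, ENNReal.tsum_geometric, mul_assoc]

/-- Comparison of a sequence with the subsequence of odd index of another one, up to the first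
three terms. -/
theorem exists_lqNorm_le_of_shift {q : ℝ≥0∞} (hq : 0 < q) :
    ∃ K : ℝ≥0∞, K ≠ ⊤ ∧ ∀ (t v : ℕ → ℝ≥0∞) (A : ℝ≥0∞), (∀ j < 3, t j ≤ A) →
      (∀ i, t (i + 3) ≤ v (2 * i + 1)) → lqNorm q t ≤ K * (A + lqNorm q v) := by
  by_cases hq' : q = ⊤
  · refine ⟨1, by simp, fun t v A hA hv => ?_⟩
    subst hq'
    rw [one_mul]
    simp only [lqNorm, if_true]
    refine iSup_le fun j => ?_
    rcases lt_or_ge j 3 with h | h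
    · exact (hA j h).trans le_self_add
    · obtain ⟨i, rfl⟩ := Nat.exists_eq_add_of_le' h
      exact ((hv i).trans (le_iSup v _)).trans le_add_self
  · have h0 : 0 < q.toReal := ENNReal.toReal_pos hq.ne' hq'
    -- Three initial terms and the tail are each bounded by `(A + ‖v‖)^q`.
    refine ⟨4 ^ (1 / q.toReal), ENNReal.rpow_ne_top_of_nonneg (by positivity) (by simp),
      fun t v A hA hv => ?_⟩
    refine lqNorm_le_of_tsum_le hq hq' ?_
    rw [← Summable.sum_add_tsum_nat_add' (k := 3) ENNReal.summable]
    have h1 : ∑ j ∈ Finset.range 3, t j ^ q.toReal ≤ 3 * (A + lqNorm q v) ^ q.toReal := by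
      calc _ ≤ ∑ j ∈ Finset.range 3, (A + lqNorm q v) ^ q.toReal := by
            refine Finset.sum_le_sum fun j hj => ?_
            gcongr
            exact (hA j (Finset.mem_range.1 hj)).trans le_self_add
        _ = _ := by simp
    have h2 : ∑' i, t (i + 3) ^ q.toReal ≤ (A + lqNorm q v) ^ q.toReal := by
      calc _ ≤ ∑' i : ℕ, v (2 * i + 1) ^ q.toReal := by
            refine ENNReal.tsum_le_tsum fun i => ?_
            gcongr
            exact hv i
        _ ≤ ∑' i, v i ^ q.toReal := ENNReal.tsum_comp_le_tsum_of_injective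
            (f := fun i : ℕ => 2 * i + 1) (fun i j h => by simpa using h) (fun i => v i ^ q.toReal)
        _ = lqNorm q v ^ q.toReal := (lqNorm_rpow hq hq' v).symm
        _ ≤ _ := by
            gcongr
            exact le_add_self
    calc _ ≤ 3 * (A + lqNorm q v) ^ q.toReal + (A + lqNorm q v) ^ q.toReal := add_le_add h1 h2
      _ = _ := by ring

/-! ### The direct estimate: Besov norm by best approximation. -/

theorem multOp_eq_zero_of_mem_spaceV {T : Finset ℕ} {m : ℕ → ℂ} {n : ℕ}
    (hm : ∀ ν ≤ n, m ν = 0) (p : ℝ≥0∞) [Fact (1 ≤ p)] {g : 𝓢(EuclideanSpace ℝ (Fin d), ℂ)}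
    (hg : g ∈ spaceV d n) : multOp T m (Lp.toTemperedDistribution (g.toLp p volume)) = 0 := by
  refine Finset.sum_eq_zero fun ν _ => Finset.sum_eq_zero fun β hβ => ?_
  rw [toTemperedDistribution_toLp_hermiteS]
  rcases le_or_gt ν n with h | h
  · rw [hm ν h, zero_mul, zero_smul]
  · rw [hcoef_eq_zero_of_mem_spaceV hg (by rwa [(Finset.mem_piAntidiag.1 hβ).1]), mul_zero,
      zero_smul]

theorem enorm_toLp_schwartz (g : 𝓢(EuclideanSpace ℝ (Fin d), ℂ)) (p : ℝ≥0∞) :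
    ‖g.toLp p volume‖ₑ = eLpNorm g p volume := by
  rw [Lp.enorm_def]
  exact eLpNorm_congr_ae (g.coeFn_toLp p volume)

theorem enorm_sub_toLp_schwartz {p : ℝ≥0∞} (F : Lp ℂ p (volume : Measure (EuclideanSpace ℝ (Fin d))))
    (g : 𝓢(EuclideanSpace ℝ (Fin d), ℂ)) :
    ‖F - g.toLp p volume‖ₑ = eLpNorm (fun x => F x - g x) p volume := by
  rw [Lp.enorm_def]
  refine eLpNorm_congr_ae ?_
  filter_upwards [Lp.coeFn_sub F (g.toLp p volume), g.coeFn_toLp p volume] with x h1 h2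
  rw [h1, Pi.sub_apply, h2]

/-- A multiplier vanishing on the frequencies up to `n` is controlled by `E_n`. -/
theorem eLpNorm_multOp_le_bestApprox {T : Finset ℕ} {m : ℕ → ℂ} {n : ℕ}
    (hm : ∀ ν ≤ n, m ν = 0) {p : ℝ≥0∞} [Fact (1 ≤ p)] {C : ℝ≥0∞} (hC0 : C ≠ 0) (hC : C ≠ ⊤)
    (hb : ∀ F : Lp ℂ p (volume : Measure (EuclideanSpace ℝ (Fin d))),
      eLpNorm (multOp T m (Lp.toTemperedDistribution F)) p volume ≤ C * eLpNorm F p volume)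
    (F : Lp ℂ p (volume : Measure (EuclideanSpace ℝ (Fin d)))) :
    eLpNorm (multOp T m (Lp.toTemperedDistribution F)) p volume ≤ C * bestApprox n p F := by
  rw [← ENNReal.div_le_iff' hC0 hC]
  refine le_iInf₂ fun g hg => ?_
  rw [ENNReal.div_le_iff' hC0 hC, ← enorm_sub_toLp_schwartz, Lp.enorm_def]
  have h := hb (F - g.toLp p volume)
  have hsub : Lp.toTemperedDistribution (F - g.toLp p volume) =
      Lp.toTemperedDistribution F - Lp.toTemperedDistribution (g.toLp p volume) :=
    map_sub (Lp.toTemperedDistributionCLM ℂ volume p) F (g.toLp p volume)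
  rwa [hsub, multOp_sub, multOp_eq_zero_of_mem_spaceV hm p hg, sub_zero] at h

/-- The pieces `Φ_j * F` with `j < 3` are bounded by `‖F‖_p`. For `j = i + 3` the symbol vanishes on
frequencies up to `4^{i+1} ≥ 2^{2i+1}`, so `E_{2^{2i+1}}(F)_p` takes over, with weights comparable
up to `2^{3α}`. -/
theorem besovNorm_le_approxNorm (d : ℕ) {a : ℝ → ℂ} (ha : IsCutoff a) {α : ℝ} (hα : 0 < α)
    (p : ℝ≥0∞) [Fact (1 ≤ p)] {q : ℝ≥0∞} (hq : 0 < q) :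
    ∃ C : ℝ≥0∞, C ≠ ⊤ ∧ ∀ F : Lp ℂ p (volume : Measure (EuclideanSpace ℝ (Fin d))),
      besovNorm a α p q (Lp.toTemperedDistribution F) ≤ C * approxNorm (α / 2) p q F := by
  obtain ⟨C₁, hC₁, hb₁⟩ := exists_levelSym_bound d ha.smooth fun t ht => ha.mem_Ioo ht
  obtain ⟨K, hK, hlq⟩ := exists_lqNorm_le_of_shift hq
  -- Enlarged to be nonzero, as `eLpNorm_multOp_le_bestApprox` divides by it to reach the infimum.
  set C : ℝ≥0∞ := C₁ + 1 with hCdef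
  have hC0 : C ≠ 0 := by simp [hCdef]
  have hC : C ≠ ⊤ := by simp [hCdef, hC₁]
  have hb : ∀ (j : ℕ) (F : Lp ℂ p (volume : Measure (EuclideanSpace ℝ (Fin d)))),
      eLpNorm (multOp (levelSet j) (levelSym a j) (Lp.toTemperedDistribution F)) p volume ≤
        C * eLpNorm F p volume := fun j F => (hb₁ j p F).trans (by gcongr; exact le_self_add)
  have h2 : ∀ r : ℝ, (2 : ℝ≥0∞) ^ r ≠ ⊤ := fun r =>
    ENNReal.rpow_ne_top_of_ne_zero (by simp) (by simp)
  set M : ℝ≥0∞ := 2 ^ (α * 3) * C with hM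
  refine ⟨K * M, ENNReal.mul_ne_top hK (ENNReal.mul_ne_top (h2 _) hC), fun F => ?_⟩
  have key := hlq
    (fun j => (2 : ℝ≥0∞) ^ (α * (j : ℝ)) *
      eLpNorm (convPhi a j (Lp.toTemperedDistribution F)) p volume)
    (fun j => M * ((2 : ℝ≥0∞) ^ (α / 2 * (j : ℝ)) * bestApprox (2 ^ j) p F))
    (M * eLpNorm F p volume) ?_ ?_
  · rw [lqNorm_const_mul hq, ← mul_add, ← mul_assoc] at key
    exact key
  · intro j hj
    rw [convPhi_eq_multOp ha, hM, mul_assoc]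
    have hj3 : (j : ℝ) ≤ 3 := by exact_mod_cast hj.le
    gcongr
    · norm_num
    · exact hb j F
  · intro i
    have hbest := eLpNorm_multOp_le_bestApprox (T := levelSet (i + 3)) (n := 2 ^ (2 * i + 1))
      (m := levelSym a (i + 3)) (fun ν hν => levelSym_eq_zero (fun t ht => ha.mem_Ioo ht) (by
        calc 4 * ν ≤ 4 * 2 ^ (2 * i + 1) := by gcongr
          _ ≤ 4 ^ (i + 2) := by
            rw [pow_succ, pow_mul, pow_add]
            norm_num
            have := Nat.one_le_pow i 4 (by norm_num)
            omega)) hC0 hC (hb (i + 3)) F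
    calc _ ≤ (2 : ℝ≥0∞) ^ (α * ((i + 3 : ℕ) : ℝ)) * (C * bestApprox (2 ^ (2 * i + 1)) p F) := by
          rw [convPhi_eq_multOp ha]
          gcongr
      _ ≤ (2 ^ (α * 3) * 2 ^ (α / 2 * ((2 * i + 1 : ℕ) : ℝ))) *
            (C * bestApprox (2 ^ (2 * i + 1)) p F) := by
          gcongr
          rw [← ENNReal.rpow_add _ _ (by simp) (by simp)]
          refine ENNReal.rpow_le_rpow_of_exponent_le (by norm_num) ?_
          push_cast
          nlinarith
      _ = _ := by rw [hM]; ring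

/-! ### The converse estimate: reconstruction in `L^p` and approximation by partial sums. -/

theorem levelSym_eq_zero_of_notMem {a : ℝ → ℂ} (hs : ∀ t, a t ≠ 0 → 1 / 4 < t ∧ t < 4) {j ν : ℕ}
    (h : ν ∉ levelSet j) : levelSym a j ν = 0 := by
  have h' : 4 ^ j < ν := by simpa [levelSet] using h
  cases j with
  | zero => simp [levelSym, show ν ≠ 0 by omega]
  | succ j =>
    by_contra hne
    have h1 := (hs _ hne).2
    rw [div_lt_iff₀ (by positivity)] at h1
    have : (4 : ℝ) ^ (j + 1) < ν := by exact_mod_cast h'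
    rw [pow_succ] at this
    linarith

/-- A distribution whose Littlewood-Paley pieces are summable in `L^p` is an `L^p` function, well
approximated by the partial sums of its decomposition. -/
theorem exists_reconstruction (d : ℕ) {a : ℝ → ℂ} (ha : IsCutoff a) (p : ℝ≥0∞) [Fact (1 ≤ p)] :
    ∃ C : ℝ≥0∞, C ≠ ⊤ ∧ ∀ f : 𝓢'(EuclideanSpace ℝ (Fin d), ℂ),
      ∑' j, eLpNorm (convPhi a j f) p volume ≠ ⊤ →
      ∃ F : Lp ℂ p (volume : Measure (EuclideanSpace ℝ (Fin d))),
        Lp.toTemperedDistribution F = f ∧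
        eLpNorm F p volume ≤ C * ∑' j, eLpNorm (convPhi a j f) p volume ∧
        ∀ i, bestApprox (2 ^ i) p F ≤
          C * ∑' l, eLpNorm (convPhi a (i / 2 + 1 + l) f) p volume := by
  obtain ⟨b, hbs, hb, hdual⟩ := ha.exists_dual
  obtain ⟨C, hC, hbound⟩ := exists_levelSym_bound d hbs hb
  refine ⟨C, hC, fun f hf => ?_⟩
  set G : ℕ → Lp ℂ p (volume : Measure (EuclideanSpace ℝ (Fin d))) :=
    fun j => (multOp (levelSet j) (levelSym a j) f).toLp p volume with hG
  set D : ℕ → 𝓢(EuclideanSpace ℝ (Fin d), ℂ) :=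
    fun j => multOp (levelSet j) (levelSym b j) (Lp.toTemperedDistribution (G j)) with hD
  -- `E j` is the `j`-th Calderón piece: the dual multiplier `b` at level `j` applied to `Φ_j * f`.
  set E : ℕ → Lp ℂ p (volume : Measure (EuclideanSpace ℝ (Fin d))) :=
    fun j => (D j).toLp p volume with hE
  have hEn : ∀ j, ‖E j‖ₑ ≤ C * eLpNorm (convPhi a j f) p volume := by
    intro j
    rw [convPhi_eq_multOp ha, ← enorm_toLp_schwartz (multOp _ _ f), hE, enorm_toLp_schwartz,
      Lp.enorm_def]
    exact hbound j p (G j)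
  have hsum : Summable E := by
    refine Summable.of_enorm (ne_top_of_le_ne_top (ENNReal.mul_ne_top hC hf) ?_)
    rw [← ENNReal.tsum_mul_left]
    exact ENNReal.tsum_le_tsum hEn
  refine ⟨∑' j, E j, ?_, ?_, fun i => ?_⟩
  · refine temperedDistribution_ext fun γ => ?_
    set ν : ℕ := ∑ i, γ i with hν
    have h1 : HasSum (fun j => Lp.toTemperedDistribution (E j) (hermiteS γ))
        (Lp.toTemperedDistribution (∑' j, E j) (hermiteS γ)) := by
      have h := hsum.hasSum.mapL (Lp.toTemperedDistributionCLM ℂ volume p)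
      exact h.mapL (PointwiseConvergenceCLM.evalCLM (RingHom.id ℂ) ℂ (hermiteS γ))
    have h2 : ∀ j, Lp.toTemperedDistribution (E j) (hermiteS γ) =
        levelSym b j ν * levelSym a j ν * f (hermiteS γ) := by
      intro j
      rw [hE, toTemperedDistribution_toLp_hermiteS, hD, hcoef_multOp, hG,
        toTemperedDistribution_toLp_hermiteS, hcoef_multOp]
      split_ifs with hmem
      · ring
      · rw [levelSym_eq_zero_of_notMem hb hmem]; ring
    obtain ⟨J, hJ⟩ : ∃ J, ν ≤ 4 ^ J := ⟨ν, (Nat.lt_pow_self (by norm_num)).le⟩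
    simp only [h2] at h1
    -- Against a fixed Hermite function only finitely many levels contribute: for `ν ≤ 4^J` the
    -- symbols vanish from level `J + 2` on.
    rw [← h1.tsum_eq, tsum_eq_sum (s := Finset.range (J + 2)), ← Finset.sum_mul, hdual ν J hJ,
      one_mul]
    intro j hj
    obtain ⟨k, rfl⟩ := Nat.exists_eq_add_of_le (not_lt.1 (by simpa using hj) : J + 2 ≤ j)
    have h0 : levelSym b (J + 1 + k + 1) ν = 0 := levelSym_eq_zero hb (by
      calc 4 * ν ≤ 4 * 4 ^ J := by gcongr
        _ = 4 ^ (J + 1) := by ring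
        _ ≤ _ := Nat.pow_le_pow_right (by norm_num) (by omega))
    rw [show J + 2 + k = J + 1 + k + 1 by ring, h0, zero_mul, zero_mul]
  · rw [← Lp.enorm_def, ← ENNReal.tsum_mul_left]
    exact enorm_tsum_le_tsum_enorm.trans (ENNReal.tsum_le_tsum hEn)
  -- Levels `j ≤ i / 2` carry frequencies at most `4^j ≤ 2^i`, so this partial sum competes in the
  -- infimum and the error is the tail starting at `i / 2 + 1`.
  · have hmem : ∑ j ∈ Finset.range (i / 2 + 1), D j ∈ spaceV d (2 ^ i) := by
      refine Submodule.sum_mem _ fun j hj => multOp_mem_spaceV (fun ν hν => ?_) _ _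
      have hj' : 2 * j ≤ i := by have := Finset.mem_range.1 hj; omega
      calc ν ≤ 4 ^ j := by simpa [levelSet, Nat.lt_succ_iff] using hν
        _ = 2 ^ (2 * j) := by rw [pow_mul]; norm_num
        _ ≤ 2 ^ i := Nat.pow_le_pow_right (by norm_num) hj'
    refine (iInf₂_le _ hmem).trans ?_
    have hto : (∑ j ∈ Finset.range (i / 2 + 1), D j).toLp p volume =
        ∑ j ∈ Finset.range (i / 2 + 1), E j :=
      map_sum (SchwartzMap.toLpCLM ℂ ℂ p volume) D _
    rw [← enorm_sub_toLp_schwartz, hto, ← hsum.sum_add_tsum_nat_add (i / 2 + 1),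
      add_sub_cancel_left, ← ENNReal.tsum_mul_left]
    refine enorm_tsum_le_tsum_enorm.trans (ENNReal.tsum_le_tsum fun l => ?_)
    rw [add_comm l]
    exact hEn _

/-- With `t_j = 2^{αj} ‖Φ_j * f‖_p`, positivity of `α` makes `‖Φ_j * f‖_p = 2^{-αj} t_j` summable,
so `exists_reconstruction` applies. The weighted tails are then Hardy sums with ratio `2^{-α}`,
written as `σ²` to suit `exists_lqNorm_hardy`. -/
theorem approxNorm_le_besovNorm (d : ℕ) {a : ℝ → ℂ} (ha : IsCutoff a) {α : ℝ} (hα : 0 < α)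
    (p : ℝ≥0∞) [Fact (1 ≤ p)] {q : ℝ≥0∞} (hq : 0 < q) :
    ∃ C : ℝ≥0∞, C ≠ ⊤ ∧ ∀ f ∈ besovSpace d a α p q,
      ∃ F : Lp ℂ p (volume : Measure (EuclideanSpace ℝ (Fin d))),
        Lp.toTemperedDistribution F = f ∧
        approxNorm (α / 2) p q F ≤ C * besovNorm a α p q f := by
  obtain ⟨C, hC, hrec⟩ := exists_reconstruction d ha p
  set σ : ℝ≥0∞ := 2 ^ (-(α / 2)) with hσdef
  have hσ : σ < 1 := ENNReal.rpow_lt_one_of_one_lt_of_neg (by norm_num) (by linarith)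
  obtain ⟨C', hC', hhardy⟩ := exists_lqNorm_hardy hq hσ
  have hσσ : ∀ l : ℕ, σ ^ l * σ ^ l = (2 : ℝ≥0∞) ^ (-(α * (l : ℝ))) := by
    intro l
    rw [hσdef, ← ENNReal.rpow_natCast, ← ENNReal.rpow_mul,
      ← ENNReal.rpow_add _ _ (by simp) (by simp)]
    congr 1
    ring
  have hσσ1 : σ * σ < 1 := (mul_le_of_le_one_left' hσ.le).trans_lt hσ
  set S : ℝ≥0∞ := ∑' j : ℕ, σ ^ j * σ ^ j with hS
  have hStop : S ≠ ⊤ := by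
    simp only [hS, ← mul_pow]
    rw [ENNReal.tsum_geometric]
    exact ENNReal.inv_ne_top.2 (tsub_pos_of_lt hσσ1).ne'
  refine ⟨C * S + C * C', by finiteness, fun f hf => ?_⟩
  set N : ℕ → ℝ≥0∞ := fun j => eLpNorm (convPhi a j f) p volume with hN
  set t : ℕ → ℝ≥0∞ := fun j => (2 : ℝ≥0∞) ^ (α * (j : ℝ)) * N j with ht
  have hB : besovNorm a α p q f = lqNorm q t := rfl
  have hBtop : lqNorm q t ≠ ⊤ := (show besovNorm a α p q f < ⊤ from hf).ne
  have hNt : ∀ j, N j = σ ^ j * σ ^ j * t j := by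
    intro j
    rw [hσσ, ht, ← mul_assoc, ← ENNReal.rpow_add _ _ (by simp) (by simp), neg_add_cancel,
      ENNReal.rpow_zero, one_mul]
  have hNsum : ∑' j, N j ≤ S * lqNorm q t := by
    rw [hS, ← ENNReal.tsum_mul_right]
    refine ENNReal.tsum_le_tsum fun j => ?_
    rw [hNt]
    gcongr
    exact le_lqNorm hq t j
  obtain ⟨F, hFf, hF, hbest⟩ := hrec f (ne_top_of_le_ne_top (ENNReal.mul_ne_top hStop hBtop) hNsum)
  refine ⟨F, hFf, ?_⟩
  rw [hB, add_mul]
  refine add_le_add (hF.trans ?_) ?_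
  · rw [mul_assoc]
    gcongr
  · have hterm : ∀ i : ℕ, (2 : ℝ≥0∞) ^ (α / 2 * (i : ℝ)) * bestApprox (2 ^ i) p F ≤
        C * ∑' l, σ ^ l * σ ^ l * t (i / 2 + 1 + l) := by
      intro i
      calc _ ≤ (2 : ℝ≥0∞) ^ (α / 2 * (i : ℝ)) * (C * ∑' l, N (i / 2 + 1 + l)) := by
            gcongr
            exact hbest i
        _ = C * ∑' l, (2 : ℝ≥0∞) ^ (α / 2 * (i : ℝ)) * N (i / 2 + 1 + l) := by
            rw [ENNReal.tsum_mul_left]; ring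
        _ ≤ _ := by
            refine mul_le_mul' le_rfl (ENNReal.tsum_le_tsum fun l => ?_)
            rw [hσσ, ht, ← mul_assoc, ← ENNReal.rpow_add _ _ (by simp) (by simp)]
            gcongr
            · norm_num
            -- The weight `2^{αi/2}` is at most `2^{α(⌊i/2⌋ + 1)}`; the start of the tail at `⌊i/2⌋
            -- + 1` absorbs the rounding.
            · have hi : (i : ℝ) ≤ 2 * ((i / 2 : ℕ) : ℝ) + 1 := by
                exact_mod_cast (by omega : i ≤ 2 * (i / 2) + 1)
              push_cast
              nlinarith
    refine (lqNorm_mono q hterm).trans ?_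
    rw [lqNorm_const_mul hq, mul_assoc]
    gcongr
    exact hhardy t

theorem toTemperedDistribution_injective (p : ℝ≥0∞) [Fact (1 ≤ p)] :
    Function.Injective (fun F : Lp ℂ p (volume : Measure (EuclideanSpace ℝ (Fin d))) =>
      Lp.toTemperedDistribution F) :=
  LinearMap.ker_eq_bot.1 (Lp.ker_toTemperedDistributionCLM_eq_bot (F := ℂ)
    (μ := (volume : Measure (EuclideanSpace ℝ (Fin d)))) (p := p))

end HermiteBesov

/-- `B^{αq}_p = A^{α/2,q}_p` with equivalent norms, where `f ∈ L^p` is identified with the tempered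
distribution `φ ↦ ∫ f φ`. -/
theorem proposition5p7 (d : ℕ) (hd : 1 ≤ d) (a : ℝ → ℂ) (ha : HermiteBesov.IsCutoff a)
    (α : ℝ) (hα : 0 < α) (p : ℝ≥0∞) [hp : Fact (1 ≤ p)] (q : ℝ≥0∞) (hq : 0 < q) :
    HermiteBesov.besovSpace d a α p q =
      (fun f : Lp ℂ p (volume : Measure (EuclideanSpace ℝ (Fin d))) =>
        Lp.toTemperedDistribution f) '' HermiteBesov.approxSpace d (α / 2) p q ∧
    ∃ c C : ℝ, 0 < c ∧ 0 < C ∧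
      ∀ f ∈ HermiteBesov.approxSpace d (α / 2) p q,
        ENNReal.ofReal c * HermiteBesov.approxNorm (α / 2) p q f ≤
            HermiteBesov.besovNorm a α p q (Lp.toTemperedDistribution f) ∧
          HermiteBesov.besovNorm a α p q (Lp.toTemperedDistribution f) ≤
            ENNReal.ofReal C * HermiteBesov.approxNorm (α / 2) p q f := by
  obtain ⟨C₁, hC₁, h₁⟩ := HermiteBesov.besovNorm_le_approxNorm d ha hα p hq
  obtain ⟨C₂, hC₂, h₂⟩ := HermiteBesov.approxNorm_le_besovNorm d ha hα p hq
  have hmem : ∀ f ∈ HermiteBesov.approxSpace d (α / 2) p q,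
      Lp.toTemperedDistribution f ∈ HermiteBesov.besovSpace d a α p q := fun f hf =>
    (h₁ f).trans_lt (ENNReal.mul_lt_top hC₁.lt_top hf)
  refine ⟨Set.Subset.antisymm ?_ ?_, (C₂.toReal + 1)⁻¹, C₁.toReal + 1, by positivity,
    by positivity, fun f hf => ⟨?_, ?_⟩⟩
  · intro f hf
    obtain ⟨F, hF, hle⟩ := h₂ f hf
    exact ⟨F, hle.trans_lt (ENNReal.mul_lt_top hC₂.lt_top hf), hF⟩
  · rintro _ ⟨f, hf, rfl⟩
    exact hmem f hf
  · obtain ⟨F, hF, hle⟩ := h₂ _ (hmem f hf)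
    -- The converse estimate yields some `L^p` representative of the distribution; injectivity of
    -- the embedding makes it the given `f`.
    obtain rfl : F = f := HermiteBesov.toTemperedDistribution_injective p hF
    have hpos : 0 < C₂.toReal + 1 := by positivity
    rw [ENNReal.ofReal_inv_of_pos hpos, mul_comm, ← div_eq_mul_inv]
    refine ENNReal.div_le_of_le_mul' (hle.trans ?_)
    gcongr
    rw [← ENNReal.ofReal_toReal hC₂, ENNReal.toReal_ofReal ENNReal.toReal_nonneg]
    exact ENNReal.ofReal_le_ofReal (by linarith)
  · refine (h₁ f).trans ?_
    gcongr
    rw [← ENNReal.ofReal_toReal hC₁, ENNReal.toReal_ofReal ENNReal.toReal_nonneg]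
    exact ENNReal.ofReal_le_ofReal (by linarith)
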